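/- Let $(M,g_{ab})$ be a smooth (in particular, possibly real-analytic) Lorentzian 4-manifold of signature $(+,-,-,-)$ with Levi-Civita connection and spinor derivative $\nabla_{AA'}$, Weyl spinor $\Psi_{ABCD}$, and a global smooth spin dyad $(o^A,\iota^A)$, $o_A\iota^A=1$ (so that the spin bundle is trivial and comes from a global orthonormal frame). Penrose–Rindler conventions are used: $\kappa_B=\kappa^A\epsilon_{AB}$, $(\nabla_a\nabla_b-\nabla_b\nabla_a)V^d=R_{abc}{}^dV^c$; all spinor and scalar fields are complex and smooth. Suppose that $o^A$ is a shear-free ray, $o^Ao^B\nabla_{AA'}o_B=0$, and a repeated principal spinor, $\Psi_{ABCD}o^Bo^Co^D=0$. Put $\Psi_2=\Psi_{ABCD}o^Ao^B\iota^C\iota^D$ and $\Psi_3=\Psi_{ABCD}o^A\iota^B\iota^C\iota^D$. With $\ell_a=o_A\bar o_{A'}$, $n_a=\iota_A\bar\iota_{A'}$, $m_a=o_A\bar\iota_{A'}$ and the spin coefficients of the dyad in GHP notation, let $$\omega_a=-\epsilon n_a+\epsilon'\ell_a-\beta'm_a+\beta\bar m_a,\qquad B_a=-\rho n_a+\tau\bar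 m_a,\qquad f_a=\rho n_a+\rho'\ell_a-\tau'm_a-\tau\bar m_a ,$$ and for a scalar $\psi$ of GHP weight $\{p,0\}$ and conformal weight $w$ let $\tilde{\mathcal C}_{A'}\psi=o^A\big(\nabla_{AA'}\psi+(wf_{AA'}+p(\omega_{AA'}+B_{AA'}))\psi\big)$. A pair of functions $(\phi,\eta)$, $\phi$ nowhere zero and of weights $\{0,0\}$, $w=-1$, $\eta$ of weights $\{-2,0\}$, $w=-1$, is called a potential pair if $$f_{AA'}=\phi^{-1}\nabla_{AA'}\phi-o_A\tilde{\mathcal C}_{A'}\eta .$$ A symmetric $K_{AB}=K_2o_Ao_B-2K_1o_{(A}\iota_{B)}+K_0\iota_A\iota_B$ is a projected Killing spinor if $o^A\nabla_{A'(A}K_{BC)}=0$. A symmetric $\varphi_{AB}$ is called a Maxwell field if $\nabla^{AA'}\varphi_{AB}=0$. **1. General case.** Let $(\phi,\eta)$ be a potential pair and $K_{AB}$ a projected Killing spinor such that at every point $\Psi_2\ne0$ or $K_0=0$, and $K_1=c\phi^{-1}$ with a constant $c\in\mathbb C$, possibly zero. Then $\varphi_{AB}=-2\phi^3K_{AB}$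 is a Maxwell field, and the 2-form $\mathcal F_{ab}=\varphi_{AB}\bar\epsilon_{A'B'}$ is closed, $\mathrm d\mathcal F=0$. **2. Einstein case.** Suppose in addition that $R_{ab}=k\,g_{ab}$ with a constant $k$, and that $\Psi_2$ vanishes nowhere. (a) For every projected Killing spinor $K_{AB}$, the field $\Psi_{ABCD}K^{CD}$ is a Maxwell field, and $\Psi_{ABCD}K^{CD}\bar\epsilon_{A'B'}$ is closed. Now let $\phi$ be a smooth function with $\phi^3=\Psi_2$, and $\eta=\Psi_3/(3\Psi_2)$. (b) $(\phi,\eta)$ is a potential pair. (c) If $K_{AB}$ is a projected Killing spinor with $K_1=c\phi^{-1}$, $c$ constant, then $-2\Psi_2K_{AB}$ is a Maxwell field and $-2\Psi_2K_{AB}\bar\epsilon_{A'B'}$ is closed. It equals the spin-lowering field, $-2\Psi_2K_{AB}=\Psi_{ABCD}K^{CD}$, if and only if $$K_{AB}=-2c\,\phi^{-1}\big(o_{(A}\iota_{B)}-\eta\,o_Ao_B\big).\qquad(*)$$ (d) For every constant $c$, the field $(*)$ is a projected Killing spinor with $K_1=c\phi^{-1}$ and $-2\Psi_2K_{AB}=\Psi_{ABCD}K^{CD}=:\varphi_{AB}$.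 The components $\varphi_{AB}o^Ao^B$, $\varphi_{AB}o^A\iota^B$, $\varphi_{AB}\iota^A\iota^B$ are $0$, $-2c\,\Psi_2^{2/3}$ and $-2c\cdot\frac{2\Psi_3}{3\Psi_2^{1/3}}$ (where $\Psi_2^{1/3}=\phi$), and with $\hat\iota^A=\iota^A-\eta\,o^A$ one has $\varphi_{AB}=4c\,\Psi_2^{2/3}o_{(A}\hat\iota_{B)}$. (e) (Sachs' conservation law.) The dyad $(o^A,\hat\iota^A)$ satisfies $\Psi_{ABCD}o^A\hat\iota^B\hat\iota^C\hat\iota^D=0$, and $\mathrm d\big(\Psi_2^{2/3}o_{(A}\hat\iota_{B)}\bar\epsilon_{A'B'}\big)=0$. In particular, if $\Psi_3=0$, then $\mathrm d\big(\Psi_2^{2/3}o_{(A}\iota_{B)}\bar\epsilon_{A'B'}\big)=0$. -/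

import Mathlib

open scoped Manifold ContDiff ComplexConjugate

noncomputable section

namespace TwoSpinor

/-! ### Lorentzian geometry in an orthonormal frame -/

/-- The Minkowski matrix `diag(1,-1,-1,-1)`; it is its own inverse. -/
def eta (a b : Fin 4) : ℝ := if a = b then (if a = 0 then 1 else -1) else 0

/-- A smooth vector field on a 4-manifold. -/
def SmoothVectorField {M : Type*} [TopologicalSpace M]
    [ChartedSpace (EuclideanSpace ℝ (Fin 4)) M] [IsManifold (𝓡 4) ∞ M]
    (X : (x : M) → TangentSpace (𝓡 4) x) : Prop :=
  ContMDiff (𝓡 4) (𝓡 4).tangent ∞ (fun x => (⟨x, X x⟩ : TangentBundle (𝓡 4) M))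

/-- A Lorentzian 4-manifold of signature `(+,-,-,-)` whose spin bundle is trivialised: the
trivialisation is given by a smooth orthonormal frame `frame 0, …, frame 3`, with which a spin
frame of the (then trivial) bundle `𝕊 = M × ℂ²` is associated through the Infeld–van der Waerden
symbols below. A spacetime with a global spin dyad is always of this form. The smoothness of the
metric follows from that of the frame. -/
structure SpinSpacetime (M : Type*) [TopologicalSpace M]
    [ChartedSpace (EuclideanSpace ℝ (Fin 4)) M] [IsManifold (𝓡 4) ∞ M] where
  /-- the metric `g_{ab}` -/
  metric : (x : M) → TangentSpace (𝓡 4) x →L[ℝ] TangentSpace (𝓡 4) x →L[ℝ] ℝ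
  metric_symm : ∀ x u v, metric x u v = metric x v u
  /-- the orthonormal frame `E_a` -/
  frame : Fin 4 → (x : M) → TangentSpace (𝓡 4) x
  frame_smooth : ∀ a, SmoothVectorField (frame a)
  frame_orthonormal : ∀ x a b, metric x (frame a x) (frame b x) = eta a b

/-- The derivative of the function `f` along the vector field `X`. -/
def dirDeriv {M : Type*} [TopologicalSpace M] [ChartedSpace (EuclideanSpace ℝ (Fin 4)) M]
    {F : Type*} [NormedAddCommGroup F] [NormedSpace ℝ F]
    (X : (x : M) → TangentSpace (𝓡 4) x) (f : M → F) (x : M) : F :=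
  mvfderiv (𝓡 4) f x (X x)

/-- The exterior derivative of the complex-valued 2-form `F` vanishes. -/
def IsClosedTwoForm {M : Type*} [TopologicalSpace M]
    [ChartedSpace (EuclideanSpace ℝ (Fin 4)) M] [IsManifold (𝓡 4) ∞ M]
    (F : (x : M) → TangentSpace (𝓡 4) x → TangentSpace (𝓡 4) x → ℂ) : Prop :=
  ∀ X Y Z : (x : M) → TangentSpace (𝓡 4) x,
    SmoothVectorField X → SmoothVectorField Y → SmoothVectorField Z → ∀ x : M,
      dirDeriv X (fun y => F y (Y y) (Z y)) x
        + dirDeriv Y (fun y => F y (Z y) (X y)) x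
        + dirDeriv Z (fun y => F y (X y) (Y y)) x
        - F x (VectorField.mlieBracket (𝓡 4) X Y x) (Z x)
        - F x (VectorField.mlieBracket (𝓡 4) Y Z x) (X x)
        - F x (VectorField.mlieBracket (𝓡 4) Z X x) (Y x) = 0

/-! ### Spinor algebra

Unprimed spinor indices take values in `Fin 2`; a primed index is the complex conjugate of an
unprimed one. The field `o^A` is given by its upper components `M → Fin 2 → ℂ`, all fields with two
or more indices by their lower ones. -/

/-- `ε_{AB}`, and also `ε^{AB}`, `ε_{A'B'}` and `ε^{A'B'}`. -/
def eps (A B : Fin 2) : ℂ := (!![0, 1; -1, 0] : Matrix (Fin 2) (Fin 2) ℂ) A B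

/-- `κ_B = κ^A ε_{AB}`. -/
def low (κ : Fin 2 → ℂ) (B : Fin 2) : ℂ := ∑ A, κ A * eps A B

/-- `K^{AB} = ε^{AC} ε^{BD} K_{CD}`. -/
def raise₂ (K : Fin 2 → Fin 2 → ℂ) (A B : Fin 2) : ℂ := ∑ C, ∑ D, eps A C * eps B D * K C D

/-- The lower components of `κ_{(A} μ_{B)}`. -/
def symProd (κ μ : Fin 2 → ℂ) (A B : Fin 2) : ℂ :=
  (low κ A * low μ B + low κ B * low μ A) / 2

/-- The Infeld–van der Waerden symbols `σ_a^{AA'}`: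
`ε_{AB} ε_{A'B'} σ_a^{AA'} σ_b^{BB'} = η_{ab}`. -/
def ivdw (a : Fin 4) (A A' : Fin 2) : ℂ :=
  ((Real.sqrt 2 : ℝ) : ℂ)⁻¹ *
    (![!![1, 0; 0, 1], !![0, 1; 1, 0], !![0, Complex.I; -Complex.I, 0], !![1, 0; 0, -1]] :
      Fin 4 → Matrix (Fin 2) (Fin 2) ℂ) a A A'

/-- The inverse Infeld–van der Waerden symbols `σ^a_{AA'} = η^{ab} σ_b^{BB'} ε_{BA} ε_{B'A'}`. -/
def ivdwInv (a : Fin 4) (A A' : Fin 2) : ℂ :=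
  ∑ b, ∑ B, ∑ B', (eta a b : ℂ) * ivdw b B B' * eps B A * eps B' A'

/-- `K_0 = K_{AB} o^A o^B`, `K_1 = K_{AB} o^A ι^B`, `K_2 = K_{AB} ι^A ι^B` are
`comp₂ K o o`, `comp₂ K o ι`, `comp₂ K ι ι`. If `o_A ι^A = 1` and `K` is symmetric, then
`K_{AB} = K_2 o_A o_B - 2 K_1 o_{(A} ι_{B)} + K_0 ι_A ι_B`. -/
def comp₂ (K : Fin 2 → Fin 2 → ℂ) (κ μ : Fin 2 → ℂ) : ℂ := ∑ A, ∑ B, K A B * κ A * μ B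

namespace SpinSpacetime

variable {M : Type*} [TopologicalSpace M] [ChartedSpace (EuclideanSpace ℝ (Fin 4)) M]
  [IsManifold (𝓡 4) ∞ M] (S : SpinSpacetime M)

/-! ### Levi-Civita connection and curvature -/

/-- `g(∇_X Y, Z)` for the Levi-Civita connection, by the Koszul formula. -/
def koszul (X Y Z : (x : M) → TangentSpace (𝓡 4) x) (x : M) : ℝ :=
  (dirDeriv X (fun y => S.metric y (Y y) (Z y)) x
    + dirDeriv Y (fun y => S.metric y (X y) (Z y)) x
    - dirDeriv Z (fun y => S.metric y (X y) (Y y)) x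
    + S.metric x (VectorField.mlieBracket (𝓡 4) X Y x) (Z x)
    - S.metric x (VectorField.mlieBracket (𝓡 4) X Z x) (Y x)
    - S.metric x (VectorField.mlieBracket (𝓡 4) Y Z x) (X x)) / 2

/-- The connection coefficients `Γ_{ab}{}^c`: `∇_{E_a} E_b = Γ_{ab}{}^c E_c`. -/
def conn (a b c : Fin 4) (x : M) : ℝ :=
  eta c c * S.koszul (S.frame a) (S.frame b) (S.frame c) x

/-- The frame components of a tangent vector: `u = u^a E_a`. -/
def coord (x : M) (u : TangentSpace (𝓡 4) x) (a : Fin 4) : ℝ :=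
  eta a a * S.metric x u (S.frame a x)

/-- The frame components `R_{abc}{}^d` of the Riemann tensor, with the convention
`(∇_a ∇_b - ∇_b ∇_a) V^d = R_{abc}{}^d V^c`. -/
def riemann (a b c d : Fin 4) (x : M) : ℝ :=
  dirDeriv (S.frame a) (S.conn b c d) x - dirDeriv (S.frame b) (S.conn a c d) x
    + ∑ e, (S.conn b c e x * S.conn a e d x - S.conn a c e x * S.conn b e d x
      - S.coord x (VectorField.mlieBracket (𝓡 4) (S.frame a) (S.frame b) x) e * S.conn e c d x)

/-- The frame components `R_{ac} = R_{abc}{}^b` of the Ricci tensor. -/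
def ricci (a c : Fin 4) (x : M) : ℝ := ∑ b, S.riemann a b c b x

/-- The Einstein condition (vacuum with cosmological constant): `R_{ab} = k g_{ab}` for a
constant `k`. -/
def IsEinstein : Prop := ∃ k : ℝ, ∀ a c x, S.ricci a c x = k * eta a c

/-- `X_{ABCD} = ¼ R_{AA'BB'CC'DD'} ε^{A'B'} ε^{C'D'}`. -/
def curvX (A B C D : Fin 2) (x : M) : ℂ :=
  (∑ a, ∑ b, ∑ c, ∑ d, ∑ A', ∑ B', ∑ C', ∑ D',
    ivdwInv a A A' * ivdwInv b B B' * ivdwInv c C C' * ivdwInv d D D' *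
      eps A' B' * eps C' D' * ((S.riemann a b c d x * eta d d : ℝ) : ℂ)) / 4

/-- The Weyl spinor `Ψ_{ABCD} = X_{(ABCD)}`. (Since `X_{ABCD} = X_{(AB)(CD)} = X_{CDAB}`, the
symmetrisation is the average of the following three terms.) -/
def weyl (A B C D : Fin 2) (x : M) : ℂ :=
  (S.curvX A B C D x + S.curvX A C B D x + S.curvX A D B C x) / 3

/-- `Ψ_{ABCD} κ^A μ^B ν^C π^D`; the Weyl scalars of a dyad are `Ψ_2 = weylComp o o ι ι` and
`Ψ_3 = weylComp o ι ι ι`. -/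
def weylComp (κ μ ν π : M → Fin 2 → ℂ) (x : M) : ℂ :=
  ∑ A, ∑ B, ∑ C, ∑ D, S.weyl A B C D x * κ x A * μ x B * ν x C * π x D

/-- `Ψ_{ABCD} K^{CD}`. -/
def weylContract (K : M → Fin 2 → Fin 2 → ℂ) (x : M) (A B : Fin 2) : ℂ :=
  ∑ C, ∑ D, S.weyl A B C D x * raise₂ (K x) C D

/-! ### The spinor covariant derivative -/

/-- The spin connection `γ_{aB}{}^C = ½ σ^b_{BX'} σ_c^{CX'} Γ_{ab}{}^c`. It is the trace-free
`γ` with `Γ_{aBB'}{}^{CC'} = γ_{aB}{}^C δ_{B'}{}^{C'} + γ̄_{aB'}{}^{C'} δ_B{}^C`. -/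
def spinConn (a : Fin 4) (B C : Fin 2) (x : M) : ℂ :=
  (∑ b, ∑ c, ∑ X', ivdwInv b B X' * ivdw c C X' * (S.conn a b c x : ℂ)) / 2

/-- `∂_{AA'} f = σ^a_{AA'} E_a(f)` for a complex function `f`. -/
def nabla₀ (f : M → ℂ) (A A' : Fin 2) (x : M) : ℂ :=
  ∑ a, ivdwInv a A A' * dirDeriv (S.frame a) f x

/-- `∇_{AA'} κ_B` for a spinor field with lower components `κ_B`. -/
def nabla₁ (κ : M → Fin 2 → ℂ) (A A' B : Fin 2) (x : M) : ℂ :=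
  ∑ a, ivdwInv a A A' *
    (dirDeriv (S.frame a) (fun y => κ y B) x - ∑ D, S.spinConn a B D x * κ x D)

/-- `∇_{AA'} K_{BC}` for a spinor field with lower components `K_{BC}`. -/
def nabla₂ (K : M → Fin 2 → Fin 2 → ℂ) (A A' B C : Fin 2) (x : M) : ℂ :=
  ∑ a, ivdwInv a A A' *
    (dirDeriv (S.frame a) (fun y => K y B C) x
      - ∑ D, S.spinConn a B D x * K x D C - ∑ D, S.spinConn a C D x * K x B D)

/-- `o^A` is a shear-free ray: `o^A o^B ∇_{AA'} o_B = 0`. -/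
def IsShearFreeRay (o : M → Fin 2 → ℂ) : Prop :=
  ∀ A' x, ∑ A, ∑ B, o x A * o x B * S.nabla₁ (fun y => low (o y)) A A' B x = 0

/-- `o^A` is a repeated principal spinor: `Ψ_{ABCD} o^B o^C o^D = 0`. -/
def IsRepeatedPrincipal (o : M → Fin 2 → ℂ) : Prop :=
  ∀ A x, ∑ B, ∑ C, ∑ D, S.weyl A B C D x * o x B * o x C * o x D = 0

/-- The projected Killing spinor equation `o^A ∇_{A'(A} K_{BC)} = 0` for a symmetric `K_{AB}`. -/
def IsProjectedKilling (o : M → Fin 2 → ℂ) (K : M → Fin 2 → Fin 2 → ℂ) : Prop :=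
  (∀ x A B, K x A B = K x B A) ∧
  ∀ A' B C x, ∑ A, o x A *
    ((S.nabla₂ K A A' B C x + S.nabla₂ K B A' C A x + S.nabla₂ K C A' A B x) / 3) = 0

/-- The vacuum Maxwell equations `∇^{AA'} φ_{AB} = 0` for a symmetric `φ_{AB}`. -/
def IsMaxwell (φ : M → Fin 2 → Fin 2 → ℂ) : Prop :=
  (∀ x A B, φ x A B = φ x B A) ∧
  ∀ A' B x, ∑ A, ∑ C, ∑ C', eps A C * eps A' C' * S.nabla₂ φ C C' A B x = 0

/-- The complex 2-form `F_{ab} = φ_{AB} ε_{A'B'}`. -/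
def maxwellForm (φ : M → Fin 2 → Fin 2 → ℂ) (x : M) (u v : TangentSpace (𝓡 4) x) : ℂ :=
  ∑ a, ∑ b, ∑ A, ∑ A', ∑ B, ∑ B', φ x A B * eps A' B' *
    ivdw a A A' * ivdw b B B' * (S.coord x u a : ℂ) * (S.coord x v b : ℂ)

/-! ### The conformal-GHP connection of a dyad -/

/-- `κ^A μ̄^{A'} ν^B ∇_{AA'} π_B`. -/
def spinCoeff (κ μ ν π : M → Fin 2 → ℂ) (x : M) : ℂ :=
  ∑ A, ∑ A', ∑ B, κ x A * conj (μ x A') * ν x B * S.nabla₁ (fun y => low (π y)) A A' B x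

/-- `ω_a = -ε n_a + ε' ℓ_a - β' m_a + β m̄_a`, where `ℓ_a = o_A ō_{A'}`, `n_a = ι_A ῑ_{A'}`,
`m_a = o_A ῑ_{A'}`, `m̄_a = ι_A ō_{A'}` and, with `D = ℓ^a ∇_a`, `D' = n^a ∇_a`, `δ = m^a ∇_a`,
`δ' = m̄^a ∇_a`, the spin coefficients are `ε = ι^A D o_A`, `ε' = -ι^A D' o_A`,
`β = ι^A δ o_A`, `β' = -ι^A δ' o_A`. -/
def formω (o ι : M → Fin 2 → ℂ) (A A' : Fin 2) (x : M) : ℂ :=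
  - S.spinCoeff o o ι o x * (low (ι x) A * conj (low (ι x) A'))
  + (- S.spinCoeff ι ι ι o x) * (low (o x) A * conj (low (o x) A'))
  - (- S.spinCoeff ι o ι o x) * (low (o x) A * conj (low (ι x) A'))
  + S.spinCoeff o ι ι o x * (low (ι x) A * conj (low (o x) A'))

/-- `B_a = -ρ n_a + τ m̄_a`, where `ρ = o^A δ' o_A` and `τ = o^A D' o_A`. -/
def formB (o ι : M → Fin 2 → ℂ) (A A' : Fin 2) (x : M) : ℂ :=
  - S.spinCoeff ι o o o x * (low (ι x) A * conj (low (ι x) A'))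
  + S.spinCoeff ι ι o o x * (low (ι x) A * conj (low (o x) A'))

/-- `f_a = ρ n_a + ρ' ℓ_a - τ' m_a - τ m̄_a`, where `ρ' = -ι^A δ ι_A` and `τ' = -ι^A D ι_A`. -/
def formf (o ι : M → Fin 2 → ℂ) (A A' : Fin 2) (x : M) : ℂ :=
  S.spinCoeff ι o o o x * (low (ι x) A * conj (low (ι x) A'))
  + (- S.spinCoeff o ι ι ι x) * (low (o x) A * conj (low (o x) A'))
  - (- S.spinCoeff o o ι ι x) * (low (o x) A * conj (low (ι x) A'))
  - S.spinCoeff ι ι o o x * (low (ι x) A * conj (low (o x) A'))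

/-- The conformal-GHP derivative `𝒞_{AA'} ψ` of a scalar of GHP weight `{p,0}` and conformal
weight `w`. -/
def confGHP (o ι : M → Fin 2 → ℂ) (p w : ℤ) (ψ : M → ℂ) (A A' : Fin 2) (x : M) : ℂ :=
  S.nabla₀ ψ A A' x
    + (w * S.formf o ι A A' x + p * (S.formω o ι A A' x + S.formB o ι A A' x)) * ψ x

/-- `𝒞̃_{A'} ψ = o^A 𝒞_{AA'} ψ`. -/
def confGHPTilde (o ι : M → Fin 2 → ℂ) (p w : ℤ) (ψ : M → ℂ) (A' : Fin 2) (x : M) : ℂ :=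
  ∑ A, o x A * S.confGHP o ι p w ψ A A' x

/-- `f_{AA'} = ∇_{AA'} log φ - o_A 𝒞̃_{A'} η` with `φ` nowhere zero, `η` of GHP weight `{-2,0}` and
conformal weight `-1`; here `∇_{AA'} log φ = φ⁻¹ ∇_{AA'} φ`. -/
def IsPotentialPair (o ι : M → Fin 2 → ℂ) (φ η : M → ℂ) : Prop :=
  (∀ x, φ x ≠ 0) ∧
  ∀ A A' x, S.formf o ι A A' x =
    (φ x)⁻¹ * S.nabla₀ φ A A' x - low (o x) A * S.confGHPTilde o ι (-2) (-1) η A' x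

end SpinSpacetime

end TwoSpinor

end

open TwoSpinor

/-! All geometry is reduced to polynomial identities over the algebra `smoothFn M`. Frame vectors
act on it as derivations, and the Levi-Civita connection enters only through four facts: vanishing
torsion, metricity, the commutator of frame vectors and the Jacobi identity. Spinor identities are
verified in components with the explicit Infeld–van der Waerden symbols.

Write `s` for `ι^A o^B ∇_{AA'} o_B` (in Lean `S.sc ι o o`). A projected Killing spinor satisfies `Ψ₂
K₀ = 0` (`weylComp_mul_comp₂`): the symmetrised derivative `∇_{A'(A} K_{BC)}` is annihilated by `o`,
hence proportional to `o_A o_B o_C`, so its derivative vanishes when contracted twice with `o`. The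
primed trace of this second-order condition contains only commutators, and for a repeated principal
spinor the curvature term left over is a multiple of `Ψ₂ K₀`. Therefore `K₀ = 0` in all cases
considered.

For `K₀ = 0` and a shear-free `o`, both equations become a pair of transport equations along `o^A
∇_{AA'}` (`killing_components`, `maxwell_components`). The first ones are `o·∇K₁ = -s K₁` and `o·∇φ₁
= 2 s φ₁`. The second ones differ only in that the Killing equation contains `ι·∇K₁ + s K₂` with
coefficient `2`, and Maxwell's equation contains `ι·∇φ₁ + s φ₂` with coefficient `-1`. A function
with `o·∇φ = s φ` repairs exactly this: multiplication by `φ³` shifts the weight of `s` by `3`, and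
since `K₁ φ` is constant, `2 φ³ ι·∇K₁ = -ι·∇(φ³ K₁)`. Hence `φ³ K` solves Maxwell's equations
(`isMaxwell_mul`).

In an Einstein space the spin curvature is the 2-form `X_{ABCE} ε_{A'B'}`, and the second Bianchi
identity makes the Weyl spinor divergence-free (`maxwellOp_Ψ`). In components, `o·∇Ψ₂ = 3 s Ψ₂`, and
a second equation gives `ι·∇Ψ₂` in terms of `Ψ₃`. They say that `Ψ₂^{1/3}` and `Ψ₃ / (3 Ψ₂)` form a
potential pair, and they turn the Killing equations into Maxwell's equations for `Ψ_{ABCD} K^{CD}`,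
whose components are `0`, `-2 Ψ₂ K₁` and `Ψ₂ K₂ - 2 Ψ₃ K₁`. Comparison with `-2 Ψ₂ K` leaves the
single condition `K₂ = 2 η K₁`, which characterises the potential.

Closedness of `φ_{AB} ε_{A'B'}` is equivalent to Maxwell's equations, because the four components of
its exterior derivative are an invertible linear image of the four components of `∇^{AA'} φ_{AB}`
(`cyc_components`, `cyc_covariant`, `cartan_formula`). Sachs' law is the closedness of the
spin-lowering field of the potential. -/

namespace TwoSpinor

/-! ### Directional derivatives -/

section DirDeriv

variable {M : Type*} [TopologicalSpace M] [ChartedSpace (EuclideanSpace ℝ (Fin 4)) M]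
  {F : Type*} [NormedAddCommGroup F] [NormedSpace ℝ F]

theorem dirDeriv_smooth [IsManifold (𝓡 4) ∞ M] {X : (x : M) → TangentSpace (𝓡 4) x}
    (hX : SmoothVectorField X) {f : M → F} (hf : ContMDiff (𝓡 4) 𝓘(ℝ, F) ∞ f) :
    ContMDiff (𝓡 4) 𝓘(ℝ, F) ∞ (dirDeriv X f) := by
  have h : ContMDiff (𝓡 4) 𝓘(ℝ, F).tangent ∞
      (fun x => tangentMap (𝓡 4) 𝓘(ℝ, F) f ⟨x, X x⟩) :=
    (hf.contMDiff_tangentMap (m := ∞) le_rfl).comp hX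
  exact (contMDiff_snd_tangentBundle_modelSpace F 𝓘(ℝ, F)).comp h

theorem dirDeriv_const (X : (x : M) → TangentSpace (𝓡 4) x) (c : F) (x : M) :
    dirDeriv X (fun _ => c) x = 0 := by
  simp [dirDeriv, mvfderiv_const]

theorem dirDeriv_add (X : (x : M) → TangentSpace (𝓡 4) x) {f g : M → F} {x : M}
    (hf : MDifferentiableAt (𝓡 4) 𝓘(ℝ, F) f x) (hg : MDifferentiableAt (𝓡 4) 𝓘(ℝ, F) g x) :
    dirDeriv X (f + g) x = dirDeriv X f x + dirDeriv X g x := by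
  simp [dirDeriv, mvfderiv_add hf hg]

theorem dirDeriv_mul (X : (x : M) → TangentSpace (𝓡 4) x) {f g : M → ℂ} {x : M}
    (hf : MDifferentiableAt (𝓡 4) 𝓘(ℝ, ℂ) f x) (hg : MDifferentiableAt (𝓡 4) 𝓘(ℝ, ℂ) g x) :
    dirDeriv X (f * g) x = f x * dirDeriv X g x + g x * dirDeriv X f x := by
  have h := (hf.hasMFDerivAt.mul hg.hasMFDerivAt).mfderiv
  simp only [dirDeriv, mvfderiv, h]
  rfl

/-- A directional derivative commutes with continuous linear maps. -/
theorem dirDeriv_clm {G : Type*} [NormedAddCommGroup G] [NormedSpace ℝ G]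
    (L : F →L[ℝ] G) (X : (x : M) → TangentSpace (𝓡 4) x) {f : M → F} {x : M}
    (hf : MDifferentiableAt (𝓡 4) 𝓘(ℝ, F) f x) :
    dirDeriv X (fun y => L (f y)) x = L (dirDeriv X f x) := by
  have h := (L.hasMFDerivAt (x := f x)).comp x hf.hasMFDerivAt
  have h2 : mfderiv (𝓡 4) 𝓘(ℝ, G) (fun y => L (f y)) x = _ := h.mfderiv
  simp only [dirDeriv, mvfderiv, h2]
  rfl

theorem dirDeriv_sum_smul {ι : Type*} (s : Finset ι) (c : ι → M → ℝ)
    (Y : ι → (x : M) → TangentSpace (𝓡 4) x) (X : (x : M) → TangentSpace (𝓡 4) x) (f : M → F)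
    (x : M)
    (h : X x = ∑ i ∈ s, c i x • Y i x) :
    dirDeriv X f x = ∑ i ∈ s, c i x • dirDeriv (Y i) f x := by
  simp [dirDeriv, h]

end DirDeriv

/-! ### Components of vectors in the orthonormal frame -/

namespace SpinSpacetime

variable {M : Type*} [TopologicalSpace M] [ChartedSpace (EuclideanSpace ℝ (Fin 4)) M]
  [IsManifold (𝓡 4) ∞ M] (S : SpinSpacetime M)

theorem coord_frame (x : M) (a b : Fin 4) :
    S.coord x (S.frame a x) b = if a = b then 1 else 0 := by
  rw [coord, S.frame_orthonormal]
  fin_cases a <;> fin_cases b <;> simp [eta]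

theorem coord_add (x : M) (u v : TangentSpace (𝓡 4) x) (a : Fin 4) :
    S.coord x (u + v) a = S.coord x u a + S.coord x v a := by
  simp [coord, mul_add]

theorem coord_smul (x : M) (c : ℝ) (u : TangentSpace (𝓡 4) x) (a : Fin 4) :
    S.coord x (c • u) a = c * S.coord x u a := by
  simp [coord]; ring

theorem coord_neg (x : M) (u : TangentSpace (𝓡 4) x) (a : Fin 4) :
    S.coord x (-u) a = -S.coord x u a := by
  simp [coord]

theorem coord_sum {ι : Type*} (s : Finset ι) (x : M) (u : ι → TangentSpace (𝓡 4) x) (a : Fin 4) :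
    S.coord x (∑ i ∈ s, u i) a = ∑ i ∈ s, S.coord x (u i) a := by
  simp [coord, Finset.mul_sum]

theorem coord_sum_frame (x : M) (c : Fin 4 → ℝ) (a : Fin 4) :
    S.coord x (∑ b, c b • S.frame b x) a = c a := by
  simp [coord_sum, coord_smul, coord_frame]

theorem linearIndependent_frame (x : M) :
    LinearIndependent ℝ (fun a => S.frame a x) := by
  rw [Fintype.linearIndependent_iff]
  intro c hc a
  have h := S.coord_sum_frame x c a
  rw [hc] at h
  rw [← h]; simp [coord]

theorem span_frame (x : M) : ⊤ ≤ Submodule.span ℝ (Set.range fun a => S.frame a x) := by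
  have h : Module.finrank ℝ (TangentSpace (𝓡 4) x) = 4 := by
    change Module.finrank ℝ (EuclideanSpace ℝ (Fin 4)) = 4
    simp
  have : FiniteDimensional ℝ (TangentSpace (𝓡 4) x) :=
    inferInstanceAs (FiniteDimensional ℝ (EuclideanSpace ℝ (Fin 4)))
  exact ((S.linearIndependent_frame x).span_eq_top_of_card_eq_finrank' (by simp [h])).ge

theorem sum_coord_smul_frame (x : M) (u : TangentSpace (𝓡 4) x) :
    ∑ a, S.coord x u a • S.frame a x = u := by
  have hu : u ∈ Submodule.span ℝ (Set.range fun a => S.frame a x) := S.span_frame x trivial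
  obtain ⟨c, rfl⟩ := (Submodule.mem_span_range_iff_exists_fun ℝ).1 hu
  simp [coord_sum_frame]

theorem metric_eq_coord (x : M) (u : TangentSpace (𝓡 4) x) (a : Fin 4) :
    S.metric x u (S.frame a x) = eta a a * S.coord x u a := by
  rw [coord, ← mul_assoc]
  fin_cases a <;> simp [eta]

/-- Smoothness has to come from the frame, since the metric carries no smoothness assumption. In a
local trivialisation the frame is an invertible operator depending smoothly on the point, the
components of `X` are its inverse applied to `X`, and inversion of operators is smooth. -/
theorem coord_smooth {X : (x : M) → TangentSpace (𝓡 4) x} (hX : SmoothVectorField X) (a : Fin 4) :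
    ContMDiff (𝓡 4) 𝓘(ℝ, ℝ) ∞ (fun x => S.coord x (X x) a) := by
  intro x₀
  let E := EuclideanSpace ℝ (Fin 4)
  let e := trivializationAt E (TangentSpace (𝓡 4) : M → Type _) x₀
  have hx₀ : x₀ ∈ e.baseSet := FiberBundle.mem_baseSet_trivializationAt' x₀
  have hread : ∀ Y : (x : M) → TangentSpace (𝓡 4) x, SmoothVectorField Y →
      ContMDiffAt (𝓡 4) 𝓘(ℝ, E) ∞ (fun x => (e ⟨x, Y x⟩).2) x₀ := fun Y hY =>
    (e.contMDiffAt_section_iff hx₀).1 (hY x₀)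
  -- The operator taking a coefficient vector `c` to the trivialised value of `∑ b, c b • E_b`.
  let L : M → (E →L[ℝ] E) := fun x =>
    ∑ b, (ContinuousLinearMap.smulRightL ℝ E E (EuclideanSpace.proj b : E →L[ℝ] ℝ))
      ((e ⟨x, S.frame b x⟩).2)
  have hLsmooth : ContMDiffAt (𝓡 4) 𝓘(ℝ, E →L[ℝ] E) ∞ L x₀ := by
    refine contMDiffAt_finsetSum fun b _ => ?_
    exact (ContinuousLinearMap.contMDiffAt _).comp x₀ (hread _ (S.frame_smooth b))
  have hLapp : ∀ x ∈ e.baseSet, ∀ c : E,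
      L x c = (e ⟨x, ∑ b, c b • S.frame b x⟩).2 := by
    intro x hx c
    have h := map_sum (e.linearEquivAt ℝ x hx) (fun b => c b • S.frame b x) Finset.univ
    simp only [map_smul] at h
    simp only [L, _root_.sum_apply]
    exact h.symm
  have hLunit : ∀ x ∈ e.baseSet, IsUnit (L x) := by
    intro x hx
    have hinj : Function.Injective (L x : E →ₗ[ℝ] E) := by
      rw [← LinearMap.ker_eq_bot, LinearMap.ker_eq_bot']
      intro c hc
      have hc' : L x c = 0 := hc
      rw [hLapp x hx] at hc'
      have h0 : (∑ b, c b • S.frame b x) = 0 := by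
        apply (e.linearEquivAt ℝ x hx).injective
        rw [map_zero]
        exact hc'
      have hli := Fintype.linearIndependent_iff.1 (S.linearIndependent_frame x) (fun b => c b) h0
      ext b; simpa using hli b
    have hu : IsUnit (L x : E →ₗ[ℝ] E) := (LinearMap.isUnit_iff_ker_eq_bot _).2
      (LinearMap.ker_eq_bot.2 hinj)
    let eq := (LinearEquiv.ofInjectiveEndo (L x : E →ₗ[ℝ] E) hinj).toContinuousLinearEquiv
    have : L x = (eq : E →L[ℝ] E) := by ext c; rfl
    rw [this]
    exact ⟨ContinuousLinearEquiv.toUnit eq, rfl⟩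
  have hinv : ContMDiffAt (𝓡 4) 𝓘(ℝ, E →L[ℝ] E) ∞ (fun x => Ring.inverse (L x)) x₀ := by
    obtain ⟨u, hu⟩ := hLunit x₀ hx₀
    have h1 : ContDiffAt ℝ ∞ Ring.inverse (u : E →L[ℝ] E) := contDiffAt_ringInverse ℝ u
    rw [hu] at h1
    exact h1.contMDiffAt.comp x₀ hLsmooth
  have hres : ContMDiffAt (𝓡 4) 𝓘(ℝ, E) ∞
      (fun x => Ring.inverse (L x) ((e ⟨x, X x⟩).2)) x₀ := hinv.clm_apply (hread X hX)
  have hproj := (ContinuousLinearMap.contMDiffAt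
    (EuclideanSpace.proj a : E →L[ℝ] ℝ) (n := ∞)).comp x₀ hres
  -- The two functions are compared only on the base set of the trivialisation, which is enough for
  -- smoothness at `x₀`.
  refine hproj.congr_of_eventuallyEq ?_
  filter_upwards [e.open_baseSet.mem_nhds hx₀] with x hx
  have h1 : (e ⟨x, X x⟩).2 = L x (WithLp.toLp 2 fun b => S.coord x (X x) b) := by
    rw [hLapp x hx]
    simp [sum_coord_smul_frame]
  simp only [Function.comp, h1]
  have h2 : Ring.inverse (L x) (L x (WithLp.toLp 2 fun b => S.coord x (X x) b)) =
      (Ring.inverse (L x) * L x) (WithLp.toLp 2 fun b => S.coord x (X x) b) := rfl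
  rw [h2, Ring.inverse_mul_cancel _ (hLunit x hx)]
  simp

end SpinSpacetime

/-! ### Lie brackets of smooth vector fields -/

theorem isManifold_minSmoothness (M : Type*) [TopologicalSpace M]
    [ChartedSpace (EuclideanSpace ℝ (Fin 4)) M] [IsManifold (𝓡 4) ∞ M] (n : ℕ) :
    IsManifold (𝓡 4) (minSmoothness ℝ n) M :=
  IsManifold.of_le (n := ∞) (by rw [minSmoothness_of_isRCLikeNormedField]; exact mod_cast le_top)

theorem mlieBracket_smooth {M : Type*} [TopologicalSpace M]
    [ChartedSpace (EuclideanSpace ℝ (Fin 4)) M] [IsManifold (𝓡 4) ∞ M]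
    {X Y : (x : M) → TangentSpace (𝓡 4) x} (hX : SmoothVectorField X) (hY : SmoothVectorField Y) :
    SmoothVectorField (VectorField.mlieBracket (𝓡 4) X Y) := by
  have : IsManifold (𝓡 4) (((⊤ : ℕ∞) : WithTop ℕ∞) + 1) M := by simpa
  have := isManifold_minSmoothness M 2
  have := isManifold_minSmoothness M 3
  exact ContDiff.mlieBracket_vectorField (m := ⊤) (n := ⊤) hX hY (by simp)

section LieBracket

variable {M : Type*} [TopologicalSpace M] [ChartedSpace (EuclideanSpace ℝ (Fin 4)) M]
  [IsManifold (𝓡 4) ∞ M]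

local notation "⟦" X ", " Y "⟧" => VectorField.mlieBracket (𝓡 4) X Y

theorem SmoothVectorField.mdifferentiableAt {X : (x : M) → TangentSpace (𝓡 4) x}
    (hX : SmoothVectorField X) (x : M) :
    MDifferentiableAt (𝓡 4) (𝓡 4).tangent
      (fun x => (⟨x, X x⟩ : TangentBundle (𝓡 4) M)) x :=
  (ContMDiff.mdifferentiable hX (by simp)) x

theorem ContMDiff.mdiffAt {F : Type*} [NormedAddCommGroup F] [NormedSpace ℝ F] {f : M → F}
    (hf : ContMDiff (𝓡 4) 𝓘(ℝ, F) ∞ f) (x : M) : MDifferentiableAt (𝓡 4) 𝓘(ℝ, F) f x :=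
  (ContMDiff.mdifferentiable hf (by simp)) x

theorem SmoothVectorField.smul {f : M → ℝ} (hf : ContMDiff (𝓡 4) 𝓘(ℝ, ℝ) ∞ f)
    {X : (x : M) → TangentSpace (𝓡 4) x} (hX : SmoothVectorField X) :
    SmoothVectorField (f • X) :=
  ContMDiff.smul_section hf hX

theorem mlieBracket_smul {f : M → ℝ} (hf : ContMDiff (𝓡 4) 𝓘(ℝ, ℝ) ∞ f)
    (X : (x : M) → TangentSpace (𝓡 4) x) {Y : (x : M) → TangentSpace (𝓡 4) x}
    (hY : SmoothVectorField Y) :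
    ⟦X, f • Y⟧ = dirDeriv X f • Y + f • ⟦X, Y⟧ := by
  have := isManifold_minSmoothness M 2
  funext x
  exact VectorField.mlieBracket_smul_right (hf.mdiffAt x) (hY.mdifferentiableAt x)

theorem mlieBracket_add {X Y Z : (x : M) → TangentSpace (𝓡 4) x}
    (hY : SmoothVectorField Y) (hZ : SmoothVectorField Z) :
    ⟦X, Y + Z⟧ = ⟦X, Y⟧ + ⟦X, Z⟧ := by
  have := isManifold_minSmoothness M 2
  funext x
  exact VectorField.mlieBracket_add_right (hY.mdifferentiableAt x) (hZ.mdifferentiableAt x)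

theorem SmoothVectorField.sum {ι : Type*} (s : Finset ι)
    {Y : ι → (x : M) → TangentSpace (𝓡 4) x} (hY : ∀ i, SmoothVectorField (Y i)) :
    SmoothVectorField (∑ i ∈ s, Y i) := by
  have h : (∑ i ∈ s, Y i) = fun x => ∑ i ∈ s, Y i x := by funext x; simp
  rw [h]
  exact ContMDiff.sum_section fun i _ => hY i

theorem mlieBracket_sum {ι : Type*} (s : Finset ι) (X : (x : M) → TangentSpace (𝓡 4) x)
    {Y : ι → (x : M) → TangentSpace (𝓡 4) x} (hY : ∀ i, SmoothVectorField (Y i)) :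
    ⟦X, ∑ i ∈ s, Y i⟧ = ∑ i ∈ s, ⟦X, Y i⟧ := by
  classical
  induction s using Finset.induction_on with
  | empty => simp [VectorField.mlieBracket_zero_right]
  | insert i s hi ih =>
    rw [Finset.sum_insert hi, Finset.sum_insert hi,
      mlieBracket_add (hY i) (SmoothVectorField.sum s hY), ih]

theorem mlieBracket_jacobi {X Y Z : (x : M) → TangentSpace (𝓡 4) x}
    (hX : SmoothVectorField X) (hY : SmoothVectorField Y) (hZ : SmoothVectorField Z) :
    ⟦X, ⟦Y, Z⟧⟧ = ⟦⟦X, Y⟧, Z⟧ + ⟦Y, ⟦X, Z⟧⟧ := by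
  have := isManifold_minSmoothness M 3
  have h : minSmoothness ℝ 2 ≤ ((∞ : ℕ∞ω)) := by
    rw [minSmoothness_of_isRCLikeNormedField]
    exact WithTop.coe_le_coe.2 (le_top : (2 : ℕ∞) ≤ ⊤)
  exact VectorField.leibniz_identity_mlieBracket (hX.of_le h) (hY.of_le h) (hZ.of_le h)

/-- `X (Y f) - Y (X f) = [X, Y] f`, where a nowhere vanishing vector field is available. -/
theorem dirDeriv_comm_real {X Y Z : (x : M) → TangentSpace (𝓡 4) x}
    (hX : SmoothVectorField X) (hY : SmoothVectorField Y) (hZ : SmoothVectorField Z)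
    {f : M → ℝ} (hf : ContMDiff (𝓡 4) 𝓘(ℝ, ℝ) ∞ f) (x : M) (hZx : Z x ≠ 0) :
    dirDeriv X (dirDeriv Y f) x - dirDeriv Y (dirDeriv X f) x = dirDeriv ⟦X, Y⟧ f x := by
  have hXf := dirDeriv_smooth hX hf
  have hYf := dirDeriv_smooth hY hf
  have hXZ := mlieBracket_smooth hX hZ
  have hYZ := mlieBracket_smooth hY hZ
  -- The Jacobi identity for `X, Y, fZ` is expanded by the Leibniz rule. Modulo the identity for `X,
  -- Y, Z` the terms with brackets of `Z` cancel, and what is left is `X(Yf) - Y(Xf) - [X, Y]f`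
  -- times `Z`.
  have h := mlieBracket_jacobi hX hY (hZ.smul hf)
  have h0 := mlieBracket_jacobi hX hY hZ
  rw [mlieBracket_smul hf Y hZ, mlieBracket_smul hf X hZ, mlieBracket_smul hf _ hZ,
    mlieBracket_add (hZ.smul hYf) (hYZ.smul hf), mlieBracket_add (hZ.smul hXf) (hXZ.smul hf),
    mlieBracket_smul hf _ hYZ, mlieBracket_smul hf _ hXZ, mlieBracket_smul hYf _ hZ,
    mlieBracket_smul hXf _ hZ, h0] at h
  have hx := congrFun h x
  simp only [Pi.add_apply, Pi.smul_apply'] at hx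
  have hz : (dirDeriv X (dirDeriv Y f) x - dirDeriv Y (dirDeriv X f) x
      - dirDeriv ⟦X, Y⟧ f x) • Z x = 0 := by
    rw [sub_smul, sub_smul]
    rw [← sub_eq_zero] at hx
    rw [← hx]
    simp only [smul_add]
    abel
  have := (smul_eq_zero.1 hz).resolve_right hZx
  linarith

theorem dirDeriv_comm {X Y Z : (x : M) → TangentSpace (𝓡 4) x}
    (hX : SmoothVectorField X) (hY : SmoothVectorField Y) (hZ : SmoothVectorField Z)
    {f : M → ℂ} (hf : ContMDiff (𝓡 4) 𝓘(ℝ, ℂ) ∞ f) (x : M) (hZx : Z x ≠ 0) :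
    dirDeriv X (dirDeriv Y f) x - dirDeriv Y (dirDeriv X f) x = dirDeriv ⟦X, Y⟧ f x := by
  -- The real identity is applied to the real and imaginary parts of `f`.
  have key : ∀ L : ℂ →L[ℝ] ℝ,
      L (dirDeriv X (dirDeriv Y f) x - dirDeriv Y (dirDeriv X f) x) = L (dirDeriv ⟦X, Y⟧ f x) := by
    intro L
    have hL : ContMDiff (𝓡 4) 𝓘(ℝ, ℝ) ∞ (fun y => L (f y)) := L.contMDiff.comp hf
    have h := dirDeriv_comm_real hX hY hZ hL x hZx
    have h1 : ∀ V : (x : M) → TangentSpace (𝓡 4) x,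
        dirDeriv V (fun y => L (f y)) = fun y => L (dirDeriv V f y) :=
      fun V => funext fun y => dirDeriv_clm L V (hf.mdiffAt y)
    rw [h1, h1, h1, dirDeriv_clm L X ((dirDeriv_smooth hY hf).mdiffAt x),
      dirDeriv_clm L Y ((dirDeriv_smooth hX hf).mdiffAt x)] at h
    rw [map_sub, h]
  exact Complex.ext (key Complex.reCLM) (key Complex.imCLM)

namespace SpinSpacetime

variable (S : SpinSpacetime M)

theorem eq_sum_coord_smul (X : (x : M) → TangentSpace (𝓡 4) x) :
    X = ∑ a, (fun x => S.coord x (X x) a) • S.frame a := by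
  funext x
  simpa using (S.sum_coord_smul_frame x (X x)).symm

/-- The components of the Lie bracket of two vector fields in the orthonormal frame. -/
theorem coord_mlieBracket {X Y : (x : M) → TangentSpace (𝓡 4) x}
    (hX : SmoothVectorField X) (hY : SmoothVectorField Y) (x : M) (c : Fin 4) :
    S.coord x (⟦X, Y⟧ x) c =
      dirDeriv X (fun y => S.coord y (Y y) c) x - dirDeriv Y (fun y => S.coord y (X y) c) x
      + ∑ a, ∑ b, S.coord x (X x) a * S.coord x (Y x) b *
        S.coord x (⟦S.frame a, S.frame b⟧ x) c := by
  have hsm : ∀ {V : (x : M) → TangentSpace (𝓡 4) x}, SmoothVectorField V → ∀ a,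
      SmoothVectorField ((fun x => S.coord x (V x) a) • S.frame a) := fun hV a =>
    (S.frame_smooth a).smul (S.coord_smooth hV a)
  have expand : ∀ {V W : (x : M) → TangentSpace (𝓡 4) x}, SmoothVectorField W → 
      S.coord x (⟦V, W⟧ x) c = dirDeriv V (fun y => S.coord y (W y) c) x
        + ∑ b, S.coord x (W x) b * S.coord x (⟦V, S.frame b⟧ x) c := by
    intro V W hW
    conv_lhs => rw [S.eq_sum_coord_smul W]
    rw [mlieBracket_sum _ _ (hsm hW)]
    simp_rw [mlieBracket_smul (S.coord_smooth hW _) V (S.frame_smooth _)]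
    simp [coord_sum, coord_add, coord_smul, coord_frame, Finset.sum_add_distrib]
  have swap : ∀ V W : (x : M) → TangentSpace (𝓡 4) x,
      S.coord x (⟦V, W⟧ x) c = -S.coord x (⟦W, V⟧ x) c := by
    intro V W
    rw [VectorField.mlieBracket_swap_apply, coord_neg]
  rw [expand hY]
  have h2 : ∀ b, S.coord x (⟦X, S.frame b⟧ x) c =
      -dirDeriv (S.frame b) (fun y => S.coord y (X y) c) x
        + ∑ a, S.coord x (X x) a * S.coord x (⟦S.frame a, S.frame b⟧ x) c := by
    intro b
    rw [swap, expand hX, neg_add, ← Finset.sum_neg_distrib]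
    congr 1
    refine Finset.sum_congr rfl fun a _ => ?_
    rw [swap (S.frame a)]; ring
  simp_rw [h2]
  have h3 : dirDeriv Y (fun y => S.coord y (X y) c) x =
      ∑ b, S.coord x (Y x) b * dirDeriv (S.frame b) (fun y => S.coord y (X y) c) x := by
    rw [dirDeriv_sum_smul Finset.univ (fun b y => S.coord y (Y y) b) S.frame Y _ x
      (S.sum_coord_smul_frame x (Y x)).symm]
    simp
  rw [h3]
  simp only [mul_add, mul_neg, Finset.sum_add_distrib, Finset.sum_neg_distrib, Finset.mul_sum]
  rw [Finset.sum_comm (f := fun a b => S.coord x (X x) a * S.coord x (Y x) b *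
        S.coord x (⟦S.frame a, S.frame b⟧ x) c)]
  rw [sub_eq_add_neg, add_assoc]
  congr 2
  refine Finset.sum_congr rfl fun _ _ => Finset.sum_congr rfl fun _ _ => by ring

theorem frame_ne_zero (a : Fin 4) (x : M) : S.frame a x ≠ 0 :=
  (S.linearIndependent_frame x).ne_zero a

end SpinSpacetime

end LieBracket

/-! ### Smooth complex functions as an algebra, vector fields as derivations -/

noncomputable section

section SmoothFn

variable (M : Type*) [TopologicalSpace M] [ChartedSpace (EuclideanSpace ℝ (Fin 4)) M]

/-- The algebra of smooth complex functions. -/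
def smoothFn : Subalgebra ℂ (M → ℂ) where
  carrier := {f | ContMDiff (𝓡 4) 𝓘(ℝ, ℂ) ∞ f}
  mul_mem' hf hg := contDiff_mul.contMDiff.comp (hf.prodMk_space hg)
  add_mem' hf hg := hf.add hg
  algebraMap_mem' _ := contMDiff_const

variable {M}

theorem smoothFn.ext_iff {f g : smoothFn M} : f = g ↔ ∀ x, f.1 x = g.1 x := by
  rw [Subtype.ext_iff, funext_iff]

theorem ContMDiff.ofReal {f : M → ℝ} (hf : ContMDiff (𝓡 4) 𝓘(ℝ, ℝ) ∞ f) :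
    ContMDiff (𝓡 4) 𝓘(ℝ, ℂ) ∞ (fun x => (f x : ℂ)) :=
  Complex.ofRealCLM.contMDiff.comp hf

theorem ContMDiff.conj {f : M → ℂ} (hf : ContMDiff (𝓡 4) 𝓘(ℝ, ℂ) ∞ f) :
    ContMDiff (𝓡 4) 𝓘(ℝ, ℂ) ∞ (fun x => conj (f x)) :=
  Complex.conjCLE.toContinuousLinearMap.contMDiff.comp hf

variable [IsManifold (𝓡 4) ∞ M]

/-- A smooth vector field as a derivation of the smooth complex functions. -/
def vfDeriv (X : (x : M) → TangentSpace (𝓡 4) x) (hX : SmoothVectorField X) :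
    Derivation ℂ (smoothFn M) (smoothFn M) :=
  Derivation.mk'
    { toFun := fun f => ⟨dirDeriv X f.1, dirDeriv_smooth hX f.2⟩
      map_add' := fun f g => Subtype.ext <| funext fun x =>
        dirDeriv_add X (ContMDiff.mdiffAt f.2 x) (ContMDiff.mdiffAt g.2 x)
      map_smul' := fun c f => Subtype.ext <| funext fun x => by
        have h := dirDeriv_mul X (f := fun _ => c) (mdifferentiableAt_const)
          (ContMDiff.mdiffAt f.2 x)
        rw [dirDeriv_const, mul_zero, add_zero] at h
        exact h }
    fun f g => Subtype.ext <| funext fun x =>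
      dirDeriv_mul X (ContMDiff.mdiffAt f.2 x) (ContMDiff.mdiffAt g.2 x)

theorem vfDeriv_apply (X : (x : M) → TangentSpace (𝓡 4) x) (hX : SmoothVectorField X)
    (f : smoothFn M) (x : M) : (vfDeriv X hX f).1 x = dirDeriv X f.1 x := rfl

end SmoothFn

/-! ### Structure functions, Levi-Civita connection and Riemann tensor of the frame -/

namespace SpinSpacetime

variable {M : Type*} [TopologicalSpace M] [ChartedSpace (EuclideanSpace ℝ (Fin 4)) M]
  [IsManifold (𝓡 4) ∞ M] (S : SpinSpacetime M)

/-- The frame vector `E_a` as a derivation. -/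
def D (a : Fin 4) : Derivation ℂ (smoothFn M) (smoothFn M) := vfDeriv _ (S.frame_smooth a)

theorem structure_smooth (a b c : Fin 4) : ContMDiff (𝓡 4) 𝓘(ℝ, ℝ) ∞
    (fun x => S.coord x (VectorField.mlieBracket (𝓡 4) (S.frame a) (S.frame b) x) c) :=
  S.coord_smooth (mlieBracket_smooth (S.frame_smooth a) (S.frame_smooth b)) c

/-- The structure functions of the frame: `[E_a, E_b] = C_{ab}{}^c E_c`. -/
def C (a b c : Fin 4) : smoothFn M := ⟨_, ContMDiff.ofReal (S.structure_smooth a b c)⟩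

theorem C_apply (a b c : Fin 4) (x : M) : (S.C a b c).1 x =
    (S.coord x (VectorField.mlieBracket (𝓡 4) (S.frame a) (S.frame b) x) c : ℂ) := rfl

/-- Inner products of frame vectors are constant, so the derivative terms of the Koszul formula drop
out and only structure functions remain. -/
theorem conn_eq (a b c : Fin 4) (x : M) : S.conn a b c x =
    eta c c * (eta c c * S.coord x (VectorField.mlieBracket (𝓡 4) (S.frame a) (S.frame b) x) c
      - eta b b * S.coord x (VectorField.mlieBracket (𝓡 4) (S.frame a) (S.frame c) x) b
      - eta a a * S.coord x (VectorField.mlieBracket (𝓡 4) (S.frame b) (S.frame c) x) a) / 2 := by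
  simp only [conn, koszul, S.frame_orthonormal, dirDeriv_const, metric_eq_coord]
  ring

theorem conn_smooth (a b c : Fin 4) : ContMDiff (𝓡 4) 𝓘(ℝ, ℝ) ∞ (S.conn a b c) := by
  have h : S.conn a b c = fun x => S.conn a b c x := rfl
  rw [h]
  simp only [S.conn_eq, div_eq_mul_inv]
  have hc : ∀ r : ℝ, ContMDiff (𝓡 4) 𝓘(ℝ, ℝ) ∞ (fun _ : M => r) := fun r => contMDiff_const
  exact ((hc _).mul ((((hc _).mul (S.structure_smooth a b c)).sub
    ((hc _).mul (S.structure_smooth a c b))).sub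
    ((hc _).mul (S.structure_smooth b c a)))).mul (hc _)

/-- The connection coefficients as smooth complex functions. -/
def Γ (a b c : Fin 4) : smoothFn M := ⟨_, ContMDiff.ofReal (S.conn_smooth a b c)⟩

theorem Γ_apply (a b c : Fin 4) (x : M) : (S.Γ a b c).1 x = (S.conn a b c x : ℂ) := rfl

theorem C_swap (a b c : Fin 4) : S.C a b c = -S.C b a c := by
  rw [smoothFn.ext_iff]; intro x
  change (S.C a b c).1 x = -(S.C b a c).1 x
  rw [C_apply, C_apply, VectorField.mlieBracket_swap_apply, coord_neg]
  push_cast; rfl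

theorem conn_torsion (a b c : Fin 4) (x : M) : S.conn a b c x - S.conn b a c x =
    S.coord x (VectorField.mlieBracket (𝓡 4) (S.frame a) (S.frame b) x) c := by
  have hs : ∀ a b c, S.coord x (VectorField.mlieBracket (𝓡 4) (S.frame a) (S.frame b) x) c =
    -S.coord x (VectorField.mlieBracket (𝓡 4) (S.frame b) (S.frame a) x) c := fun a b c => by
      rw [VectorField.mlieBracket_swap_apply, coord_neg]
  rw [conn_eq, conn_eq, hs b a c]
  have : eta c c * eta c c = 1 := by fin_cases c <;> simp [eta]
  linear_combination S.coord x (VectorField.mlieBracket (𝓡 4) (S.frame a) (S.frame b) x) c * this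

theorem conn_skew (a b c : Fin 4) (x : M) :
    eta c c * S.conn a b c x + eta b b * S.conn a c b x = 0 := by
  have hs : ∀ a b c, S.coord x (VectorField.mlieBracket (𝓡 4) (S.frame a) (S.frame b) x) c =
    -S.coord x (VectorField.mlieBracket (𝓡 4) (S.frame b) (S.frame a) x) c := fun a b c => by
      rw [VectorField.mlieBracket_swap_apply, coord_neg]
  rw [conn_eq, conn_eq, hs c b a]
  have h : ∀ c, eta c c * eta c c = 1 := fun c => by fin_cases c <;> simp [eta]
  linear_combination (eta c c * S.coord x
      (VectorField.mlieBracket (𝓡 4) (S.frame a) (S.frame b) x) c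
      - eta b b * S.coord x (VectorField.mlieBracket (𝓡 4) (S.frame a) (S.frame c) x) b
      - eta a a * S.coord x (VectorField.mlieBracket (𝓡 4) (S.frame b) (S.frame c) x) a)
        / 2 * (h c - h b)

theorem torsion (a b c : Fin 4) : S.Γ a b c - S.Γ b a c = S.C a b c := by
  rw [smoothFn.ext_iff]; intro x
  change (S.Γ a b c).1 x - (S.Γ b a c).1 x = _
  rw [Γ_apply, Γ_apply, C_apply, ← conn_torsion]
  push_cast; rfl

theorem D_comm (a b : Fin 4) (f : smoothFn M) :
    S.D a (S.D b f) - S.D b (S.D a f) = ∑ e, S.C a b e * S.D e f := by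
  rw [smoothFn.ext_iff]; intro x
  have h := dirDeriv_comm (S.frame_smooth a) (S.frame_smooth b) (S.frame_smooth 0) f.2 x
    (S.frame_ne_zero 0 x)
  rw [dirDeriv_sum_smul Finset.univ (fun c y => S.coord y
    (VectorField.mlieBracket (𝓡 4) (S.frame a) (S.frame b) y) c) S.frame _ _ x
    (S.sum_coord_smul_frame x _).symm] at h
  refine h.trans ?_
  rw [AddSubmonoidClass.coe_finsetSum, Finset.sum_apply]
  rfl

theorem jacobi (a b c d : Fin 4) :
    S.D a (S.C b c d) + S.D b (S.C c a d) + S.D c (S.C a b d)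
      + ∑ e, (S.C b c e * S.C a e d + S.C c a e * S.C b e d + S.C a b e * S.C c e d) = 0 := by
  have hsm : ∀ a b, SmoothVectorField (VectorField.mlieBracket (𝓡 4) (S.frame a) (S.frame b)) :=
    fun a b => mlieBracket_smooth (S.frame_smooth a) (S.frame_smooth b)
  have key : ∀ (a b c : Fin 4) (x : M), (S.coord x (VectorField.mlieBracket (𝓡 4) (S.frame a)
      (VectorField.mlieBracket (𝓡 4) (S.frame b) (S.frame c)) x) d : ℂ) =
      (S.D a (S.C b c d)).1 x + ∑ e, (S.C b c e).1 x * (S.C a e d).1 x := by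
    intro a b c x
    rw [S.coord_mlieBracket (S.frame_smooth a) (hsm b c)]
    -- Frame vectors have constant components, so only one of the two derivative terms of the
    -- bracket survives.
    have h1 : (fun y => S.coord y (S.frame a y) d) = fun _ => if a = d then 1 else 0 := by
      funext y; rw [coord_frame]
    rw [h1, dirDeriv_const]
    have h2 : (S.D a (S.C b c d)).1 x = ((dirDeriv (S.frame a) (fun y => S.coord y
        (VectorField.mlieBracket (𝓡 4) (S.frame b) (S.frame c) y) d) x : ℝ) : ℂ) :=
      dirDeriv_clm Complex.ofRealCLM _ (ContMDiff.mdiffAt (S.structure_smooth b c d) x)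
    rw [h2]
    simp [coord_frame, C_apply]
  rw [smoothFn.ext_iff]; intro x
  have hj := congrFun (mlieBracket_jacobi (S.frame_smooth a) (S.frame_smooth b)
    (S.frame_smooth c)) x
  have hj2 : (S.coord x (VectorField.mlieBracket (𝓡 4) (S.frame a)
      (VectorField.mlieBracket (𝓡 4) (S.frame b) (S.frame c)) x) d : ℂ)
      + (S.coord x (VectorField.mlieBracket (𝓡 4) (S.frame b)
      (VectorField.mlieBracket (𝓡 4) (S.frame c) (S.frame a)) x) d : ℂ)
      + (S.coord x (VectorField.mlieBracket (𝓡 4) (S.frame c)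
      (VectorField.mlieBracket (𝓡 4) (S.frame a) (S.frame b)) x) d : ℂ) = 0 := by
    rw [hj, VectorField.mlieBracket_swap (V := S.frame c) (W := S.frame a),
      VectorField.mlieBracket_swap_apply (V := S.frame c)]
    have hneg : VectorField.mlieBracket (𝓡 4) (S.frame b)
        (-VectorField.mlieBracket (𝓡 4) (S.frame a) (S.frame c)) =
        -VectorField.mlieBracket (𝓡 4) (S.frame b)
          (VectorField.mlieBracket (𝓡 4) (S.frame a) (S.frame c)) := by
      have h := mlieBracket_smul (f := fun _ : M => (-1 : ℝ)) contMDiff_const (S.frame b) (hsm a c)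
      have e1 : ((fun _ : M => (-1 : ℝ)) • VectorField.mlieBracket (𝓡 4) (S.frame a) (S.frame c)) =
        -VectorField.mlieBracket (𝓡 4) (S.frame a) (S.frame c) := by funext y; simp
      rw [e1] at h
      rw [h]; funext y; simp [dirDeriv_const]
    rw [hneg]
    simp only [Pi.add_apply, Pi.neg_apply, coord_add, coord_neg]
    push_cast; ring
  rw [key, key, key] at hj2
  refine Eq.trans ?_ hj2
  simp only [Finset.sum_add_distrib]
  change (S.D a (S.C b c d)).1 x + (S.D b (S.C c a d)).1 x + (S.D c (S.C a b d)).1 x +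
    ((∑ e, S.C b c e * S.C a e d) + (∑ e, S.C c a e * S.C b e d)
      + (∑ e, S.C a b e * S.C c e d) : smoothFn M).1 x = _
  simp only [AddMemClass.coe_add, AddSubmonoidClass.coe_finsetSum, MulMemClass.coe_mul,
    Pi.add_apply, Finset.sum_apply, Pi.mul_apply]
  ring

/-- The Riemann tensor as a smooth complex function. -/
def Rm (a b c d : Fin 4) : smoothFn M :=
  S.D a (S.Γ b c d) - S.D b (S.Γ a c d)
    + ∑ e, (S.Γ b c e * S.Γ a e d - S.Γ a c e * S.Γ b e d - S.C a b e * S.Γ e c d)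

theorem Rm_apply (a b c d : Fin 4) (x : M) : (S.Rm a b c d).1 x = (S.riemann a b c d x : ℂ) := by
  have h : ∀ a b c d, (S.D a (S.Γ b c d)).1 x = ((dirDeriv (S.frame a) (S.conn b c d) x : ℝ) : ℂ) :=
    fun a b c d => dirDeriv_clm Complex.ofRealCLM _ (ContMDiff.mdiffAt (S.conn_smooth b c d) x)
  rw [Rm]
  simp only [AddMemClass.coe_add, AddSubmonoidClass.coe_finsetSum, MulMemClass.coe_mul,
    AddSubgroupClass.coe_sub, Pi.add_apply, Pi.sub_apply, Finset.sum_apply, Pi.mul_apply,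
    h, Γ_apply, C_apply, riemann]
  push_cast
  rfl

end SpinSpacetime

/-! ### Curvature identities in a frame of derivations -/

section FrameAlgebra

variable {A : Type*} [CommRing A] [Algebra ℂ A] (D : Fin 4 → Derivation ℂ A A)
  (C Γ : Fin 4 → Fin 4 → Fin 4 → A) (γ : Fin 4 → Fin 2 → Fin 2 → A)

/-- The curvature of the connection coefficients `Γ` in a frame with structure functions `C`. -/
def frameCurv (a b c d : Fin 4) : A :=
  D a (Γ b c d) - D b (Γ a c d)
    + ∑ e, (Γ b c e * Γ a e d - Γ a c e * Γ b e d - C a b e * Γ e c d)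

/-- The curvature of the spin connection `γ` in a frame with structure functions `C`. -/
def spinCurv (a b : Fin 4) (B E : Fin 2) : A :=
  D a (γ b B E) - D b (γ a B E)
    + ∑ X, (γ b B X * γ a X E - γ a B X * γ b X E) - ∑ e, C a b e * γ e B E

/-- The covariant derivative of the components `K_{BC}` of a spinor along the frame. -/
def covD₂ (K : Fin 2 → Fin 2 → A) (a : Fin 4) (B E : Fin 2) : A :=
  D a (K B E) - ∑ X, γ a B X * K X E - ∑ X, γ a E X * K B X

/-- The second covariant derivative `∇_d ∇_a K_{BC}`. -/
def covD₂₂ (K : Fin 2 → Fin 2 → A) (d a : Fin 4) (B E : Fin 2) : A :=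
  D d (covD₂ D γ K a B E) - ∑ e, Γ d a e * covD₂ D γ K e B E
    - ∑ X, γ d B X * covD₂ D γ K a X E - ∑ X, γ d E X * covD₂ D γ K a B X

variable {D C Γ γ}

theorem frameCurv_swap (hC : ∀ a b c, C a b c = -C b a c) (a b c d : Fin 4) :
    frameCurv D C Γ a b c d = -frameCurv D C Γ b a c d := by
  simp only [frameCurv, Fin.sum_univ_four, hC b a]
  ring

/-- Once the structure functions are written as `Γ a b c - Γ b a c`, the Jacobi identity becomes the
cyclic sum of the curvature: the first Bianchi identity is the Jacobi identity of the frame. -/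
theorem frameCurv_cyclic (hT : ∀ a b c, Γ a b c - Γ b a c = C a b c)
    (hJ : ∀ a b c d, D a (C b c d) + D b (C c a d) + D c (C a b d)
      + ∑ e, (C b c e * C a e d + C c a e * C b e d + C a b e * C c e d) = 0) (a b c d : Fin 4) :
    frameCurv D C Γ a b c d + frameCurv D C Γ b c a d + frameCurv D C Γ c a b d = 0 := by
  rw [← hJ a b c d]
  simp only [frameCurv, ← hT, map_sub, Fin.sum_univ_four]
  ring

/-- The factors `s` play the role of the diagonal entries of the metric. Differentiating the
metricity relation `hΓ` handles the derivative terms, and applying it inside each product handles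
the quadratic ones. -/
theorem frameCurv_skew (s : Fin 4 → A) (hs : ∀ a b, D a (s b) = 0)
    (hΓ : ∀ a b c, s c * Γ a b c + s b * Γ a c b = 0) (a b c d : Fin 4) :
    s d * frameCurv D C Γ a b c d + s c * frameCurv D C Γ a b d c = 0 := by
  have hD : ∀ a b c d, s d * D a (Γ b c d) + s c * D a (Γ b d c) = 0 := by
    intro a b c d
    have h := congrArg (D a) (hΓ b c d)
    simp only [map_add, Derivation.leibniz, hs, smul_eq_mul, mul_zero, add_zero, map_zero] at h
    exact h
  have hq : ∀ e, s d * (Γ b c e * Γ a e d - Γ a c e * Γ b e d - C a b e * Γ e c d)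
      + s c * (Γ b d e * Γ a e c - Γ a d e * Γ b e c - C a b e * Γ e d c) = 0 := by
    intro e
    linear_combination Γ b c e * hΓ a e d - Γ a c e * hΓ b e d - C a b e * hΓ e c d
      - Γ a d e * hΓ b c e + Γ b d e * hΓ a c e
  have hsum : s d * ∑ e, (Γ b c e * Γ a e d - Γ a c e * Γ b e d - C a b e * Γ e c d)
      + s c * ∑ e, (Γ b d e * Γ a e c - Γ a d e * Γ b e c - C a b e * Γ e d c) = 0 := by
    rw [Finset.mul_sum, Finset.mul_sum, ← Finset.sum_add_distrib]
    exact Finset.sum_eq_zero fun e _ => hq e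
  simp only [frameCurv]
  linear_combination hsum + hD a b c d - hD b a c d

/-- The Ricci identity: without torsion the first-order terms cancel against the bracket of the
frame vectors, and the curvature acts once on each spinor index. -/
theorem covD₂₂_comm (hT : ∀ a b c, Γ a b c - Γ b a c = C a b c)
    (hD : ∀ a b f, D a (D b f) - D b (D a f) = ∑ e, C a b e * D e f)
    (K : Fin 2 → Fin 2 → A) (a b : Fin 4) (B E : Fin 2) :
    covD₂₂ D Γ γ K a b B E - covD₂₂ D Γ γ K b a B E =
      - ∑ X, spinCurv D C γ a b B X * K X E - ∑ X, spinCurv D C γ a b E X * K B X := by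
  have h := hD a b (K B E)
  simp only [covD₂₂, covD₂, spinCurv, ← hT, Fin.sum_univ_two, Fin.sum_univ_four, map_sub, map_add,
    Derivation.leibniz, smul_eq_mul] at h ⊢
  linear_combination h

/-- The second Bianchi identity for the spin curvature. -/
theorem spinCurv_bianchi (hC : ∀ a b c, C a b c = -C b a c)
    (hD : ∀ a b f, D a (D b f) - D b (D a f) = ∑ e, C a b e * D e f)
    (hJ : ∀ a b c d, D a (C b c d) + D b (C c a d) + D c (C a b d)
      + ∑ e, (C b c e * C a e d + C c a e * C b e d + C a b e * C c e d) = 0)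
    (a b c : Fin 4) (B E : Fin 2) :
    (D a (spinCurv D C γ b c B E) - ∑ X, γ a B X * spinCurv D C γ b c X E
        + ∑ X, γ a X E * spinCurv D C γ b c B X - ∑ e, C a b e * spinCurv D C γ e c B E)
    + (D b (spinCurv D C γ c a B E) - ∑ X, γ b B X * spinCurv D C γ c a X E
        + ∑ X, γ b X E * spinCurv D C γ c a B X - ∑ e, C b c e * spinCurv D C γ e a B E)
    + (D c (spinCurv D C γ a b B E) - ∑ X, γ c B X * spinCurv D C γ a b X E
        + ∑ X, γ c X E * spinCurv D C γ a b B X - ∑ e, C c a e * spinCurv D C γ e b B E) = 0 := by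
  have h1 := hD a b (γ c B E)
  have h2 := hD b c (γ a B E)
  have h3 := hD c a (γ b B E)
  have j := fun e => hJ a b c e
  have j0 := j 0
  have j1 := j 1
  have j2 := j 2
  have j3 := j 3
  simp only [spinCurv, Fin.sum_univ_two, Fin.sum_univ_four, map_sub, map_add,
    Derivation.leibniz, smul_eq_mul] at h1 h2 h3 j0 j1 j2 j3 ⊢
  -- Products of two structure functions occur with either order of the lower indices; a fixed order
  -- lets the Jacobi identities `j0`, …, `j3` remove them.
  simp only [hC 0 a, hC 1 a, hC 2 a, hC 3 a, hC 0 b, hC 1 b, hC 2 b, hC 3 b,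
    hC 0 c, hC 1 c, hC 2 c, hC 3 c]
  linear_combination h1 + h2 + h3 - γ 0 B E * j0 - γ 1 B E * j1 - γ 2 B E * j2 - γ 3 B E * j3

end FrameAlgebra

/-! ### Infeld–van der Waerden symbols and the spin representation -/

section Symbols

/-- The normalisation `1/√2` of the Infeld–van der Waerden symbols. -/
def rt : ℂ := ((Real.sqrt 2 : ℝ) : ℂ)⁻¹

theorem rt_sq : rt * rt = 1 / 2 := by
  rw [rt, ← mul_inv, ← Complex.ofReal_mul, Real.mul_self_sqrt (by norm_num)]
  norm_num

theorem ivdw_zero (A A' : Fin 2) : ivdw 0 A A' = rt * if A = A' then 1 else 0 := by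
  fin_cases A <;> fin_cases A' <;> simp [ivdw, rt]

theorem ivdw_one (A A' : Fin 2) : ivdw 1 A A' = rt * if A = A' then 0 else 1 := by
  fin_cases A <;> fin_cases A' <;> simp [ivdw, rt]

theorem ivdw_two (A A' : Fin 2) : ivdw 2 A A' =
    rt * if A = A' then 0 else if A = 0 then Complex.I else -Complex.I := by
  fin_cases A <;> fin_cases A' <;> simp [ivdw, rt]

theorem ivdw_three (A A' : Fin 2) : ivdw 3 A A' =
    rt * if A = A' then (if A = 0 then 1 else -1) else 0 := by
  fin_cases A <;> fin_cases A' <;> simp [ivdw, rt]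

theorem ivdwInv_zero (A A' : Fin 2) : ivdwInv 0 A A' = rt * if A = A' then 1 else 0 := by
  fin_cases A <;> fin_cases A' <;>
    simp [ivdwInv, ivdw, rt, eta, eps, Fin.sum_univ_four]

theorem ivdwInv_one (A A' : Fin 2) : ivdwInv 1 A A' = rt * if A = A' then 0 else 1 := by
  fin_cases A <;> fin_cases A' <;>
    simp [ivdwInv, ivdw, rt, eta, eps, Fin.sum_univ_four]

theorem ivdwInv_two (A A' : Fin 2) : ivdwInv 2 A A' =
    rt * if A = A' then 0 else if A = 0 then -Complex.I else Complex.I := by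
  fin_cases A <;> fin_cases A' <;>
    simp [ivdwInv, ivdw, rt, eta, eps, Fin.sum_univ_four]

theorem ivdwInv_three (A A' : Fin 2) : ivdwInv 3 A A' =
    rt * if A = A' then (if A = 0 then 1 else -1) else 0 := by
  fin_cases A <;> fin_cases A' <;>
    simp [ivdwInv, ivdw, rt, eta, eps, Fin.sum_univ_four]

theorem eps_zero_zero : eps 0 0 = 0 := by simp [eps]
theorem eps_zero_one : eps 0 1 = 1 := by simp [eps]
theorem eps_one_zero : eps 1 0 = -1 := by simp [eps]
theorem eps_one_one : eps 1 1 = 0 := by simp [eps]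

/-- `W_b{}^c` is an infinitesimal Lorentz transformation. -/
def IsLorentz (W : Fin 4 → Fin 4 → ℂ) : Prop :=
  ∀ b c, (eta c c : ℂ) * W b c + (eta b b : ℂ) * W c b = 0

theorem IsLorentz.components {W : Fin 4 → Fin 4 → ℂ} (h : IsLorentz W) :
    W 0 0 = 0 ∧ W 1 1 = 0 ∧ W 2 2 = 0 ∧ W 3 3 = 0 ∧ W 1 0 = W 0 1 ∧ W 2 0 = W 0 2 ∧
    W 3 0 = W 0 3 ∧ W 2 1 = -W 1 2 ∧ W 3 1 = -W 1 3 ∧ W 3 2 = -W 2 3 := by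
  have e0 : (eta 0 0 : ℂ) = 1 := by simp [eta]
  have e1 : (eta 1 1 : ℂ) = -1 := by simp [eta]
  have e2 : (eta 2 2 : ℂ) = -1 := by simp [eta]
  have e3 : (eta 3 3 : ℂ) = -1 := by simp [eta]
  have h00 := h 0 0
  have h11 := h 1 1
  have h22 := h 2 2
  have h33 := h 3 3
  have h10 := h 1 0
  have h20 := h 2 0
  have h30 := h 3 0
  have h21 := h 2 1
  have h31 := h 3 1
  have h32 := h 3 2
  simp only [e0, e1, e2, e3] at *
  refine ⟨?_, ?_, ?_, ?_, ?_, ?_, ?_, ?_, ?_, ?_⟩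
  · linear_combination h00 / 2
  · linear_combination -h11 / 2
  · linear_combination -h22 / 2
  · linear_combination -h33 / 2
  · linear_combination h10
  · linear_combination h20
  · linear_combination h30
  · linear_combination -h21
  · linear_combination -h31
  · linear_combination -h32

/-- The spin representation `½ σ^b_{BX'} σ_c^{CX'} W_b{}^c`. -/
def rho (W : Fin 4 → Fin 4 → ℂ) (B C : Fin 2) : ℂ :=
  (∑ b, ∑ c, ∑ X', ivdwInv b B X' * ivdw c C X' * W b c) / 2

/-- A Lorentz generator has six independent entries. These closed forms reduce the identities of the
spin representation to polynomial identities with `I ^ 2 = -1`. -/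
theorem rho_components {W : Fin 4 → Fin 4 → ℂ} (h : IsLorentz W) :
    rho W 0 0 = (W 0 3 + Complex.I * W 1 2) / 2 ∧
    rho W 0 1 = (W 0 1 - W 1 3 + Complex.I * (W 2 3 - W 0 2)) / 2 ∧
    rho W 1 0 = (W 0 1 + W 1 3 + Complex.I * (W 2 3 + W 0 2)) / 2 ∧
    rho W 1 1 = -(W 0 3 + Complex.I * W 1 2) / 2 := by
  obtain ⟨h0, h1, h2, h3, h10, h20, h30, h21, h31, h32⟩ := h.components
  have hr := rt_sq
  simp only [rho, Fin.sum_univ_four, Fin.sum_univ_two, ivdw_zero, ivdw_one, ivdw_two, ivdw_three,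
    ivdwInv_zero, ivdwInv_one, ivdwInv_two, ivdwInv_three, h0, h1, h2, h3, h10, h20, h30, h21, h31,
    h32]
  simp only [zero_ne_one, one_ne_zero, if_true, if_false, mul_zero, zero_mul, add_zero, zero_add,
    mul_one, mul_neg, neg_mul]
  refine ⟨?_, ?_, ?_, ?_⟩
  · linear_combination (W 0 3 + Complex.I * W 1 2) * hr
  · linear_combination (W 0 1 + Complex.I * W 2 3 - Complex.I * W 0 2 - W 1 3) * hr
  · linear_combination (W 0 1 + Complex.I * W 2 3 + Complex.I * W 0 2 + W 1 3) * hr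
  · linear_combination -(W 0 3 + Complex.I * W 1 2) * hr

/-- The Infeld–van der Waerden symbols intertwine the vector and the spin representation. -/
theorem soldering {W : Fin 4 → Fin 4 → ℂ} (h : IsLorentz W) (hW : ∀ b c, conj (W b c) = W b c)
    (c : Fin 4) (B B' : Fin 2) :
    ∑ b, ivdwInv b B B' * W b c =
      ∑ E, rho W B E * ivdwInv c E B' + ∑ E', conj (rho W B' E') * ivdwInv c B E' := by
  obtain ⟨h0, h1, h2, h3, h10, h20, h30, h21, h31, h32⟩ := h.components
  obtain ⟨r0, r1, r2, r3⟩ := rho_components h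
  fin_cases c <;> fin_cases B <;> fin_cases B' <;>
  simp only [Fin.zero_eta, Fin.mk_one, Fin.reduceFinMk, Fin.sum_univ_four, Fin.sum_univ_two,
    ivdwInv_zero, ivdwInv_one, ivdwInv_two, ivdwInv_three, h0, h1, h2, h3, h10, h20, h30, h21, h31,
    h32, r0, r1, r2, r3, map_div₀, map_add, map_sub, map_mul, map_neg, hW, Complex.conj_I,
    map_ofNat, zero_ne_one, one_ne_zero, if_true, if_false] <;>
  ring_nf <;> (try simp only [Complex.I_sq]) <;> ring

/-- The intertwining property in the form with upper spinor indices, from which the covariant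
constancy of `sigma₂` follows. -/
theorem soldering_upper {W : Fin 4 → Fin 4 → ℂ} (h : IsLorentz W)
    (hW : ∀ b c, conj (W b c) = W b c) (b : Fin 4) (A A' : Fin 2) :
    ∑ e, W b e * ivdw e A A' =
      ∑ E, rho W E A * ivdw b E A' + ∑ E', conj (rho W E' A') * ivdw b A E' := by
  obtain ⟨h0, h1, h2, h3, h10, h20, h30, h21, h31, h32⟩ := h.components
  obtain ⟨r0, r1, r2, r3⟩ := rho_components h
  fin_cases b <;> fin_cases A <;> fin_cases A' <;>
  simp only [Fin.zero_eta, Fin.mk_one, Fin.reduceFinMk, Fin.sum_univ_four, Fin.sum_univ_two,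
    ivdw_zero, ivdw_one, ivdw_two, ivdw_three, h0, h1, h2, h3, h10, h20, h30, h21, h31,
    h32, r0, r1, r2, r3, map_div₀, map_add, map_sub, map_mul, map_neg, hW, Complex.conj_I,
    map_ofNat, zero_ne_one, one_ne_zero, if_true, if_false] <;>
  ring_nf <;> (try simp only [Complex.I_sq]) <;> ring

theorem IsLorentz.comm {W V : Fin 4 → Fin 4 → ℂ} (hW : IsLorentz W) (hV : IsLorentz V) :
    IsLorentz fun b c => ∑ e, (W b e * V e c - V b e * W e c) := by
  intro b c
  rw [Finset.mul_sum, Finset.mul_sum, ← Finset.sum_add_distrib]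
  refine Finset.sum_eq_zero fun e _ => ?_
  linear_combination W b e * hV e c - V b e * hW e c + W c e * hV e b - V c e * hW e b

/-- The spin representation is a homomorphism of Lie algebras. This carries the quadratic terms of
the Riemann tensor to those of the spin curvature in `ev_spinCurv`. -/
theorem rho_comm {W V : Fin 4 → Fin 4 → ℂ} (hW : IsLorentz W) (hV : IsLorentz V) (B C : Fin 2) :
    ∑ E, (rho W B E * rho V E C - rho V B E * rho W E C) =
      rho (fun b c => ∑ e, (W b e * V e c - V b e * W e c)) B C := by
  obtain ⟨h0, h1, h2, h3, h10, h20, h30, h21, h31, h32⟩ := hW.components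
  obtain ⟨k0, k1, k2, k3, k10, k20, k30, k21, k31, k32⟩ := hV.components
  obtain ⟨r0, r1, r2, r3⟩ := rho_components hW
  obtain ⟨s0, s1, s2, s3⟩ := rho_components hV
  obtain ⟨t0, t1, t2, t3⟩ := rho_components (hW.comm hV)
  fin_cases B <;> fin_cases C <;>
  simp only [Fin.zero_eta, Fin.mk_one, t0, t1, t2, t3, r0, r1, r2, r3, s0, s1,
    s2, s3, Fin.sum_univ_two] <;>
  simp only [Fin.sum_univ_four, h0, h1, h2, h3, h10, h20, h30, h21, h31, h32, k0, k1, k2, k3, k10,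
    k20, k30, k21, k31, k32] <;>
  ring_nf <;> (try simp only [Complex.I_sq]) <;> ring

end Symbols

/-! ### Bivectors, their unprimed and primed spinors, and Maxwell's operator -/

section Bivectors

/-- The unprimed spinor `½ U_{AA'BB'} ε^{A'B'}` of a bivector. -/
def sd (U : Fin 4 → Fin 4 → ℂ) (A B : Fin 2) : ℂ :=
  (∑ a, ∑ b, ∑ A', ∑ B', ivdwInv a A A' * ivdwInv b B B' * eps A' B' * U a b) / 2

/-- The primed spinor `½ U_{AA'BB'} ε^{AB}` of a bivector. -/
def asd (U : Fin 4 → Fin 4 → ℂ) (A' B' : Fin 2) : ℂ :=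
  (∑ a, ∑ b, ∑ A, ∑ B, ivdwInv a A A' * ivdwInv b B B' * eps A B * U a b) / 2

/-- `σ_b^{AA'} σ_c^{BB'} ε_{A'B'}`. -/
def sigma₂ (b c : Fin 4) (A B : Fin 2) : ℂ := ∑ A', ∑ B', ivdw b A A' * ivdw c B B' * eps A' B'

theorem skew_components {U : Fin 4 → Fin 4 → ℂ} (h : ∀ a b, U a b = -U b a) :
    U 0 0 = 0 ∧ U 1 1 = 0 ∧ U 2 2 = 0 ∧ U 3 3 = 0 ∧ U 1 0 = -U 0 1 ∧ U 2 0 = -U 0 2 ∧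
    U 3 0 = -U 0 3 ∧ U 2 1 = -U 1 2 ∧ U 3 1 = -U 1 3 ∧ U 3 2 = -U 2 3 :=
  ⟨self_eq_neg.1 (h 0 0), self_eq_neg.1 (h 1 1), self_eq_neg.1 (h 2 2), self_eq_neg.1 (h 3 3),
    h 1 0, h 2 0, h 3 0, h 2 1, h 3 1, h 3 2⟩

theorem sd_components {U : Fin 4 → Fin 4 → ℂ} (h : ∀ a b, U a b = -U b a) :
    sd U 0 0 = (U 0 1 - U 1 3 + Complex.I * (U 2 3 - U 0 2)) / 2 ∧
    sd U 0 1 = -(U 0 3 + Complex.I * U 1 2) / 2 ∧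
    sd U 1 0 = -(U 0 3 + Complex.I * U 1 2) / 2 ∧
    sd U 1 1 = -(U 0 1 + U 1 3 + Complex.I * (U 2 3 + U 0 2)) / 2 := by
  obtain ⟨h0, h1, h2, h3, h10, h20, h30, h21, h31, h32⟩ := skew_components h
  have hr := rt_sq
  simp only [sd, Fin.sum_univ_four, Fin.sum_univ_two, ivdwInv_zero, ivdwInv_one, ivdwInv_two,
    ivdwInv_three, eps_zero_zero, eps_zero_one, eps_one_zero, eps_one_one, h0, h1, h2, h3, h10,
    h20, h30, h21, h31, h32]
  simp only [zero_ne_one, one_ne_zero, if_true, if_false, mul_zero, zero_mul, add_zero, zero_add,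
    mul_one, mul_neg, neg_mul]
  refine ⟨?_, ?_, ?_, ?_⟩
  · linear_combination (U 0 1 - U 1 3 + Complex.I * (U 2 3 - U 0 2)) * hr
  · linear_combination -(U 0 3 + Complex.I * U 1 2) * hr
  · linear_combination -(U 0 3 + Complex.I * U 1 2) * hr
  · linear_combination -(U 0 1 + U 1 3 + Complex.I * (U 2 3 + U 0 2)) * hr

theorem asd_components {U : Fin 4 → Fin 4 → ℂ} (h : ∀ a b, U a b = -U b a) :
    asd U 0 0 = (U 0 1 - U 1 3 - Complex.I * (U 2 3 - U 0 2)) / 2 ∧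
    asd U 0 1 = -(U 0 3 - Complex.I * U 1 2) / 2 ∧
    asd U 1 0 = -(U 0 3 - Complex.I * U 1 2) / 2 ∧
    asd U 1 1 = -(U 0 1 + U 1 3 - Complex.I * (U 2 3 + U 0 2)) / 2 := by
  obtain ⟨h0, h1, h2, h3, h10, h20, h30, h21, h31, h32⟩ := skew_components h
  have hr := rt_sq
  simp only [asd, Fin.sum_univ_four, Fin.sum_univ_two, ivdwInv_zero, ivdwInv_one, ivdwInv_two,
    ivdwInv_three, eps_zero_zero, eps_zero_one, eps_one_zero, eps_one_one, h0, h1, h2, h3, h10,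
    h20, h30, h21, h31, h32]
  simp only [zero_ne_one, one_ne_zero, if_true, if_false, mul_zero, zero_mul, add_zero, zero_add,
    mul_one, mul_neg, neg_mul]
  refine ⟨?_, ?_, ?_, ?_⟩
  · linear_combination (U 0 1 - U 1 3 - Complex.I * (U 2 3 - U 0 2)) * hr
  · linear_combination -(U 0 3 - Complex.I * U 1 2) * hr
  · linear_combination -(U 0 3 - Complex.I * U 1 2) * hr
  · linear_combination -(U 0 1 + U 1 3 - Complex.I * (U 2 3 + U 0 2)) * hr

theorem sd_symm {U : Fin 4 → Fin 4 → ℂ} (h : ∀ a b, U a b = -U b a) (A B : Fin 2) :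
    sd U A B = sd U B A := by
  obtain ⟨-, h1, h2, -⟩ := sd_components h
  fin_cases A <;> fin_cases B <;> simp [h1, h2]

/-- The spin representation of `W_c{}^d` is the spinor of the bivector `W_{cd}`. -/
theorem sd_lower {W : Fin 4 → Fin 4 → ℂ} (h : IsLorentz W) (B C : Fin 2) :
    sd (fun c d => W c d * (eta d d : ℂ)) B C = ∑ E, rho W B E * eps E C := by
  have hU : ∀ a b, W a b * (eta b b : ℂ) = -(W b a * (eta a a : ℂ)) := fun a b => by
    linear_combination h a b
  obtain ⟨s0, s1, s2, s3⟩ := sd_components hU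
  obtain ⟨r0, r1, r2, r3⟩ := rho_components h
  have e1 : (eta 1 1 : ℂ) = -1 := by simp [eta]
  have e2 : (eta 2 2 : ℂ) = -1 := by simp [eta]
  have e3 : (eta 3 3 : ℂ) = -1 := by simp [eta]
  fin_cases B <;> fin_cases C <;>
  simp only [Fin.zero_eta, Fin.mk_one, s0, s1, s2, s3, r0, r1, r2, r3, Fin.sum_univ_two, e1, e2, e3,
    eps_zero_zero, eps_zero_one, eps_one_zero, eps_one_one] <;> ring

theorem sigma₂_eq (b c : Fin 4) (A B : Fin 2) :
    sigma₂ b c A B = ivdw b A 0 * ivdw c B 1 - ivdw b A 1 * ivdw c B 0 := by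
  simp only [sigma₂, Fin.sum_univ_two, eps_zero_zero, eps_zero_one, eps_one_zero, eps_one_one]
  ring

/-- The components of the bivector `φ_{AB} ε_{A'B'}`. -/
theorem sum_sigma₂_mul {φ : Fin 2 → Fin 2 → ℂ} (h : φ 1 0 = φ 0 1) :
    (∀ b c, ∑ A, ∑ B, sigma₂ b c A B * φ A B = -∑ A, ∑ B, sigma₂ c b A B * φ A B) ∧
    ∑ A, ∑ B, sigma₂ 0 1 A B * φ A B = (φ 0 0 - φ 1 1) / 2 ∧
    ∑ A, ∑ B, sigma₂ 0 2 A B * φ A B = Complex.I * (φ 0 0 + φ 1 1) / 2 ∧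
    ∑ A, ∑ B, sigma₂ 0 3 A B * φ A B = -φ 0 1 ∧
    ∑ A, ∑ B, sigma₂ 1 2 A B * φ A B = Complex.I * φ 0 1 ∧
    ∑ A, ∑ B, sigma₂ 1 3 A B * φ A B = -(φ 0 0 + φ 1 1) / 2 ∧
    ∑ A, ∑ B, sigma₂ 2 3 A B * φ A B = Complex.I * (φ 1 1 - φ 0 0) / 2 := by
  have hr := rt_sq
  refine ⟨fun b c => ?_, ?_⟩
  · simp only [Fin.sum_univ_two, sigma₂_eq, h]
    ring
  · simp only [Fin.sum_univ_two, sigma₂_eq, h, ivdw_zero, ivdw_one, ivdw_two, ivdw_three]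
    simp only [zero_ne_one, one_ne_zero, if_true, if_false, mul_zero, zero_mul, add_zero, zero_add,
      mul_one, mul_neg, neg_mul, sub_zero, zero_sub]
    refine ⟨?_, ?_, ?_, ?_, ?_, ?_⟩
    · linear_combination (φ 0 0 - φ 1 1) * hr
    · linear_combination Complex.I * (φ 0 0 + φ 1 1) * hr
    · linear_combination -2 * φ 0 1 * hr
    · linear_combination 2 * Complex.I * φ 0 1 * hr
    · linear_combination -(φ 0 0 + φ 1 1) * hr
    · linear_combination Complex.I * (φ 1 1 - φ 0 0) * hr

/-- A bivector without primed part is determined by its unprimed spinor. -/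
theorem eq_sum_sigma₂_sd {U : Fin 4 → Fin 4 → ℂ} (h : ∀ a b, U a b = -U b a)
    (h0 : ∀ A' B', asd U A' B' = 0) (b c : Fin 4) :
    U b c = ∑ A, ∑ B, sigma₂ b c A B * sd U A B := by
  obtain ⟨s0, s1, s2, s3⟩ := sd_components h
  obtain ⟨a0, a1, -, a3⟩ := asd_components h
  rw [h0] at a0 a1 a3
  obtain ⟨f, f01, f02, f03, f12, f13, f23⟩ := sum_sigma₂_mul (φ := sd U) (sd_symm h 1 0)
  have hI := Complex.I_mul_I
  rw [s0, s3] at f01 f02 f13 f23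
  rw [s1] at f03 f12
  -- Vanishing of the primed spinor is a duality relation: it expresses three of the six components
  -- through the other three.
  have hA : U 0 1 = Complex.I * U 2 3 := by linear_combination a3 - a0
  have hB : U 1 3 = Complex.I * U 0 2 := by linear_combination a3 + a0
  have hC : U 0 3 = Complex.I * U 1 2 := by linear_combination 2 * a1
  rw [hA, hB] at f01 f02 f13 f23
  rw [hC] at f03 f12
  have g01 : U 0 1 = ∑ A, ∑ B, sigma₂ 0 1 A B * sd U A B := by rw [f01, hA]; ring
  have g02 : U 0 2 = ∑ A, ∑ B, sigma₂ 0 2 A B * sd U A B := by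
    rw [f02]; linear_combination U 0 2 * hI
  have g03 : U 0 3 = ∑ A, ∑ B, sigma₂ 0 3 A B * sd U A B := by rw [f03, hC]; ring
  have g12 : U 1 2 = ∑ A, ∑ B, sigma₂ 1 2 A B * sd U A B := by
    rw [f12]; linear_combination U 1 2 * hI
  have g13 : U 1 3 = ∑ A, ∑ B, sigma₂ 1 3 A B * sd U A B := by rw [f13, hB]; ring
  have g23 : U 2 3 = ∑ A, ∑ B, sigma₂ 2 3 A B * sd U A B := by
    rw [f23]; linear_combination U 2 3 * hI
  have diag : ∀ a, U a a = ∑ A, ∑ B, sigma₂ a a A B * sd U A B := fun a => by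
    rw [self_eq_neg.1 (h a a), self_eq_neg.1 (f a a)]
  have swap : ∀ a b, U a b = ∑ A, ∑ B, sigma₂ a b A B * sd U A B →
      U b a = ∑ A, ∑ B, sigma₂ b a A B * sd U A B := fun a b hab => by rw [h, f, hab]
  fin_cases b <;> fin_cases c <;>
  first
  | exact diag _ | exact g01 | exact g02 | exact g03 | exact g12 | exact g13 | exact g23
  | exact swap _ _ g01 | exact swap _ _ g02 | exact swap _ _ g03 | exact swap _ _ g12
  | exact swap _ _ g13 | exact swap _ _ g23

/-- The cyclic sum `∇_{[a} F_{bc]}` for `F_{bc} = φ_{BC} ε_{B'C'}` in terms of `N = ∇φ`. -/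
def cyc (N : Fin 4 → Fin 2 → Fin 2 → ℂ) (a b c : Fin 4) : ℂ :=
  (∑ A, ∑ B, sigma₂ b c A B * N a A B) + (∑ A, ∑ B, sigma₂ c a A B * N b A B)
    + ∑ A, ∑ B, sigma₂ a b A B * N c A B

/-- The Maxwell operator `∇^A_{A'} φ_{AB}`, up to sign, in terms of `N = ∇φ`. -/
def maxwellOp (N : Fin 4 → Fin 2 → Fin 2 → ℂ) (A' B : Fin 2) : ℂ :=
  ∑ a, (ivdwInv a 0 A' * N a 1 B - ivdwInv a 1 A' * N a 0 B)

theorem rt_ne_zero : rt ≠ 0 := by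
  intro h
  have := rt_sq
  rw [h] at this
  norm_num at this

theorem maxwellOp_components {N : Fin 4 → Fin 2 → Fin 2 → ℂ} (h : ∀ a, N a 1 0 = N a 0 1) :
    maxwellOp N 0 0 = rt * (N 0 0 1 + N 3 0 1 - N 1 0 0 - Complex.I * N 2 0 0) ∧
    maxwellOp N 0 1 = rt * (N 0 1 1 + N 3 1 1 - N 1 0 1 - Complex.I * N 2 0 1) ∧
    maxwellOp N 1 0 = rt * (N 1 0 1 - Complex.I * N 2 0 1 - N 0 0 0 + N 3 0 0) ∧
    maxwellOp N 1 1 = rt * (N 1 1 1 - Complex.I * N 2 1 1 - N 0 0 1 + N 3 0 1) := by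
  simp only [maxwellOp, Fin.sum_univ_four, ivdwInv_zero, ivdwInv_one, ivdwInv_two, ivdwInv_three, h]
  simp only [zero_ne_one, one_ne_zero, if_true, if_false]
  refine ⟨?_, ?_, ?_, ?_⟩ <;> ring

/-- A 3-form in four dimensions has four components, as many as a spinor with one primed and one
unprimed index. For `φ_{AB} ε_{A'B'}` the two sets are related by an invertible linear map, so
closedness and Maxwell's equations are the same condition. -/
theorem cyc_components {N : Fin 4 → Fin 2 → Fin 2 → ℂ} (h : ∀ a, N a 1 0 = N a 0 1) :
    rt * cyc N 0 1 2 = Complex.I / 2 * (maxwellOp N 0 0 - maxwellOp N 1 1) ∧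
    rt * cyc N 1 2 3 = Complex.I / 2 * (maxwellOp N 0 0 + maxwellOp N 1 1) ∧
    rt * cyc N 0 2 3 = Complex.I / 2 * (maxwellOp N 0 1 + maxwellOp N 1 0) ∧
    rt * cyc N 0 1 3 = -1 / 2 * (maxwellOp N 0 1 - maxwellOp N 1 0) := by
  obtain ⟨w0, w1, w2, w3⟩ := maxwellOp_components h
  have hI := Complex.I_mul_I
  have s20 := fun a => (sum_sigma₂_mul (h a)).1 2 0
  have s30 := fun a => (sum_sigma₂_mul (h a)).1 3 0
  have s31 := fun a => (sum_sigma₂_mul (h a)).1 3 1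
  have f := fun a => (sum_sigma₂_mul (h a)).2
  simp only [cyc, s20, s30, s31, f, w0, w1, w2, w3]
  refine ⟨?_, ?_, ?_, ?_⟩
  · linear_combination rt / 2 * (N 2 0 0 - N 2 1 1) * hI
  · linear_combination rt / 2 * (N 2 0 0 + N 2 1 1) * hI
  · linear_combination rt * N 2 0 1 * hI
  · ring

theorem maxwellOp_eq_zero_of_cyc {N : Fin 4 → Fin 2 → Fin 2 → ℂ} (h : ∀ a, N a 1 0 = N a 0 1)
    (h0 : ∀ a b c, cyc N a b c = 0) (A' B : Fin 2) : maxwellOp N A' B = 0 := by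
  obtain ⟨w0, w1, w2, w3⟩ := cyc_components h
  have hI := Complex.I_mul_I
  simp only [h0, mul_zero] at w0 w1 w2 w3
  fin_cases A' <;> fin_cases B <;> simp only [Fin.zero_eta, Fin.mk_one]
  · linear_combination Complex.I * (w0 + w1) + maxwellOp N 0 0 * hI
  · linear_combination Complex.I * w2 + w3 + (maxwellOp N 0 1 + maxwellOp N 1 0) / 2 * hI
  · linear_combination Complex.I * w2 - w3 + (maxwellOp N 0 1 + maxwellOp N 1 0) / 2 * hI
  · linear_combination Complex.I * (w1 - w0) + maxwellOp N 1 1 * hI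

/-- A rotation and a transposition generate all permutations of three indices, so the four
increasing triples determine `T`. -/
theorem alternating_eq_zero {T : Fin 4 → Fin 4 → Fin 4 → ℂ} (rot : ∀ a b c, T a b c = T b c a)
    (swp : ∀ a b c, T a b c = -T b a c) (w0 : T 0 1 2 = 0) (w1 : T 1 2 3 = 0) (w2 : T 0 2 3 = 0)
    (w3 : T 0 1 3 = 0) (a b c : Fin 4) : T a b c = 0 := by
  have d1 : ∀ a c, T a a c = 0 := fun a c => self_eq_neg.1 (swp a a c)
  have d2 : ∀ a c, T c a a = 0 := fun a c => by rw [rot, d1]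
  have d3 : ∀ a c, T a c a = 0 := fun a c => by rw [rot, rot, d1]
  have all : ∀ a b c, T a b c = 0 → T b c a = 0 ∧ T c a b = 0 ∧ T b a c = 0 ∧
      T a c b = 0 ∧ T c b a = 0 := by
    intro a b c h
    have e1 := rot a b c
    have e2 := rot b c a
    have e3 := swp a b c
    have e4 := rot b a c
    have e5 := rot a c b
    rw [h] at e1 e3
    rw [← e1] at e2
    have e3' : T b a c = 0 := neg_eq_zero.1 e3.symm
    rw [e3'] at e4
    rw [← e4] at e5
    exact ⟨e1.symm, e2.symm, e3', e4.symm, e5.symm⟩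
  fin_cases a <;> fin_cases b <;> fin_cases c <;>
  first
  | exact d1 _ _ | exact d2 _ _ | exact d3 _ _
  | exact w0 | exact w1 | exact w2 | exact w3
  | exact (all _ _ _ w0).1 | exact (all _ _ _ w0).2.1 | exact (all _ _ _ w0).2.2.1
  | exact (all _ _ _ w0).2.2.2.1 | exact (all _ _ _ w0).2.2.2.2
  | exact (all _ _ _ w1).1 | exact (all _ _ _ w1).2.1 | exact (all _ _ _ w1).2.2.1
  | exact (all _ _ _ w1).2.2.2.1 | exact (all _ _ _ w1).2.2.2.2
  | exact (all _ _ _ w2).1 | exact (all _ _ _ w2).2.1 | exact (all _ _ _ w2).2.2.1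
  | exact (all _ _ _ w2).2.2.2.1 | exact (all _ _ _ w2).2.2.2.2
  | exact (all _ _ _ w3).1 | exact (all _ _ _ w3).2.1 | exact (all _ _ _ w3).2.2.1
  | exact (all _ _ _ w3).2.2.2.1 | exact (all _ _ _ w3).2.2.2.2

theorem cyc_eq_zero_of_maxwellOp {N : Fin 4 → Fin 2 → Fin 2 → ℂ} (h : ∀ a, N a 1 0 = N a 0 1)
    (h0 : ∀ A' B, maxwellOp N A' B = 0) (a b c : Fin 4) : cyc N a b c = 0 := by
  obtain ⟨w0, w1, w2, w3⟩ := cyc_components h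
  simp only [h0, sub_zero, add_zero, mul_zero, mul_eq_zero, rt_ne_zero, false_or] at w0 w1 w2 w3
  have f := fun a => (sum_sigma₂_mul (h a)).1
  exact alternating_eq_zero (fun a b c => by simp only [cyc]; ring)
    (fun a b c => by simp only [cyc, f _ a b, f _ b c, f _ c a]; ring) w0 w1 w2 w3 a b c

/-- `σ_b^{AA'} σ_c^{BB'} ε_{A'B'}` is covariantly constant. -/
theorem sigma₂_parallel {W : Fin 4 → Fin 4 → ℂ} (h : IsLorentz W)
    (hW : ∀ b c, conj (W b c) = W b c) (b c : Fin 4) (A B : Fin 2) :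
    ∑ e, W b e * sigma₂ e c A B + ∑ e, W c e * sigma₂ b e A B =
      ∑ E, rho W E A * sigma₂ b c E B + ∑ E, rho W E B * sigma₂ b c A E := by
  obtain ⟨r0, -, -, r3⟩ := rho_components h
  have hr : rho W 1 1 = -rho W 0 0 := by rw [r0, r3]; ring
  have e1 : ∑ e, W b e * sigma₂ e c A B =
      (∑ e, W b e * ivdw e A 0) * ivdw c B 1 - (∑ e, W b e * ivdw e A 1) * ivdw c B 0 := by
    simp only [sigma₂_eq, Fin.sum_univ_four]; ring
  have e2 : ∑ e, W c e * sigma₂ b e A B =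
      ivdw b A 0 * (∑ e, W c e * ivdw e B 1) - ivdw b A 1 * (∑ e, W c e * ivdw e B 0) := by
    simp only [sigma₂_eq, Fin.sum_univ_four]; ring
  rw [e1, e2]
  simp only [soldering_upper h hW, Fin.sum_univ_two, sigma₂_eq, hr, map_neg]
  ring

end Bivectors

/-! ### Exterior derivative of a 2-form in frame components -/

section ExteriorDerivative

variable {A : Type*} [CommRing A] [Algebra ℂ A] {D : Fin 4 → Derivation ℂ A A}
  {C : Fin 4 → Fin 4 → Fin 4 → A} {F : Fin 4 → Fin 4 → A}

/-- The frame components of the exterior derivative of the 2-form `F`. -/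
def extD (D : Fin 4 → Derivation ℂ A A) (C : Fin 4 → Fin 4 → Fin 4 → A) (F : Fin 4 → Fin 4 → A)
    (a b c : Fin 4) : A :=
  D a (F b c) + D b (F c a) + D c (F a b)
    - ∑ e, (C a b e * F e c + C b c e * F e a + C c a e * F e b)

/-- The Cartan formula for the exterior derivative, in frame components. -/
theorem cartan_formula (hF : ∀ a b, F a b = -F b a) (X Y Z : Fin 4 → A)
    (dX dY dZ : Derivation ℂ A A) (hX : ∀ f, dX f = ∑ a, X a * D a f)
    (hY : ∀ f, dY f = ∑ a, Y a * D a f) (hZ : ∀ f, dZ f = ∑ a, Z a * D a f) :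
    dX (∑ b, ∑ c, F b c * Y b * Z c) + dY (∑ b, ∑ c, F b c * Z b * X c)
      + dZ (∑ b, ∑ c, F b c * X b * Y c)
      - ∑ e, ∑ c, F e c * (dX (Y e) - dY (X e) + ∑ a, ∑ b, X a * Y b * C a b e) * Z c
      - ∑ e, ∑ c, F e c * (dY (Z e) - dZ (Y e) + ∑ a, ∑ b, Y a * Z b * C a b e) * X c
      - ∑ e, ∑ c, F e c * (dZ (X e) - dX (Z e) + ∑ a, ∑ b, Z a * X b * C a b e) * Y c
    = ∑ a, ∑ b, ∑ c, X a * Y b * Z c * extD D C F a b c := by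
  have leib : ∀ (d : Derivation ℂ A A) (U V : Fin 4 → A), d (∑ b, ∑ c, F b c * U b * V c) =
      (∑ b, ∑ c, d (F b c) * U b * V c) + (∑ b, ∑ c, F b c * d (U b) * V c)
        - ∑ b, ∑ c, F b c * d (V b) * U c := by
    intro d U V
    -- Antisymmetry of `F` moves the differentiated vector into the first slot, where it can meet
    -- the derivative terms of the bracket.
    have h : ∑ b, ∑ c, F b c * d (V b) * U c = ∑ b, ∑ c, -(F b c * U b * d (V c)) := by
      rw [Finset.sum_comm]
      refine Finset.sum_congr rfl fun b _ => Finset.sum_congr rfl fun c _ => ?_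
      rw [hF c b]; ring
    rw [h, ← sub_eq_zero]
    simp only [map_sum, Derivation.leibniz, smul_eq_mul, ← Finset.sum_add_distrib,
      ← Finset.sum_sub_distrib]
    exact Finset.sum_eq_zero fun b _ => Finset.sum_eq_zero fun c _ => by ring
  have spl : ∀ (P Q : Fin 4 → A) (R : Fin 4 → A) (V : Fin 4 → A),
      ∑ e, ∑ c, F e c * (P e - Q e + R e) * V c =
      (∑ e, ∑ c, F e c * P e * V c) - (∑ e, ∑ c, F e c * Q e * V c)
        + ∑ e, ∑ c, F e c * R e * V c := by
    intro P Q R V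
    simp only [← Finset.sum_add_distrib, ← Finset.sum_sub_distrib]
    exact Finset.sum_congr rfl fun b _ => Finset.sum_congr rfl fun c _ => by ring
  rw [leib, leib, leib, spl, spl, spl]
  have c1 : ∑ b, ∑ c, dX (F b c) * Y b * Z c = ∑ a, ∑ b, ∑ c, X a * Y b * Z c * D a (F b c) := by
    simp only [hX, Fin.sum_univ_four]; ring
  have c2 : ∑ b, ∑ c, dY (F b c) * Z b * X c = ∑ a, ∑ b, ∑ c, X a * Y b * Z c * D b (F c a) := by
    simp only [hY, Fin.sum_univ_four]; ring
  have c3 : ∑ b, ∑ c, dZ (F b c) * X b * Y c = ∑ a, ∑ b, ∑ c, X a * Y b * Z c * D c (F a b) := by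
    simp only [hZ, Fin.sum_univ_four]; ring
  have c4 : ∑ e, ∑ c, F e c * (∑ a, ∑ b, X a * Y b * C a b e) * Z c =
      ∑ a, ∑ b, ∑ c, X a * Y b * Z c * ∑ e, C a b e * F e c := by
    simp only [Fin.sum_univ_four]; ring
  have c5 : ∑ e, ∑ c, F e c * (∑ a, ∑ b, Y a * Z b * C a b e) * X c =
      ∑ a, ∑ b, ∑ c, X a * Y b * Z c * ∑ e, C b c e * F e a := by
    simp only [Fin.sum_univ_four]; ring
  have c6 : ∑ e, ∑ c, F e c * (∑ a, ∑ b, Z a * X b * C a b e) * Y c =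
      ∑ a, ∑ b, ∑ c, X a * Y b * Z c * ∑ e, C c a e * F e b := by
    simp only [Fin.sum_univ_four]; ring
  have c7 : ∑ a, ∑ b, ∑ c, X a * Y b * Z c * extD D C F a b c =
      (∑ a, ∑ b, ∑ c, X a * Y b * Z c * D a (F b c))
      + (∑ a, ∑ b, ∑ c, X a * Y b * Z c * D b (F c a))
      + (∑ a, ∑ b, ∑ c, X a * Y b * Z c * D c (F a b))
      - (∑ a, ∑ b, ∑ c, X a * Y b * Z c * ∑ e, C a b e * F e c)
      - (∑ a, ∑ b, ∑ c, X a * Y b * Z c * ∑ e, C b c e * F e a)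
      - (∑ a, ∑ b, ∑ c, X a * Y b * Z c * ∑ e, C c a e * F e b) := by
    simp only [← Finset.sum_add_distrib, ← Finset.sum_sub_distrib]
    refine Finset.sum_congr rfl fun a _ => Finset.sum_congr rfl fun b _ =>
      Finset.sum_congr rfl fun c _ => ?_
    rw [extD]
    simp only [Finset.sum_add_distrib]
    ring
  rw [c1, c2, c3, c4, c5, c6, c7]
  ring

end ExteriorDerivative

/-- The exterior derivative of `φ_{AB} ε_{A'B'}` in terms of the covariant derivative of `φ`. -/
theorem cyc_covariant {W : Fin 4 → Fin 4 → Fin 4 → ℂ} (h : ∀ a, IsLorentz (W a))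
    (hW : ∀ a b c, conj (W a b c) = W a b c) (d : Fin 4 → Fin 2 → Fin 2 → ℂ)
    {φ : Fin 2 → Fin 2 → ℂ} (hφ : φ 1 0 = φ 0 1) (a b c : Fin 4) :
    cyc (fun a A B => d a A B - ∑ X, rho (W a) A X * φ X B - ∑ X, rho (W a) B X * φ A X) a b c =
    cyc d a b c - ∑ e, ((W a b e - W b a e) * (∑ A, ∑ B, sigma₂ e c A B * φ A B)
      + (W b c e - W c b e) * (∑ A, ∑ B, sigma₂ e a A B * φ A B)
      + (W c a e - W a c e) * ∑ A, ∑ B, sigma₂ e b A B * φ A B) := by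
  have par : ∀ a b c, ∑ A, ∑ B, sigma₂ b c A B *
      (d a A B - ∑ X, rho (W a) A X * φ X B - ∑ X, rho (W a) B X * φ A X) =
      (∑ A, ∑ B, sigma₂ b c A B * d a A B)
        - ∑ e, (W a b e * (∑ A, ∑ B, sigma₂ e c A B * φ A B)
          - W a c e * ∑ A, ∑ B, sigma₂ e b A B * φ A B) := by
    intro a b c
    have p := fun A B => sigma₂_parallel (h a) (hW a) b c A B
    have e : ∑ e, (W a b e * (∑ A, ∑ B, sigma₂ e c A B * φ A B)
          - W a c e * ∑ A, ∑ B, sigma₂ e b A B * φ A B) = ∑ A, ∑ B,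
        (∑ e, W a b e * sigma₂ e c A B + ∑ e, W a c e * sigma₂ b e A B) * φ A B := by
      -- Antisymmetry of the 2-form puts the connection terms of both indices into the same shape,
      -- so that the cyclic sum collects them into torsion.
      have f := fun e => (sum_sigma₂_mul hφ).1 e b
      simp only [f, mul_neg, sub_neg_eq_add]
      simp only [Fin.sum_univ_four, Fin.sum_univ_two]
      ring
    rw [e]
    simp only [p]
    simp only [Fin.sum_univ_two]
    ring
  simp only [cyc, par, Finset.sum_add_distrib, Finset.sum_sub_distrib, sub_mul]
  ring

/-! ### Maxwell's equations and closed 2-forms on the manifold -/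

section Evaluation

variable {M : Type*} [TopologicalSpace M] [ChartedSpace (EuclideanSpace ℝ (Fin 4)) M]

/-- Evaluation of a smooth function at a point. -/
def ev (x : M) : smoothFn M →ₐ[ℂ] ℂ := (Pi.evalAlgHom ℂ (fun _ : M => ℂ) x).comp (smoothFn M).val

theorem ev_apply (x : M) (f : smoothFn M) : ev x f = f.1 x := rfl

theorem eq_of_ev {f g : smoothFn M} (h : ∀ x, ev x f = ev x g) : f = g :=
  smoothFn.ext_iff.2 h

end Evaluation

namespace SpinSpacetime

variable {M : Type*} [TopologicalSpace M] [ChartedSpace (EuclideanSpace ℝ (Fin 4)) M]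
  [IsManifold (𝓡 4) ∞ M] (S : SpinSpacetime M)

/-- The spin connection as smooth functions. -/
def γ (a : Fin 4) (B E : Fin 2) : smoothFn M :=
  ∑ b, ∑ c, ∑ X', (ivdwInv b B X' * ivdw c E X' / 2) • S.Γ a b c

theorem ev_Γ (a b c : Fin 4) (x : M) : ev x (S.Γ a b c) = (S.conn a b c x : ℂ) := rfl

theorem ev_C (a b c : Fin 4) (x : M) : ev x (S.C a b c) = S.conn a b c x - S.conn b a c x := by
  rw [← torsion, map_sub, ev_Γ, ev_Γ]

theorem isLorentz_conn (a : Fin 4) (x : M) : IsLorentz fun b c => (S.conn a b c x : ℂ) :=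
  fun b c => by
    have h := S.conn_skew a b c x
    beta_reduce
    exact_mod_cast h

theorem spinConn_eq_rho (a : Fin 4) (B E : Fin 2) (x : M) :
    S.spinConn a B E x = rho (fun b c => (S.conn a b c x : ℂ)) B E := rfl

theorem ev_γ (a : Fin 4) (B E : Fin 2) (x : M) : ev x (S.γ a B E) = S.spinConn a B E x := by
  simp only [γ, map_sum, map_smul, ev_Γ, smul_eq_mul, spinConn, Finset.sum_div]
  refine Finset.sum_congr rfl fun b _ => Finset.sum_congr rfl fun c _ =>
    Finset.sum_congr rfl fun X _ => by ring

theorem nabla₀_eq (f : smoothFn M) (A A' : Fin 2) (x : M) :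
    S.nabla₀ f.1 A A' x = ∑ a, ivdwInv a A A' * ev x (S.D a f) := rfl

theorem nabla₁_eq (κ : Fin 2 → smoothFn M) (A A' B : Fin 2) (x : M) :
    S.nabla₁ (fun y B => ev y (κ B)) A A' B x =
      ∑ a, ivdwInv a A A' * (ev x (S.D a (κ B)) - ∑ X, S.spinConn a B X x * ev x (κ X)) := rfl

theorem nabla₂_eq (K : Fin 2 → Fin 2 → smoothFn M) (A A' B E : Fin 2) (x : M) :
    S.nabla₂ (fun y B E => ev y (K B E)) A A' B E x =
      ∑ a, ivdwInv a A A' * ev x (covD₂ S.D S.γ K a B E) := by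
  simp only [covD₂, map_sub, map_sum, map_mul, ev_γ]
  rfl

/-- `maxwellOp` has a lower primed index; raising it with `ε` only exchanges the two equations up to
sign. -/
theorem isMaxwell_iff {φ : Fin 2 → Fin 2 → smoothFn M} (hφ : ∀ A B, φ A B = φ B A) :
    S.IsMaxwell (fun y A B => ev y (φ A B)) ↔
      ∀ x A' B, maxwellOp (fun a A B => ev x (covD₂ S.D S.γ φ a A B)) A' B = 0 := by
  have key : ∀ x A' B, ∑ A, ∑ E, ∑ C', eps A E * eps A' C' *
      S.nabla₂ (fun y A B => ev y (φ A B)) E C' A B x =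
      ∑ C', eps A' C' * -maxwellOp (fun a A B => ev x (covD₂ S.D S.γ φ a A B)) C' B := by
    intro x A' B
    simp only [nabla₂_eq, maxwellOp, Fin.sum_univ_two, Fin.sum_univ_four, eps_zero_zero,
      eps_zero_one, eps_one_zero, eps_one_one]
    ring
  constructor
  · rintro ⟨-, h⟩ x A' B
    have h0 := h 0 B x
    have h1 := h 1 B x
    rw [key] at h0 h1
    simp only [Fin.sum_univ_two, eps_zero_zero, eps_zero_one, eps_one_zero, eps_one_one] at h0 h1
    fin_cases A' <;> simp only [Fin.zero_eta, Fin.mk_one]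
    · linear_combination h1
    · linear_combination -h0
  · refine fun h => ⟨fun x A B => congrArg (ev x) (hφ A B), fun A' B x => ?_⟩
    rw [key]
    simp [h]

theorem covD₂_symm {φ : Fin 2 → Fin 2 → smoothFn M} (hφ : ∀ A B, φ A B = φ B A) (a : Fin 4)
    (A B : Fin 2) : covD₂ S.D S.γ φ a A B = covD₂ S.D S.γ φ a B A := by
  simp only [covD₂, hφ B A, Fin.sum_univ_two, hφ 0 B, hφ 1 B, hφ A 0, hφ A 1]
  ring

/-- A 2-form whose frame components satisfy `dF = 0` is closed. -/
theorem isClosedTwoForm_of_extD {F : Fin 4 → Fin 4 → smoothFn M} (hF : ∀ a b, F a b = -F b a)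
    (h : ∀ a b c, extD S.D S.C F a b c = 0) :
    IsClosedTwoForm fun x u v => ∑ a, ∑ b, ev x (F a b) * (S.coord x u a : ℂ) * S.coord x v b := by
  intro X Y Z hX hY hZ x
  let cf : ∀ {V : (x : M) → TangentSpace (𝓡 4) x}, SmoothVectorField V → Fin 4 → smoothFn M :=
    fun hV a => ⟨_, ContMDiff.ofReal (S.coord_smooth hV a)⟩
  have hd : ∀ {V : (x : M) → TangentSpace (𝓡 4) x} (hV : SmoothVectorField V) (f : smoothFn M),
      vfDeriv V hV f = ∑ a, cf hV a * S.D a f := by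
    intro V hV f
    refine eq_of_ev fun y => ?_
    simp only [map_sum, map_mul]
    exact dirDeriv_sum_smul Finset.univ (fun a y => S.coord y (V y) a) S.frame V f.1 y
      (S.sum_coord_smul_frame y (V y)).symm
  have key := congrArg (ev x) (cartan_formula (D := S.D) (C := S.C) hF (cf hX) (cf hY) (cf hZ)
    (vfDeriv X hX) (vfDeriv Y hY) (vfDeriv Z hZ) (hd hX) (hd hY) (hd hZ))
  simp only [h, mul_zero, Finset.sum_const_zero, map_zero] at key
  rw [← key]
  have hpair : ∀ {U V W : (x : M) → TangentSpace (𝓡 4) x} (hU : SmoothVectorField U)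
      (hV : SmoothVectorField V) (hW : SmoothVectorField W),
      dirDeriv U (fun y => ∑ a, ∑ b, ev y (F a b) * (S.coord y (V y) a : ℂ) * S.coord y (W y) b) x
      = ev x (vfDeriv U hU (∑ b, ∑ c, F b c * cf hV b * cf hW c)) := by
    intro U V W hU hV hW
    rw [ev_apply, vfDeriv_apply]
    refine congrArg (fun f => dirDeriv U f x) (funext fun y => ?_)
    change _ = ev y (∑ b, ∑ c, F b c * cf hV b * cf hW c)
    simp only [map_sum, map_mul]
    rfl
  have hbr : ∀ {U V W : (x : M) → TangentSpace (𝓡 4) x} (hU : SmoothVectorField U)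
      (hV : SmoothVectorField V) (hW : SmoothVectorField W),
      (∑ a, ∑ b, ev x (F a b) * (S.coord x (VectorField.mlieBracket (𝓡 4) U V x) a : ℂ)
        * S.coord x (W x) b)
      = ev x (∑ e, ∑ c, F e c * (vfDeriv U hU (cf hV e) - vfDeriv V hV (cf hU e)
        + ∑ a, ∑ b, cf hU a * cf hV b * S.C a b e) * cf hW c) := by
    intro U V W hU hV hW
    simp only [map_sum, map_mul, map_add, map_sub]
    refine Finset.sum_congr rfl fun e _ => Finset.sum_congr rfl fun c _ => ?_
    rw [S.coord_mlieBracket hU hV]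
    have e1 : ∀ {P Q : (x : M) → TangentSpace (𝓡 4) x} (hP : SmoothVectorField P)
        (hQ : SmoothVectorField Q), ev x (vfDeriv P hP (cf hQ e)) =
        ((dirDeriv P (fun y => S.coord y (Q y) e) x : ℝ) : ℂ) := fun hP hQ =>
      dirDeriv_clm Complex.ofRealCLM _ (ContMDiff.mdiffAt (S.coord_smooth hQ e) x)
    rw [e1 hU hV, e1 hV hU]
    push_cast
    rfl
  simp only [map_add, map_sub]
  rw [hpair hX hY hZ, hpair hY hZ hX, hpair hZ hX hY, hbr hX hY hZ, hbr hY hZ hX, hbr hZ hX hY]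

/-- The frame components of `φ_{AB} ε_{A'B'}`. -/
def twoForm (φ : Fin 2 → Fin 2 → smoothFn M) (b c : Fin 4) : smoothFn M :=
  ∑ A, ∑ B, sigma₂ b c A B • φ A B

theorem ev_twoForm (φ : Fin 2 → Fin 2 → smoothFn M) (b c : Fin 4) (x : M) :
    ev x (twoForm φ b c) = ∑ A, ∑ B, sigma₂ b c A B * ev x (φ A B) := by
  simp [twoForm]

theorem maxwellForm_eq (φ : Fin 2 → Fin 2 → smoothFn M) :
    S.maxwellForm (fun y A B => ev y (φ A B)) = fun x u v =>
      ∑ a, ∑ b, ev x (twoForm φ a b) * (S.coord x u a : ℂ) * S.coord x v b := by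
  funext x u v
  simp only [maxwellForm, ev_twoForm]
  refine Finset.sum_congr rfl fun a _ => Finset.sum_congr rfl fun b _ => ?_
  simp only [sigma₂, Fin.sum_univ_two]
  ring

/-- In the cyclic sum the connection survives only as `Γ a b e - Γ b a e`, which is the structure
function appearing in the exterior derivative. -/
theorem ev_extD_twoForm {φ : Fin 2 → Fin 2 → smoothFn M} (hφ : ∀ A B, φ A B = φ B A)
    (a b c : Fin 4) (x : M) : ev x (extD S.D S.C (twoForm φ) a b c) =
      cyc (fun a A B => ev x (covD₂ S.D S.γ φ a A B)) a b c := by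
  have h := cyc_covariant (fun a => S.isLorentz_conn a x) (fun a b c => by simp)
    (fun a A B => ev x (S.D a (φ A B))) (φ := fun A B => ev x (φ A B)) (congrArg (ev x) (hφ 1 0))
    a b c
  have hN : (fun a A B => ev x (covD₂ S.D S.γ φ a A B)) = fun a A B => ev x (S.D a (φ A B))
      - ∑ X, rho (fun b c => (S.conn a b c x : ℂ)) A X * ev x (φ X B)
      - ∑ X, rho (fun b c => (S.conn a b c x : ℂ)) B X * ev x (φ A X) := by
    funext a A B
    simp only [covD₂, map_sub, map_sum, map_mul, ev_γ, spinConn_eq_rho]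
  rw [hN, h]
  have hD : ∀ a b c, ev x (S.D a (twoForm φ b c)) =
      ∑ A, ∑ B, sigma₂ b c A B * ev x (S.D a (φ A B)) := by
    intro a b c
    simp [twoForm]
  simp only [extD, map_sub, map_add, map_sum, map_mul, hD, ev_C, ev_twoForm, cyc]

theorem isClosed_of_isMaxwell {φ : Fin 2 → Fin 2 → smoothFn M} (hφ : ∀ A B, φ A B = φ B A)
    (h : S.IsMaxwell fun y A B => ev y (φ A B)) :
    IsClosedTwoForm (S.maxwellForm fun y A B => ev y (φ A B)) := by
  rw [maxwellForm_eq]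
  refine S.isClosedTwoForm_of_extD (fun a b => ?_) fun a b c => ?_
  · refine eq_of_ev fun x => ?_
    rw [map_neg, ev_twoForm, ev_twoForm]
    exact (sum_sigma₂_mul (congrArg (ev x) (hφ 1 0))).1 a b
  · refine eq_of_ev fun x => ?_
    rw [S.ev_extD_twoForm hφ, map_zero]
    exact cyc_eq_zero_of_maxwellOp (fun a => by rw [S.covD₂_symm hφ])
      ((S.isMaxwell_iff hφ).1 h x) a b c

end SpinSpacetime

/-! ### Algebra of curvature tensors and the Einstein condition -/

section CurvatureAlgebra

/-- The coefficients of `½ U_{AA'BB'} ε^{A'B'}` as a linear form in `U`. -/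
def sdCoeff (a b : Fin 4) (A B : Fin 2) : ℂ :=
  (ivdwInv a A 0 * ivdwInv b B 1 - ivdwInv a A 1 * ivdwInv b B 0) / 2

theorem sd_eq (U : Fin 4 → Fin 4 → ℂ) (A B : Fin 2) :
    sd U A B = ∑ a, ∑ b, sdCoeff a b A B * U a b := by
  rw [sd, Finset.sum_div]
  refine Finset.sum_congr rfl fun a _ => ?_
  rw [Finset.sum_div]
  refine Finset.sum_congr rfl fun b _ => ?_
  simp only [sdCoeff, Fin.sum_univ_two, eps_zero_zero, eps_zero_one, eps_one_zero, eps_one_one]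
  ring

theorem sd_sd_comm (T : Fin 4 → Fin 4 → Fin 4 → Fin 4 → ℂ) (A B C D : Fin 2) :
    sd (fun a b => sd (fun c d => T a b c d) C D) A B =
      sd (fun c d => sd (fun a b => T a b c d) A B) C D := by
  have h : ∀ (U : Fin 4 → Fin 4 → ℂ) (A B : Fin 2),
      sd U A B = ∑ p : Fin 4 × Fin 4, sdCoeff p.1 p.2 A B * U p.1 p.2 := fun U A B => by
    rw [sd_eq, Fintype.sum_prod_type]
  simp only [h, Finset.mul_sum]
  rw [Finset.sum_comm]
  exact Finset.sum_congr rfl fun p _ => Finset.sum_congr rfl fun q _ => by ring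

theorem sd_neg (U : Fin 4 → Fin 4 → ℂ) (A B : Fin 2) : sd (fun a b => -U a b) A B = -sd U A B := by
  simp [sd_eq]

/-- The pair symmetry of a curvature tensor. -/
theorem pair_symm {R : Fin 4 → Fin 4 → Fin 4 → Fin 4 → ℝ} (h1 : ∀ a b c d, R a b c d = -R b a c d)
    (h2 : ∀ a b c d, R a b c d = -R a b d c)
    (h3 : ∀ a b c d, R a b c d + R b c a d + R c a b d = 0) (a b c d : Fin 4) :
    R a b c d = R c d a b := by
  -- The four cyclic identities obtained by rotating all indices are combined; the other terms use
  -- antisymmetry in each pair.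
  linarith [h3 a b c d, h3 b c d a, h3 c d a b, h3 d a b c, h2 b c d a, h2 c d b a, h1 d b c a,
    h1 d a c b, h2 a d c b, h1 a c d b, h2 c a d b, h1 d a b c, h2 a b d c, h2 b d a c]

/-- The components of a curvature tensor whose Ricci tensor is a multiple of the metric. -/
theorem einstein_components {R : Fin 4 → Fin 4 → Fin 4 → Fin 4 → ℝ}
    (h1 : ∀ a b c d, R a b c d = -R b a c d) (h2 : ∀ a b c d, R a b c d = -R a b d c)
    (h4 : ∀ a b c d, R a b c d = R c d a b) (k : ℝ)
    (hk : ∀ a c, ∑ b, R a b c b * eta b b = k * eta a c) :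
    (R 2 3 2 3 = -R 0 1 0 1 ∧ R 1 3 1 3 = -R 0 2 0 2 ∧ R 1 2 1 2 = -R 0 3 0 3) ∧
    (R 1 3 2 3 = R 0 1 0 2 ∧ R 1 2 2 3 = -R 0 1 0 3 ∧ R 1 2 1 3 = R 0 2 0 3) ∧
    (R 0 1 1 3 = -R 0 2 2 3 ∧ R 0 1 1 2 = R 0 3 2 3 ∧ R 0 2 1 2 = -R 0 3 1 3) := by
  have d1 : ∀ a c d, R a a c d = 0 := fun a c d => by linarith [h1 a a c d]
  have e0 : eta 0 0 = 1 := by simp [eta]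
  have e1 : eta 1 1 = -1 := by simp [eta]
  have e2 : eta 2 2 = -1 := by simp [eta]
  have e3 : eta 3 3 = -1 := by simp [eta]
  have off : ∀ a b : Fin 4, a ≠ b → eta a b = 0 := fun a b h => by simp [eta, h]
  have hb : ∀ a c, R a 0 c 0 - R a 1 c 1 - R a 2 c 2 - R a 3 c 3 = k * eta a c := fun a c => by
    rw [← hk a c, Fin.sum_univ_four, e0, e1, e2, e3]; ring
  have h12 : ∀ a b c d, R a b c d = R b a d c := fun a b c d => by linarith [h1 a b c d, h2 b a c d]
  have k00 := hb 0 0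
  have k11 := hb 1 1
  have k22 := hb 2 2
  have k33 := hb 3 3
  have k01 := hb 0 1
  have k02 := hb 0 2
  have k03 := hb 0 3
  have k12 := hb 1 2
  have k13 := hb 1 3
  have k23 := hb 2 3
  rw [off _ _ (by decide)] at k01 k02 k03 k12 k13 k23
  rw [e0, d1] at k00
  rw [e1, d1, h12 1 0] at k11
  rw [e2, d1, h12 2 0, h12 2 1] at k22
  rw [e3, d1, h12 3 0, h12 3 1, h12 3 2] at k33
  rw [d1] at k01 k02 k03
  have d2 : ∀ a b c, R a b c c = 0 := fun a b c => by rw [h4, d1]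
  rw [d2] at k01 k02 k03
  rw [d1, d2, h12 1 0] at k12 k13
  rw [d1, d2, h12 2 0, h12 2 1] at k23
  refine ⟨⟨by linarith, by linarith, by linarith⟩,
    ⟨by linarith, by linarith [h2 1 2 3 2], by linarith [h4 1 2 1 3]⟩,
    ⟨by linarith [h2 0 1 1 3, h2 0 2 2 3], by linarith [h2 0 1 1 2], by linarith⟩⟩

/-- The trace-free part of the Ricci tensor is the part of the curvature that is anti-self-dual in
the first and self-dual in the second pair of indices. -/
theorem asd_sd_eq_zero {R : Fin 4 → Fin 4 → Fin 4 → Fin 4 → ℝ}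
    (h1 : ∀ a b c d, R a b c d = -R b a c d) (h2 : ∀ a b c d, R a b c d = -R a b d c)
    (h4 : ∀ a b c d, R a b c d = R c d a b) (k : ℝ)
    (hk : ∀ a c, ∑ b, R a b c b * eta b b = k * eta a c) (C D A' B' : Fin 2) :
    asd (fun a b => sd (fun c d => (R a b c d : ℂ)) C D) A' B' = 0 := by
  obtain ⟨⟨z11, z22, z33⟩, ⟨z12, z13, z23⟩, ⟨y12, y13, y23⟩⟩ := einstein_components h1 h2 h4 k hk
  have s1 : ∀ a b, ∀ c d, (R a b c d : ℂ) = -R a b d c := fun a b c d => by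
    rw [h2 a b c d]; push_cast; rfl
  have s2 : ∀ C D a b, sd (fun c d => (R a b c d : ℂ)) C D =
      -sd (fun c d => (R b a c d : ℂ)) C D := fun C D a b => by
    rw [← sd_neg]
    refine congrArg (fun U => sd U C D) (funext fun c => funext fun d => ?_)
    rw [h1]; push_cast; rfl
  have hI := Complex.I_mul_I
  -- `g1`, `g2` and `g3` are the duality relations that characterise a bivector without primed part,
  -- here for the first pair of indices of `R`.
  have g1 : ∀ C D, sd (fun c d => (R 0 1 c d : ℂ)) C D =
      Complex.I * sd (fun c d => (R 2 3 c d : ℂ)) C D := fun C D => by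
    obtain ⟨p0, p1, p2, p3⟩ := sd_components (s1 0 1)
    obtain ⟨w0, w1, w2, w3⟩ := sd_components (s1 2 3)
    rw [h4 2 3 0 1, h4 2 3 0 2, h4 2 3 1 3, z11, z12, ← neg_eq_iff_eq_neg.2 y12] at w0 w3
    rw [h4 2 3 0 3, h4 2 3 1 2, z13, ← y13] at w1 w2
    fin_cases C <;> fin_cases D <;> simp only [Fin.zero_eta, Fin.mk_one, p0, p1, p2, p3, w0, w1, w2,
      w3] <;> push_cast
    · linear_combination (R 0 1 0 1 - R 0 1 1 3) / 2 * hI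
    · linear_combination -R 0 1 0 3 / 2 * hI
    · linear_combination -R 0 1 0 3 / 2 * hI
    · linear_combination -(R 0 1 0 1 + R 0 1 1 3) / 2 * hI
  have g2 : ∀ C D, sd (fun c d => (R 1 3 c d : ℂ)) C D =
      Complex.I * sd (fun c d => (R 0 2 c d : ℂ)) C D := fun C D => by
    obtain ⟨p0, p1, p2, p3⟩ := sd_components (s1 1 3)
    obtain ⟨w0, w1, w2, w3⟩ := sd_components (s1 0 2)
    rw [h4 1 3 0 1, h4 1 3 0 2, z22, z12, y12] at p0 p3
    rw [h4 1 3 0 3, h4 1 3 1 2, z23] at p1 p2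
    rw [h4 0 2 0 1] at w0 w3
    rw [y23] at w1 w2
    fin_cases C <;> fin_cases D <;> simp only [Fin.zero_eta, Fin.mk_one, p0, p1, p2, p3, w0, w1, w2,
      w3] <;> push_cast
    · linear_combination (R 0 2 0 2 - R 0 2 2 3) / 2 * hI
    · linear_combination -R 0 3 1 3 / 2 * hI
    · linear_combination -R 0 3 1 3 / 2 * hI
    · linear_combination (R 0 2 2 3 + R 0 2 0 2) / 2 * hI
  have g3 : ∀ C D, sd (fun c d => (R 0 3 c d : ℂ)) C D =
      Complex.I * sd (fun c d => (R 1 2 c d : ℂ)) C D := fun C D => by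
    obtain ⟨p0, p1, p2, p3⟩ := sd_components (s1 0 3)
    obtain ⟨w0, w1, w2, w3⟩ := sd_components (s1 1 2)
    rw [h4 0 3 0 1, h4 0 3 0 2] at p0 p3
    rw [h4 1 2 0 1, h4 1 2 0 2, z13, z23, y13, y23] at w0 w3
    rw [h4 1 2 0 3, z33] at w1 w2
    fin_cases C <;> fin_cases D <;> simp only [Fin.zero_eta, Fin.mk_one, p0, p1, p2, p3, w0, w1, w2,
      w3] <;> push_cast
    · linear_combination (R 0 1 0 3 - R 0 3 1 3) / 2 * hI
    · linear_combination -R 0 3 0 3 / 2 * hI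
    · linear_combination -R 0 3 0 3 / 2 * hI
    · linear_combination -(R 0 1 0 3 + R 0 3 1 3) / 2 * hI
  obtain ⟨a0, a1, a2, a3⟩ := asd_components (s2 C D)
  rw [g1, g2] at a0 a3
  rw [g3] at a1 a2
  have b0 := a0.trans (c := 0) (by ring)
  have b1 := a1.trans (c := 0) (by ring)
  have b2 := a2.trans (c := 0) (by ring)
  have b3 := a3.trans (c := 0) (by ring)
  fin_cases A' <;> fin_cases B'
  · exact b0
  · exact b1
  · exact b2
  · exact b3

end CurvatureAlgebra

/-! ### Spin curvature and the symmetries of the curvature spinors -/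

theorem rho_add (U V : Fin 4 → Fin 4 → ℂ) (B E : Fin 2) :
    rho (fun c d => U c d + V c d) B E = rho U B E + rho V B E := by
  simp only [rho, mul_add, Finset.sum_add_distrib, add_div]

theorem rho_smul (z : ℂ) (U : Fin 4 → Fin 4 → ℂ) (B E : Fin 2) :
    rho (fun c d => z * U c d) B E = z * rho U B E := by
  simp only [rho, Fin.sum_univ_two, Fin.sum_univ_four]
  ring

theorem rho_sub (U V : Fin 4 → Fin 4 → ℂ) (B E : Fin 2) :
    rho (fun c d => U c d - V c d) B E = rho U B E - rho V B E := by
  have h : (fun c d => U c d - V c d) = fun c d => U c d + (-1) * V c d := by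
    funext c d; ring
  rw [h, rho_add, rho_smul]
  ring

theorem rho_sum_smul (z : Fin 4 → ℂ) (U : Fin 4 → Fin 4 → Fin 4 → ℂ) (B E : Fin 2) :
    rho (fun c d => ∑ e, z e * U e c d) B E = ∑ e, z e * rho (U e) B E := by
  simp only [Fin.sum_univ_four, rho_add, rho_smul]

namespace SpinSpacetime

variable {M : Type*} [TopologicalSpace M] [ChartedSpace (EuclideanSpace ℝ (Fin 4)) M]
  [IsManifold (𝓡 4) ∞ M] (S : SpinSpacetime M)

theorem ev_Rm (a b c d : Fin 4) (x : M) : ev x (S.Rm a b c d) = (S.riemann a b c d x : ℂ) :=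
  S.Rm_apply a b c d x

theorem riemann_swap (a b c d : Fin 4) (x : M) : S.riemann a b c d x = -S.riemann b a c d x := by
  have h := congrArg (ev x) (frameCurv_swap (D := S.D) (Γ := S.Γ) S.C_swap a b c d)
  change ev x (S.Rm a b c d) = ev x (-S.Rm b a c d) at h
  rw [map_neg, ev_Rm, ev_Rm] at h
  exact_mod_cast h

theorem riemann_cyclic (a b c d : Fin 4) (x : M) :
    S.riemann a b c d x + S.riemann b c a d x + S.riemann c a b d x = 0 := by
  have h := congrArg (ev x) (frameCurv_cyclic (D := S.D) S.torsion S.jacobi a b c d)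
  change ev x (S.Rm a b c d + S.Rm b c a d + S.Rm c a b d) = ev x 0 at h
  rw [map_add, map_add, map_zero, ev_Rm, ev_Rm, ev_Rm] at h
  exact_mod_cast h

theorem riemann_skew (a b c d : Fin 4) (x : M) :
    eta d d * S.riemann a b c d x + eta c c * S.riemann a b d c x = 0 := by
  have h := congrArg (ev x) (frameCurv_skew (D := S.D) (C := S.C) (Γ := S.Γ)
    (fun a => algebraMap ℂ _ (eta a a : ℂ)) (fun a b => (S.D a).map_algebraMap _)
    (fun a b c => eq_of_ev fun y => by
      rw [map_add, map_mul, map_mul, map_zero, AlgHom.commutes, AlgHom.commutes, ev_Γ, ev_Γ]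
      have h := S.conn_skew a b c y
      simp only [Algebra.algebraMap_self, RingHom.id_apply]
      exact_mod_cast h) a b c d)
  change ev x (algebraMap ℂ _ (eta d d : ℂ) * S.Rm a b c d +
    algebraMap ℂ _ (eta c c : ℂ) * S.Rm a b d c) = ev x 0 at h
  rw [map_add, map_mul, map_mul, map_zero, AlgHom.commutes, AlgHom.commutes, ev_Rm, ev_Rm] at h
  simp only [Algebra.algebraMap_self, RingHom.id_apply] at h
  exact_mod_cast h

/-- The Riemann tensor with all indices lowered. -/
def riem (x : M) (a b c d : Fin 4) : ℝ := S.riemann a b c d x * eta d d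

theorem riem_swap (x : M) (a b c d : Fin 4) : S.riem x a b c d = -S.riem x b a c d := by
  rw [riem, riem, S.riemann_swap]; ring

theorem riem_skew (x : M) (a b c d : Fin 4) : S.riem x a b c d = -S.riem x a b d c := by
  rw [riem, riem]; linarith [S.riemann_skew a b c d x]

theorem riem_pair (x : M) (a b c d : Fin 4) : S.riem x a b c d = S.riem x c d a b :=
  pair_symm (S.riem_swap x) (S.riem_skew x) (fun a b c d => by
    simp only [riem, ← add_mul, S.riemann_cyclic, zero_mul]) a b c d

theorem isLorentz_riemann (a b : Fin 4) (x : M) :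
    IsLorentz fun c d => (S.riemann a b c d x : ℂ) := fun c d => by
  have h := S.riemann_skew a b c d x
  beta_reduce
  exact_mod_cast h

/-- The spin curvature is the spin representation of the Riemann curvature. -/
theorem ev_spinCurv (a b : Fin 4) (B E : Fin 2) (x : M) :
    ev x (spinCurv S.D S.C S.γ a b B E) = rho (fun c d => (S.riemann a b c d x : ℂ)) B E := by
  have hD : ∀ a b, ev x (S.D a (S.γ b B E)) = rho (fun c d => ev x (S.D a (S.Γ b c d))) B E := by
    intro a b
    simp only [γ, map_sum, Derivation.map_smul, map_smul, smul_eq_mul, rho, Finset.sum_div]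
    refine Finset.sum_congr rfl fun b _ => Finset.sum_congr rfl fun c _ =>
      Finset.sum_congr rfl fun X _ => by ring
  have hR : (fun c d => (S.riemann a b c d x : ℂ)) = fun c d =>
      ev x (S.D a (S.Γ b c d)) - ev x (S.D b (S.Γ a c d))
      + (∑ e, ((S.conn b c e x : ℂ) * S.conn a e d x - S.conn a c e x * S.conn b e d x))
      - ∑ e, ev x (S.C a b e) * S.conn e c d x := by
    funext c d
    rw [← ev_Rm, Rm]
    simp only [map_add, map_sub, map_sum, map_mul, ev_Γ, Finset.sum_sub_distrib]
    ring
  rw [hR, rho_sub, rho_add, rho_sub, rho_sum_smul,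
    ← rho_comm (S.isLorentz_conn b x) (S.isLorentz_conn a x), ← hD, ← hD]
  simp only [spinCurv, map_add, map_sub, map_sum, map_mul, ev_γ, spinConn_eq_rho]

theorem curvX_eq (A B C D : Fin 2) (x : M) : S.curvX A B C D x =
    sd (fun a b => sd (fun c d => (S.riem x a b c d : ℂ)) C D) A B := by
  simp only [curvX, sd_eq, Finset.sum_div, Finset.mul_sum]
  refine Finset.sum_congr rfl fun a _ => Finset.sum_congr rfl fun b _ =>
    Finset.sum_congr rfl fun c _ => Finset.sum_congr rfl fun d _ => ?_
  simp only [sdCoeff, Fin.sum_univ_two, eps_zero_zero, eps_zero_one, eps_one_zero, eps_one_one,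
    riem]
  ring

theorem curvX_symm_left (A B C D : Fin 2) (x : M) : S.curvX A B C D x = S.curvX B A C D x := by
  rw [curvX_eq, curvX_eq]
  refine sd_symm (fun a b => ?_) A B
  rw [← sd_neg]
  refine congrArg (fun U => sd U C D) (funext fun c => funext fun d => ?_)
  rw [riem_swap]; push_cast; rfl

theorem curvX_pair (A B C D : Fin 2) (x : M) : S.curvX A B C D x = S.curvX C D A B x := by
  rw [curvX_eq, curvX_eq, sd_sd_comm]
  simp only [S.riem_pair x]

theorem curvX_symm_right (A B C D : Fin 2) (x : M) : S.curvX A B C D x = S.curvX A B D C x := by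
  rw [curvX_pair, curvX_symm_left, curvX_pair]

/-- The symmetries of `curvX` within and between its pairs make each adjacent transposition permute
the three terms of the average; together these transpositions give total symmetry. -/
theorem weyl_swap₁₂ (A B C D : Fin 2) (x : M) : S.weyl A B C D x = S.weyl B A C D x := by
  rw [weyl, weyl, S.curvX_symm_left B A, S.curvX_pair A C, S.curvX_pair A D, S.curvX_symm_left B D,
    S.curvX_symm_right D B, S.curvX_symm_left B C, S.curvX_symm_right C B]
  ring

theorem weyl_swap₂₃ (A B C D : Fin 2) (x : M) : S.weyl A B C D x = S.weyl A C B D x := by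
  rw [weyl, weyl, S.curvX_symm_right A D C B]
  ring

theorem weyl_swap₃₄ (A B C D : Fin 2) (x : M) : S.weyl A B C D x = S.weyl A B D C x := by
  rw [weyl, weyl, S.curvX_symm_right A B D C]
  ring

end SpinSpacetime

/-- The covariant derivative of the components `X_{ABCE}` of a spinor along the frame. -/
def covD₄ {A : Type*} [CommRing A] [Algebra ℂ A] (D : Fin 4 → Derivation ℂ A A)
    (γ : Fin 4 → Fin 2 → Fin 2 → A) (X : Fin 2 → Fin 2 → Fin 2 → Fin 2 → A) (a : Fin 4)
    (P Q R T : Fin 2) : A :=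
  D a (X P Q R T) - ∑ Y, γ a P Y * X Y Q R T - ∑ Y, γ a Q Y * X P Y R T
    - ∑ Y, γ a R Y * X P Q Y T - ∑ Y, γ a T Y * X P Q R Y

/-! ### The Bianchi identity of an Einstein space -/

namespace SpinSpacetime

variable {M : Type*} [TopologicalSpace M] [ChartedSpace (EuclideanSpace ℝ (Fin 4)) M]
  [IsManifold (𝓡 4) ∞ M] (S : SpinSpacetime M)

/-- The curvature spinor `X_{ABCD}` as smooth functions. -/
def X (A B C D : Fin 2) : smoothFn M :=
  ∑ a, ∑ b, ∑ c, ∑ d, (sdCoeff a b A B * sdCoeff c d C D * (eta d d : ℂ)) • S.Rm a b c d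

theorem ev_X (A B C D : Fin 2) (x : M) : ev x (S.X A B C D) = S.curvX A B C D x := by
  rw [curvX_eq]
  simp only [X, sd_eq, map_sum, map_smul, ev_Rm, smul_eq_mul, riem, Finset.mul_sum]
  refine Finset.sum_congr rfl fun a _ => Finset.sum_congr rfl fun b _ =>
    Finset.sum_congr rfl fun c _ => Finset.sum_congr rfl fun d _ => ?_
  push_cast
  ring

/-- The Weyl spinor `Ψ_{ABCD}` as smooth functions. -/
def Ψ (A B C D : Fin 2) : smoothFn M :=
  (1 / 3 : ℂ) • (S.X A B C D + S.X A C B D + S.X A D B C)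

theorem ev_Ψ (A B C D : Fin 2) (x : M) : ev x (S.Ψ A B C D) = S.weyl A B C D x := by
  simp only [Ψ, map_smul, map_add, ev_X, weyl, smul_eq_mul]
  ring

theorem X_symm_left (A B C D : Fin 2) : S.X A B C D = S.X B A C D :=
  eq_of_ev fun x => by rw [ev_X, ev_X, curvX_symm_left]

theorem sd_riem_eq (a b : Fin 4) (C E : Fin 2) (x : M) :
    sd (fun c d => (S.riem x a b c d : ℂ)) C E =
      ∑ Y, ev x (spinCurv S.D S.C S.γ a b C Y) * eps Y E := by
  simp only [ev_spinCurv]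
  rw [← sd_lower (S.isLorentz_riemann a b x)]
  simp only [riem]
  push_cast
  rfl

/-- In an Einstein space the spin curvature has no anti-self-dual part. -/
theorem IsEinstein.sd_riem {S : SpinSpacetime M} (h : S.IsEinstein) (a b : Fin 4) (C E : Fin 2)
    (x : M) : sd (fun c d => (S.riem x a b c d : ℂ)) C E =
      ev x (twoForm (fun A B => S.X A B C E) a b) := by
  obtain ⟨k, hk⟩ := h
  have hU : ∀ a b, sd (fun c d => (S.riem x a b c d : ℂ)) C E =
      -sd (fun c d => (S.riem x b a c d : ℂ)) C E := fun a b => by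
    rw [← sd_neg]
    refine congrArg (fun U => sd U C E) (funext fun c => funext fun d => ?_)
    rw [riem_swap]; push_cast; rfl
  have heta : ∀ b : Fin 4, eta b b * eta b b = 1 := fun b => by fin_cases b <;> simp [eta]
  have h0 := asd_sd_eq_zero (S.riem_swap x) (S.riem_skew x) (S.riem_pair x) k (fun a c => by
    rw [← hk a c x, ricci]
    simp only [riem, mul_assoc, heta, mul_one]) C E
  rw [eq_sum_sigma₂_sd hU h0, ev_twoForm]
  simp only [ev_X, curvX_eq]

/-- Lowering the last index with `ε` exchanges its two values, with a sign for the upper value `1`.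
-/
theorem IsEinstein.spinCurv_zero {S : SpinSpacetime M} (h : S.IsEinstein) (a b : Fin 4)
    (C : Fin 2) : spinCurv S.D S.C S.γ a b C 0 = twoForm (fun A B => S.X A B C 1) a b :=
  eq_of_ev fun x => by
    rw [← h.sd_riem, sd_riem_eq]
    simp [Fin.sum_univ_two, eps_zero_one, eps_one_one]

theorem IsEinstein.spinCurv_one {S : SpinSpacetime M} (h : S.IsEinstein) (a b : Fin 4)
    (C : Fin 2) : spinCurv S.D S.C S.γ a b C 1 = -twoForm (fun A B => S.X A B C 0) a b :=
  eq_of_ev fun x => by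
    rw [map_neg, ← h.sd_riem, sd_riem_eq]
    simp [Fin.sum_univ_two, eps_zero_zero, eps_one_zero]

theorem γ_trace (a : Fin 4) : S.γ a 1 1 = -S.γ a 0 0 := eq_of_ev fun x => by
  obtain ⟨r0, -, -, r3⟩ := rho_components (S.isLorentz_conn a x)
  rw [map_neg, ev_γ, ev_γ, spinConn_eq_rho, spinConn_eq_rho, r0, r3]
  ring

/-- The second Bianchi identity in an Einstein space. -/
theorem IsEinstein.bianchi {S : SpinSpacetime M} (h : S.IsEinstein) (a b c : Fin 4)
    (P E : Fin 2) :
    (S.D a (twoForm (fun A B => S.X A B P E) b c)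
        - ∑ Y, S.γ a P Y * twoForm (fun A B => S.X A B Y E) b c
        - ∑ Y, S.γ a E Y * twoForm (fun A B => S.X A B P Y) b c
        - ∑ e, S.C a b e * twoForm (fun A B => S.X A B P E) e c)
    + (S.D b (twoForm (fun A B => S.X A B P E) c a)
        - ∑ Y, S.γ b P Y * twoForm (fun A B => S.X A B Y E) c a
        - ∑ Y, S.γ b E Y * twoForm (fun A B => S.X A B P Y) c a
        - ∑ e, S.C b c e * twoForm (fun A B => S.X A B P E) e a)
    + (S.D c (twoForm (fun A B => S.X A B P E) a b)
        - ∑ Y, S.γ c P Y * twoForm (fun A B => S.X A B Y E) a b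
        - ∑ Y, S.γ c E Y * twoForm (fun A B => S.X A B P Y) a b
        - ∑ e, S.C c a e * twoForm (fun A B => S.X A B P E) e b) = 0 := by
  have k := fun E => spinCurv_bianchi (γ := S.γ) S.C_swap S.D_comm S.jacobi a b c P E
  -- Because lowering with `ε` exchanges index values, the case `E = 0` comes from `k1` and the case
  -- `E = 1` from `k0`.
  have k0 := k 0
  have k1 := k 1
  simp only [Fin.sum_univ_two, Fin.sum_univ_four, h.spinCurv_zero, h.spinCurv_one, map_neg,
    γ_trace] at k0 k1
  fin_cases E <;> simp only [Fin.zero_eta, Fin.mk_one, Fin.sum_univ_two, Fin.sum_univ_four, γ_trace]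
  · linear_combination -k1
  · linear_combination k0

/-- The curvature 2-form is `X_{ABCE} ε_{A'B'}`, without primed part. The second Bianchi identity is
therefore the vanishing of `cyc` for its covariant derivative, which is Maxwell's equation on the
first pair of indices. -/
theorem IsEinstein.maxwellOp_X {S : SpinSpacetime M} (h : S.IsEinstein) (x : M)
    (A' B C E : Fin 2) :
    maxwellOp (fun a A B => ev x (covD₄ S.D S.γ S.X a A B C E)) A' B = 0 := by
  refine maxwellOp_eq_zero_of_cyc (fun a => ?_) (fun a b c => ?_) A' B
  · refine congrArg (ev x) ?_
    simp only [covD₄, S.X_symm_left 1 0, Fin.sum_univ_two]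
    ring
  · have hc := cyc_covariant (fun a => S.isLorentz_conn a x) (fun a b c => by simp)
      (fun a A B => ev x (S.D a (S.X A B C E) - ∑ Y, S.γ a C Y * S.X A B Y E
        - ∑ Y, S.γ a E Y * S.X A B C Y)) (φ := fun A B => ev x (S.X A B C E))
        (congrArg (ev x) (S.X_symm_left 1 0 C E)) a b c
    have hN : (fun a A B => ev x (covD₄ S.D S.γ S.X a A B C E)) = fun a A B =>
        ev x (S.D a (S.X A B C E) - ∑ Y, S.γ a C Y * S.X A B Y E
        - ∑ Y, S.γ a E Y * S.X A B C Y)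
        - ∑ Y, rho (fun b c => (S.conn a b c x : ℂ)) A Y * ev x (S.X Y B C E)
        - ∑ Y, rho (fun b c => (S.conn a b c x : ℂ)) B Y * ev x (S.X A Y C E) := by
      funext a A B
      simp only [covD₄, map_sub, map_sum, map_mul, ev_γ, spinConn_eq_rho]
      ring
    rw [hN, hc]
    have hD : ∀ a b c, ev x (S.D a (twoForm (fun A B => S.X A B C E) b c)) =
        ∑ A, ∑ B, sigma₂ b c A B * ev x (S.D a (S.X A B C E)) := by
      intro a b c
      simp [twoForm]
    have hb := congrArg (ev x) (h.bianchi a b c C E)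
    simp only [map_sub, map_add, map_sum, map_mul, map_zero, hD, ev_twoForm, ev_C] at hb
    simp only [cyc, map_sub, map_sum, map_mul, Finset.sum_add_distrib]
    rw [← hb]
    simp only [Fin.sum_univ_two]
    ring

/-- The Bianchi identity `∇^{AA'} Ψ_{ABCE} = 0` of an Einstein space. -/
theorem IsEinstein.maxwellOp_Ψ {S : SpinSpacetime M} (h : S.IsEinstein) (x : M)
    (A' B C E : Fin 2) :
    maxwellOp (fun a A B => ev x (covD₄ S.D S.γ S.Ψ a A B C E)) A' B = 0 := by
  -- Every term of the symmetrisation keeps `A` as its first index, so each is divergence-free by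
  -- `maxwellOp_X`; the scalar curvature needs no separate treatment.
  have hl : ∀ a A B C E, covD₄ S.D S.γ S.Ψ a A B C E = (1 / 3 : ℂ) •
      (covD₄ S.D S.γ S.X a A B C E + covD₄ S.D S.γ S.X a A C B E
        + covD₄ S.D S.γ S.X a A E B C) := by
    intro a A B C E
    simp only [covD₄, Ψ, Derivation.map_smul, map_add, Fin.sum_univ_two, mul_smul_comm,
      ← smul_add, ← smul_sub]
    congr 1
    ring
  have h1 := h.maxwellOp_X x A' B C E
  have h2 := h.maxwellOp_X x A' C B E
  have h3 := h.maxwellOp_X x A' E B C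
  simp only [maxwellOp, Fin.sum_univ_four, hl, map_smul, map_add, smul_eq_mul] at h1 h2 h3 ⊢
  linear_combination (h1 + h2 + h3) / 3

end SpinSpacetime

/-! ### Integrability of the projected Killing equation -/

section KillingAlgebra

variable {A : Type*} [CommRing A] [Algebra ℂ A] {D : Fin 4 → Derivation ℂ A A}
  {C Γ : Fin 4 → Fin 4 → Fin 4 → A} {γ γb : Fin 4 → Fin 2 → Fin 2 → A}
  {s : Fin 4 → Fin 2 → Fin 2 → A} {K : Fin 2 → Fin 2 → A} {o : Fin 2 → A}

/-- `∇_{PP'} K_{BE}`. -/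
def spinD (D : Fin 4 → Derivation ℂ A A) (γ : Fin 4 → Fin 2 → Fin 2 → A)
    (s : Fin 4 → Fin 2 → Fin 2 → A) (K : Fin 2 → Fin 2 → A) (P P' B E : Fin 2) : A :=
  ∑ a, s a P P' * covD₂ D γ K a B E

/-- `∇_d N_{PP'BE}`. -/
def spinDD (D : Fin 4 → Derivation ℂ A A) (γ γb : Fin 4 → Fin 2 → Fin 2 → A)
    (N : Fin 2 → Fin 2 → Fin 2 → Fin 2 → A) (d : Fin 4) (P P' B E : Fin 2) : A :=
  D d (N P P' B E) - ∑ X, γ d P X * N X P' B E - ∑ X, γb d P' X * N P X B E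
    - ∑ X, γ d B X * N P P' X E - ∑ X, γ d E X * N P P' B X

/-- The hypotheses say that the soldering symbols `s` are constant and covariantly constant, so they
pass through the outer derivative. -/
theorem spinDD_spinD (hs : ∀ a d P P', D d (s a P P') = 0)
    (hΓ : ∀ d e P P', ∑ a, s a P P' * Γ d a e =
      ∑ X, γ d P X * s e X P' + ∑ X, γb d P' X * s e P X) (d : Fin 4) (P P' B E : Fin 2) :
    spinDD D γ γb (spinD D γ s K) d P P' B E = ∑ a, s a P P' * covD₂₂ D Γ γ K d a B E := by
  have h := fun e => hΓ d e P P'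
  have h0 := h 0
  have h1 := h 1
  have h2 := h 2
  have h3 := h 3
  simp only [spinDD, spinD, covD₂₂]
  generalize hc : covD₂ D γ K = c
  simp only [Fin.sum_univ_four, Fin.sum_univ_two, map_add, Derivation.leibniz, smul_eq_mul, hs]
    at h0 h1 h2 h3 ⊢
  linear_combination c 0 B E * h0 + c 1 B E * h1 + c 2 B E * h2 + c 3 B E * h3

/-- The derivative of a field proportional to `o_A o_B o_C` vanishes on `o^A o^B`. -/
theorem contract_deriv_eq_zero (δ : Derivation ℂ A A) (g : Fin 2 → Fin 2 → A)
    {T : Fin 2 → Fin 2 → Fin 2 → A} (hT : ∀ B E, ∑ P, o P * T P B E = 0)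
    (hT' : ∀ P E, ∑ B, o B * T P B E = 0) (E : Fin 2) :
    ∑ P, ∑ B, o P * o B * (δ (T P B E) - ∑ X, g P X * T X B E - ∑ X, g B X * T P X E
      - ∑ X, g E X * T P B X) = 0 := by
  -- Differentiating `o^P T_{PBE} = 0` trades the derivative of `T` for `T` contracted with the
  -- derivative of `o`, and the remaining `o^B` annihilates that.
  have d0 := congrArg δ (hT 0 E)
  have d1 := congrArg δ (hT 1 E)
  have t00 := hT 0 0
  have t01 := hT 0 1
  have t10 := hT 1 0
  have t11 := hT 1 1
  have e0 := hT 0 E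
  have e1 := hT 1 E
  have f0 := hT' 0 E
  have f1 := hT' 1 E
  simp only [Fin.sum_univ_two, map_add, map_zero, Derivation.leibniz, smul_eq_mul] at *
  linear_combination o 0 * d0 + o 1 * d1 - δ (o 0) * f0 - δ (o 1) * f1
    - (o 0 * g 0 0 + o 1 * g 1 0) * f0 - (o 0 * g 0 1 + o 1 * g 1 1) * f1
    - (o 0 * g 0 0 + o 1 * g 1 0) * e0 - (o 0 * g 0 1 + o 1 * g 1 1) * e1
    - o 0 * (g E 0 * t00 + g E 1 * t01) - o 1 * (g E 0 * t10 + g E 1 * t11)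

/-- `ε^{D'A'} ∇_{DD'} ∇_{AA'} K_{BE}` up to sign. -/
def hess (D : Fin 4 → Derivation ℂ A A) (Γ : Fin 4 → Fin 4 → Fin 4 → A)
    (γ : Fin 4 → Fin 2 → Fin 2 → A) (s : Fin 4 → Fin 2 → Fin 2 → A) (K : Fin 2 → Fin 2 → A)
    (Q P B E : Fin 2) : A :=
  ∑ d, ∑ a, (s d Q 0 * s a P 1 - s d Q 1 * s a P 0) * covD₂₂ D Γ γ K d a B E

theorem hess_eq (hs : ∀ a d P P', D d (s a P P') = 0)
    (hΓ : ∀ d e P P', ∑ a, s a P P' * Γ d a e =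
      ∑ X, γ d P X * s e X P' + ∑ X, γb d P' X * s e P X) (Q P B E : Fin 2) :
    hess D Γ γ s K Q P B E = ∑ d, (s d Q 0 * spinDD D γ γb (spinD D γ s K) d P 1 B E
      - s d Q 1 * spinDD D γ γb (spinD D γ s K) d P 0 B E) := by
  simp only [spinDD_spinD hs hΓ, hess, Finset.mul_sum, ← Finset.sum_sub_distrib]
  refine Finset.sum_congr rfl fun d _ => Finset.sum_congr rfl fun a _ => ?_
  ring

/-- The coefficient of `covD₂₂` in `hess`, symmetrised in `Q` and `P`, is antisymmetric in the two
differentiation indices, so only commutators enter. -/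
theorem hess_comm (hT : ∀ a b c, Γ a b c - Γ b a c = C a b c)
    (hD : ∀ a b f, D a (D b f) - D b (D a f) = ∑ e, C a b e * D e f) (Q P B E : Fin 2) :
    hess D Γ γ s K Q P B E + hess D Γ γ s K P Q B E =
      -∑ X, (∑ d, ∑ a, (s d Q 0 * s a P 1 + s d P 0 * s a Q 1) * spinCurv D C γ d a B X) * K X E
      - ∑ X, (∑ d, ∑ a, (s d Q 0 * s a P 1 + s d P 0 * s a Q 1) * spinCurv D C γ d a E X)
        * K B X := by
  have h1 : hess D Γ γ s K Q P B E + hess D Γ γ s K P Q B E =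
      ∑ d, ∑ a, (s d Q 0 * s a P 1 + s d P 0 * s a Q 1)
        * (covD₂₂ D Γ γ K d a B E - covD₂₂ D Γ γ K a d B E) := by
    have h2 : ∑ d, ∑ a, (s d Q 0 * s a P 1 + s d P 0 * s a Q 1) * covD₂₂ D Γ γ K a d B E =
        ∑ d, ∑ a, (s a Q 0 * s d P 1 + s a P 0 * s d Q 1) * covD₂₂ D Γ γ K d a B E :=
      Finset.sum_comm
    simp only [mul_sub, Finset.sum_sub_distrib, h2, hess]
    simp only [← Finset.sum_add_distrib, ← Finset.sum_sub_distrib]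
    refine Finset.sum_congr rfl fun d _ => Finset.sum_congr rfl fun a _ => ?_
    ring
  rw [h1]
  simp only [covD₂₂_comm hT hD, Fin.sum_univ_two, Finset.sum_mul, ← Finset.sum_add_distrib,
    ← Finset.sum_sub_distrib, ← Finset.sum_neg_distrib]
  refine Finset.sum_congr rfl fun d _ => Finset.sum_congr rfl fun a _ => ?_
  ring

/-- The projected Killing equation forces a trace of second derivatives to vanish. -/
theorem hess_contract_eq_zero (hs : ∀ a d P P', D d (s a P P') = 0)
    (hΓ : ∀ d e P P', ∑ a, s a P P' * Γ d a e =
      ∑ X, γ d P X * s e X P' + ∑ X, γb d P' X * s e P X)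
    (hN : ∀ P P' B E, spinD D γ s K P P' B E = spinD D γ s K P P' E B)
    (hK : ∀ P' B E, ∑ P, o P * (spinD D γ s K P P' B E + spinD D γ s K B P' E P
      + spinD D γ s K E P' P B) = 0) (Q E : Fin 2) :
    ∑ P, ∑ B, o P * o B * (hess D Γ γ s K Q P B E + hess D Γ γ s K Q B E P
      + hess D Γ γ s K Q E P B) = 0 := by
  simp only [hess_eq hs hΓ]
  generalize hN' : spinD D γ s K = N at hN hK
  have key : ∀ d P', ∑ P, ∑ B, o P * o B * (spinDD D γ γb N d P P' B E
      + spinDD D γ γb N d B P' E P + spinDD D γ γb N d E P' P B) = 0 := by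
    intro d P'
    -- The cyclic sum is totally symmetric because `K` is, so `o` annihilates it in the second index
    -- as well.
    have hT' : ∀ P' P E, ∑ B, o B * (N P P' B E + N B P' E P + N E P' P B) = 0 := by
      intro P' P E
      rw [← hK P' P E]
      refine Finset.sum_congr rfl fun B _ => ?_
      rw [hN P P' B E, hN B P' E P, hN E P' P B]
      ring
    have k := contract_deriv_eq_zero (D d) (γ d)
      (T := fun P B E => N P P' B E + N B P' E P + N E P' P B) (hK P') (hT' P') E
    have z : ∀ X, ∑ P, ∑ B, o P * o B * (N P X B E + N B X E P + N E X P B) = 0 := by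
      intro X
      rw [Finset.sum_comm]
      refine Finset.sum_eq_zero fun B _ => ?_
      rw [← mul_zero (o B), ← hK X B E, Finset.mul_sum]
      exact Finset.sum_congr rfl fun P _ => by ring
    have z0 := z 0
    have z1 := z 1
    simp only [Fin.sum_univ_two, spinDD, map_add] at k z0 z1 ⊢
    linear_combination k - γb d P' 0 * z0 - γb d P' 1 * z1
  have e : ∑ P, ∑ B, o P * o B *
      (∑ d, (s d Q 0 * spinDD D γ γb N d P 1 B E - s d Q 1 * spinDD D γ γb N d P 0 B E)
        + ∑ d, (s d Q 0 * spinDD D γ γb N d B 1 E P - s d Q 1 * spinDD D γ γb N d B 0 E P)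
        + ∑ d, (s d Q 0 * spinDD D γ γb N d E 1 P B - s d Q 1 * spinDD D γ γb N d E 0 P B)) =
      ∑ d, (s d Q 0 * (∑ P, ∑ B, o P * o B * (spinDD D γ γb N d P 1 B E
        + spinDD D γ γb N d B 1 E P + spinDD D γ γb N d E 1 P B))
        - s d Q 1 * (∑ P, ∑ B, o P * o B * (spinDD D γ γb N d P 0 B E
        + spinDD D γ γb N d B 0 E P + spinDD D γ γb N d E 0 P B))) := by
    simp only [Fin.sum_univ_two, ← Finset.sum_add_distrib, Finset.mul_sum]
    exact Finset.sum_congr rfl fun d _ => by ring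
  rw [e]
  refine Finset.sum_eq_zero fun d _ => ?_
  rw [key, key]
  ring

end KillingAlgebra

theorem two_mul_sd {U : Fin 4 → Fin 4 → ℂ} (h : ∀ a b, U a b = -U b a) (Q P : Fin 2) :
    ∑ d, ∑ a, (ivdwInv d Q 0 * ivdwInv a P 1 + ivdwInv d P 0 * ivdwInv a Q 1) * U d a =
      2 * sd U Q P := by
  have h1 : ∑ d, ∑ a, ivdwInv d P 0 * ivdwInv a Q 1 * U d a =
      -∑ d, ∑ a, ivdwInv d Q 1 * ivdwInv a P 0 * U d a := by
    rw [Finset.sum_comm]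
    simp only [← Finset.sum_neg_distrib]
    refine Finset.sum_congr rfl fun d _ => Finset.sum_congr rfl fun a _ => ?_
    rw [h a d]; ring
  simp only [add_mul, Finset.sum_add_distrib, h1, sd_eq, Finset.mul_sum]
  simp only [← Finset.sum_add_distrib, ← Finset.sum_neg_distrib]
  refine Finset.sum_congr rfl fun d _ => Finset.sum_congr rfl fun a _ => ?_
  rw [sdCoeff]; ring

/-- The inverse Infeld–van der Waerden symbols as constant functions. -/
def ivdwFn (M : Type*) [TopologicalSpace M]
    [ChartedSpace (EuclideanSpace ℝ (Fin 4)) M] (a : Fin 4) (P P' : Fin 2) : smoothFn M :=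
  algebraMap ℂ _ (ivdwInv a P P')

theorem ev_ivdwFn {M : Type*} [TopologicalSpace M] [ChartedSpace (EuclideanSpace ℝ (Fin 4)) M]
    (a : Fin 4) (P P' : Fin 2) (x : M) : ev x (ivdwFn M a P P') = ivdwInv a P P' :=
  (ev x).commutes _

namespace SpinSpacetime

variable {M : Type*} [TopologicalSpace M] [ChartedSpace (EuclideanSpace ℝ (Fin 4)) M]
  [IsManifold (𝓡 4) ∞ M] (S : SpinSpacetime M)

/-- The conjugate spin connection as smooth functions. -/
def γb (a : Fin 4) (B E : Fin 2) : smoothFn M := ⟨_, ContMDiff.conj (S.γ a B E).2⟩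

theorem ev_γb (a : Fin 4) (B E : Fin 2) (x : M) : ev x (S.γb a B E) = conj (S.spinConn a B E x) :=
  congrArg conj (S.ev_γ a B E x)

theorem D_ivdwFn (a d : Fin 4) (P P' : Fin 2) : S.D d (ivdwFn M a P P') = 0 :=
  (S.D d).map_algebraMap _

theorem ivdwFn_soldering (d e : Fin 4) (P P' : Fin 2) : ∑ a, ivdwFn M a P P' * S.Γ d a e =
    ∑ X, S.γ d P X * ivdwFn M e X P' + ∑ X, S.γb d P' X * ivdwFn M e P X := eq_of_ev fun x => by
  simp only [map_add, map_sum, map_mul, ev_ivdwFn, ev_Γ, ev_γ, ev_γb, spinConn_eq_rho]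
  exact soldering (S.isLorentz_conn d x) (fun b c => by simp) e P P'

/-- `∇_{PP'} K_{BE}` as smooth functions. -/
def nab (K : Fin 2 → Fin 2 → smoothFn M) (P P' B E : Fin 2) : smoothFn M :=
  spinD S.D S.γ (ivdwFn M) K P P' B E

theorem ev_nab (K : Fin 2 → Fin 2 → smoothFn M) (P P' B E : Fin 2) (x : M) :
    ev x (S.nab K P P' B E) = S.nabla₂ (fun y B E => ev y (K B E)) P P' B E x := by
  simp only [nabla₂_eq, nab, spinD, map_sum, map_mul, ev_ivdwFn]

theorem nab_symm {K : Fin 2 → Fin 2 → smoothFn M} (hK : ∀ B E, K B E = K E B)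
    (P P' B E : Fin 2) : S.nab K P P' B E = S.nab K P P' E B := by
  simp only [nab, spinD]
  exact Finset.sum_congr rfl fun a _ => by rw [S.covD₂_symm hK]

theorem isProjectedKilling_iff {K : Fin 2 → Fin 2 → smoothFn M} (hK : ∀ B E, K B E = K E B)
    (o : Fin 2 → smoothFn M) :
    S.IsProjectedKilling (fun y A => ev y (o A)) (fun y A B => ev y (K A B)) ↔
    ∀ P' B E, ∑ P, o P * (S.nab K P P' B E + S.nab K B P' E P + S.nab K E P' P B) = 0 := by
  have key : ∀ P' B E x, ∑ A, ev x (o A) *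
      ((S.nabla₂ (fun y A B => ev y (K A B)) A P' B E x
        + S.nabla₂ (fun y A B => ev y (K A B)) B P' E A x
        + S.nabla₂ (fun y A B => ev y (K A B)) E P' A B x) / 3) =
      ev x (∑ P, o P * (S.nab K P P' B E + S.nab K B P' E P + S.nab K E P' P B)) / 3 := by
    intro P' B E x
    simp only [map_sum, map_mul, map_add, ev_nab, Finset.sum_div]
    exact Finset.sum_congr rfl fun A _ => by ring
  constructor
  · rintro ⟨-, h⟩ P' B E
    refine eq_of_ev fun x => ?_
    have h1 := h P' B E x
    rw [key, div_eq_zero_iff] at h1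
    rw [map_zero]
    exact h1.resolve_right (by norm_num)
  · refine fun h => ⟨fun x A B => congrArg (ev x) (hK A B), fun P' B E x => ?_⟩
    rw [key, h, map_zero, zero_div]

/-- The symmetrised product of soldering symbols projects the form indices of the spin curvature to
their unprimed part. Only `X` is left, with no condition on the Ricci tensor. -/
theorem sum_spinCurv (Q P B E : Fin 2) (x : M) :
    ∑ Y, ev x (∑ d, ∑ a, (ivdwFn M d Q 0 * ivdwFn M a P 1 + ivdwFn M d P 0 * ivdwFn M a Q 1)
      * spinCurv S.D S.C S.γ d a B Y) * eps Y E = 2 * S.curvX Q P B E x := by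
  have hU : ∀ a b, sd (fun c d => (S.riem x a b c d : ℂ)) B E =
      -sd (fun c d => (S.riem x b a c d : ℂ)) B E := fun a b => by
    rw [← sd_neg]
    refine congrArg (fun U => sd U B E) (funext fun c => funext fun d => ?_)
    rw [riem_swap]; push_cast; rfl
  rw [curvX_eq, ← two_mul_sd hU]
  simp only [sd_riem_eq, map_sum, map_mul, map_add, ev_ivdwFn, Finset.sum_mul, Finset.mul_sum]
  rw [Finset.sum_comm]
  refine Finset.sum_congr rfl fun d _ => ?_
  rw [Finset.sum_comm]
  exact Finset.sum_congr rfl fun a _ => Finset.sum_congr rfl fun Y _ => by ring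

/-- The commutator of covariant derivatives on a symmetric spinor. -/
theorem ev_hess_comm (K : Fin 2 → Fin 2 → smoothFn M) (Q P B E : Fin 2) (x : M) :
    ev x (hess S.D S.Γ S.γ (ivdwFn M) K Q P B E) + ev x (hess S.D S.Γ S.γ (ivdwFn M) K P Q B E) =
      2 * (S.curvX Q P B 0 x * ev x (K 1 E) - S.curvX Q P B 1 x * ev x (K 0 E)
        + S.curvX Q P E 0 x * ev x (K B 1) - S.curvX Q P E 1 x * ev x (K B 0)) := by
  rw [← map_add, hess_comm S.torsion S.D_comm]
  have h := fun B E => S.sum_spinCurv Q P B E x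
  generalize hG : (fun B X => ∑ d, ∑ a, (ivdwFn M d Q 0 * ivdwFn M a P 1
    + ivdwFn M d P 0 * ivdwFn M a Q 1) * spinCurv S.D S.C S.γ d a B X) = G
  have hG' := fun B X => congrFun (congrFun hG B) X
  beta_reduce at hG'
  simp only [hG'] at h ⊢
  have hB0 := h B 0
  have hB1 := h B 1
  have hE0 := h E 0
  have hE1 := h E 1
  simp only [Fin.sum_univ_two, eps_zero_zero, eps_zero_one, eps_one_zero, eps_one_one, map_sub,
    map_neg, map_add, map_mul] at *
  linear_combination ev x (K 1 E) * hB0 - ev x (K 0 E) * hB1 + ev x (K B 1) * hE0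
    - ev x (K B 0) * hE1

end SpinSpacetime

/-- The algebraic consequence of the integrability conditions of a projected Killing spinor. -/
theorem psi_mul_eq_zero {o ι : Fin 2 → ℂ} {X Y h : Fin 2 → Fin 2 → Fin 2 → Fin 2 → ℂ}
    {K : Fin 2 → Fin 2 → ℂ} (hX1 : ∀ A B C D, X A B C D = X B A C D)
    (hX2 : ∀ A B C D, X A B C D = X A B D C) (hX3 : ∀ A B C D, X A B C D = X C D A B)
    (hY : ∀ A B C D, Y A B C D = (X A B C D + X A C B D + X A D B C) / 3)
    (hK : K 1 0 = K 0 1) (hrep : ∀ A, ∑ B, ∑ C, ∑ D, Y A B C D * o B * o C * o D = 0)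
    (hc : ∀ Q P B E, h Q P B E + h P Q B E = 2 * (X Q P B 0 * K 1 E - X Q P B 1 * K 0 E
      + X Q P E 0 * K B 1 - X Q P E 1 * K B 0))
    (hz : ∀ Q E, ∑ P, ∑ B, o P * o B * (h Q P B E + h Q B E P + h Q E P B) = 0) :
    (∑ A, ∑ B, ∑ C, ∑ D, Y A B C D * o A * o B * ι C * ι D) * comp₂ K o o = 0 := by
  -- With these weights the sum of `h Q P B E + h P Q B E` is a combination of the contractions that
  -- vanish by `hz`, so the corresponding contraction of the curvature vanishes too.
  have tot : ∑ Q, ∑ P, ∑ B, ∑ E, (o Q * o P * o B * ι E + o Q * o P * ι B * o E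
      + 2 * (o Q * ι P * o B * o E)) * (X Q P B 0 * K 1 E - X Q P B 1 * K 0 E
      + X Q P E 0 * K B 1 - X Q P E 1 * K B 0) = 0 := by
    have t1 : ∑ Q, ∑ P, ∑ B, ∑ E, (o Q * o P * o B * ι E + o Q * o P * ι B * o E
        + 2 * (o Q * ι P * o B * o E)) * (h Q P B E + h P Q B E) =
        ∑ Q, ∑ E, (2 * (o Q * ι E) + 2 / 3 * (ι Q * o E)) *
          ∑ P, ∑ B, o P * o B * (h Q P B E + h Q B E P + h Q E P B) := by
      simp only [Fin.sum_univ_two]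
      ring
    simp only [hz, mul_zero, Finset.sum_const_zero, hc] at t1
    rw [← mul_eq_zero_iff_left (two_ne_zero (α := ℂ)), ← t1, Finset.mul_sum]
    refine Finset.sum_congr rfl fun Q _ => ?_
    simp only [Fin.sum_univ_two]
    ring
  have r0 := hrep 0
  have r1 := hrep 1
  have s0 : ∀ A B, X 1 0 A B = X 0 1 A B := fun A B => hX1 1 0 A B
  have s1 : ∀ A B, X A B 1 0 = X A B 0 1 := fun A B => hX2 A B 1 0
  simp only [comp₂, hY, Fin.sum_univ_two, s0, s1, hK, hX3 1 1 0 0, hX3 0 1 0 0, hX3 1 1 0 1]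
    at tot r0 r1 ⊢
  -- In a normalised dyad the left side of `tot` is `-6 Ψ₂ K₀` modulo the repeated principal
  -- condition, and the trace part of `X` cancels. The determinant factor makes the identity
  -- homogeneous, so that it holds for any `ι`.
  linear_combination (-(o 0 * ι 1 - o 1 * ι 0) / 6) * tot
    + (K 0 0 * ι 0 * ι 0 + 2 * K 0 1 * ι 0 * ι 1 + K 1 1 * ι 1 * ι 1) / 3 * (o 0 * r0 + o 1 * r1)
    + 2 * (K 0 0 * o 0 * ι 0 + K 0 1 * (o 0 * ι 1 + o 1 * ι 0) + K 1 1 * o 1 * ι 1) / 3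
      * (ι 0 * r0 + ι 1 * r1)

namespace SpinSpacetime

variable {M : Type*} [TopologicalSpace M] [ChartedSpace (EuclideanSpace ℝ (Fin 4)) M]
  [IsManifold (𝓡 4) ∞ M] (S : SpinSpacetime M)

/-- A projected Killing spinor satisfies `Ψ₂ K₀ = 0`. -/
theorem weylComp_mul_comp₂ {o : Fin 2 → smoothFn M} (ι : M → Fin 2 → ℂ)
    {K : Fin 2 → Fin 2 → smoothFn M} (hK : ∀ B E, K B E = K E B)
    (hkill : S.IsProjectedKilling (fun y A => ev y (o A)) (fun y A B => ev y (K A B)))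
    (hrep : S.IsRepeatedPrincipal fun y A => ev y (o A)) (x : M) :
    S.weylComp (fun y A => ev y (o A)) (fun y A => ev y (o A)) ι ι x
      * comp₂ (fun A B => ev x (K A B)) (fun A => ev x (o A)) (fun A => ev x (o A)) = 0 := by
  have hz := hess_contract_eq_zero S.D_ivdwFn S.ivdwFn_soldering (S.nab_symm hK)
    ((S.isProjectedKilling_iff hK o).1 hkill)
  refine psi_mul_eq_zero (X := fun A B C D => S.curvX A B C D x)
    (h := fun Q P B E => ev x (hess S.D S.Γ S.γ (ivdwFn M) K Q P B E))
    (fun A B C D => S.curvX_symm_left A B C D x) (fun A B C D => S.curvX_symm_right A B C D x)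
    (fun A B C D => S.curvX_pair A B C D x) (fun A B C D => rfl)
    (congrArg (ev x) (hK 1 0)) (fun A => hrep A x) (fun Q P B E => S.ev_hess_comm K Q P B E x)
    fun Q E => ?_
  have h := congrArg (ev x) (hz Q E)
  simpa only [map_sum, map_mul, map_add, map_zero] using h

end SpinSpacetime

/-! ### Derivatives of dyad components -/

section DyadAlgebra

variable {A : Type*} [CommRing A] [Algebra ℂ A]

/-- `K_{AB} κ^A μ^B`. -/
def con₂ (K : Fin 2 → Fin 2 → A) (κ μ : Fin 2 → A) : A := ∑ B, ∑ E, K B E * κ B * μ E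

/-- `Ψ_{ABCD} κ^A μ^B ν^C π^D`. -/
def con₄ (X : Fin 2 → Fin 2 → Fin 2 → Fin 2 → A) (κ μ ν π : Fin 2 → A) : A :=
  ∑ B, ∑ E, ∑ F, ∑ G, X B E F G * κ B * μ E * ν F * π G

/-- The derivative of the components of a spinor with two lower indices. -/
def cov₂ (δ : Derivation ℂ A A) (g : Fin 2 → Fin 2 → A) (K : Fin 2 → Fin 2 → A) (B E : Fin 2) : A :=
  δ (K B E) - ∑ X, g B X * K X E - ∑ X, g E X * K B X

/-- The derivative of the components of a spinor with four lower indices. -/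
def cov₄ (δ : Derivation ℂ A A) (g : Fin 2 → Fin 2 → A) (X : Fin 2 → Fin 2 → Fin 2 → Fin 2 → A)
    (B E F G : Fin 2) : A :=
  δ (X B E F G) - ∑ Y, g B Y * X Y E F G - ∑ Y, g E Y * X B Y F G - ∑ Y, g F Y * X B E Y G
    - ∑ Y, g G Y * X B E F Y

/-- The derivatives of a dyad: `∇o^B = P o^B + Q ι^B`, `∇ι^B = R o^B - P ι^B`. -/
structure DyadDeriv (δ : Derivation ℂ A A) (g : Fin 2 → Fin 2 → A) (o ι : Fin 2 → A)
    (P Q R : A) : Prop where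
  deriv_o : ∀ B, δ (o B) = P * o B + Q * ι B - ∑ X, g X B * o X
  deriv_ι : ∀ B, δ (ι B) = R * o B - P * ι B - ∑ X, g X B * ι X

/-- A full contraction is a scalar, so this is the Leibniz rule. With `DyadDeriv` it expresses the
components of `∇K` by derivatives of components of `K` and spin coefficients. -/
theorem con₂_cov₂ (δ : Derivation ℂ A A) (g : Fin 2 → Fin 2 → A) (K : Fin 2 → Fin 2 → A)
    (κ μ : Fin 2 → A) : con₂ (cov₂ δ g K) κ μ = δ (con₂ K κ μ)
      - con₂ K (fun B => δ (κ B) + ∑ X, g X B * κ X) μ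
      - con₂ K κ (fun B => δ (μ B) + ∑ X, g X B * μ X) := by
  simp only [con₂, cov₂, Fin.sum_univ_two, map_add, Derivation.leibniz, smul_eq_mul]
  ring

theorem con₄_cov₄ (δ : Derivation ℂ A A) (g : Fin 2 → Fin 2 → A)
    (K : Fin 2 → Fin 2 → Fin 2 → Fin 2 → A) (κ μ ν π : Fin 2 → A) :
    con₄ (cov₄ δ g K) κ μ ν π = δ (con₄ K κ μ ν π)
      - con₄ K (fun B => δ (κ B) + ∑ X, g X B * κ X) μ ν π
      - con₄ K κ (fun B => δ (μ B) + ∑ X, g X B * μ X) ν π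
      - con₄ K κ μ (fun B => δ (ν B) + ∑ X, g X B * ν X) π
      - con₄ K κ μ ν (fun B => δ (π B) + ∑ X, g X B * π X) := by
  simp only [con₄, cov₄, Fin.sum_univ_two, map_add, Derivation.leibniz, smul_eq_mul]
  ring

theorem con₂_comm {K : Fin 2 → Fin 2 → A} (hK : ∀ B E, K B E = K E B) (κ μ : Fin 2 → A) :
    con₂ K κ μ = con₂ K μ κ := by
  simp only [con₂, Fin.sum_univ_two, hK 1 0]
  ring

theorem con₂_add_left (K : Fin 2 → Fin 2 → A) (a b : A) (κ ν μ : Fin 2 → A) :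
    con₂ K (fun B => a * κ B + b * ν B) μ = a * con₂ K κ μ + b * con₂ K ν μ := by
  simp only [con₂, Fin.sum_univ_two]
  ring

theorem con₂_add_right (K : Fin 2 → Fin 2 → A) (a b : A) (κ ν μ : Fin 2 → A) :
    con₂ K μ (fun B => a * κ B + b * ν B) = a * con₂ K μ κ + b * con₂ K μ ν := by
  simp only [con₂, Fin.sum_univ_two]
  ring

theorem con₄_add₁ (K : Fin 2 → Fin 2 → Fin 2 → Fin 2 → A) (a b : A) (κ ν p q r : Fin 2 → A) :
    con₄ K (fun B => a * κ B + b * ν B) p q r = a * con₄ K κ p q r + b * con₄ K ν p q r := by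
  simp only [con₄, Fin.sum_univ_two]
  ring

theorem con₄_add₂ (K : Fin 2 → Fin 2 → Fin 2 → Fin 2 → A) (a b : A) (κ ν p q r : Fin 2 → A) :
    con₄ K p (fun B => a * κ B + b * ν B) q r = a * con₄ K p κ q r + b * con₄ K p ν q r := by
  simp only [con₄, Fin.sum_univ_two]
  ring

theorem con₄_add₃ (K : Fin 2 → Fin 2 → Fin 2 → Fin 2 → A) (a b : A) (κ ν p q r : Fin 2 → A) :
    con₄ K p q (fun B => a * κ B + b * ν B) r = a * con₄ K p q κ r + b * con₄ K p q ν r := by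
  simp only [con₄, Fin.sum_univ_two]
  ring

theorem con₄_add₄ (K : Fin 2 → Fin 2 → Fin 2 → Fin 2 → A) (a b : A) (κ ν p q r : Fin 2 → A) :
    con₄ K p q r (fun B => a * κ B + b * ν B) = a * con₄ K p q r κ + b * con₄ K p q r ν := by
  simp only [con₄, Fin.sum_univ_two]
  ring

namespace DyadDeriv

variable {δ : Derivation ℂ A A} {g : Fin 2 → Fin 2 → A} {o ι : Fin 2 → A} {P Q R : A}

theorem fun_o (h : DyadDeriv δ g o ι P Q R) :
    (fun B => δ (o B) + ∑ X, g X B * o X) = fun B => P * o B + Q * ι B :=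
  funext fun B => by rw [h.deriv_o]; ring

theorem fun_ι (h : DyadDeriv δ g o ι P Q R) :
    (fun B => δ (ι B) + ∑ X, g X B * ι X) = fun B => R * o B + -P * ι B :=
  funext fun B => by rw [h.deriv_ι]; ring

theorem cov_oo (h : DyadDeriv δ g o ι P Q R) {K : Fin 2 → Fin 2 → A} (hK : ∀ B E, K B E = K E B) :
    con₂ (cov₂ δ g K) o o = δ (con₂ K o o) - 2 * P * con₂ K o o - 2 * Q * con₂ K o ι := by
  rw [con₂_cov₂, h.fun_o, con₂_add_left, con₂_add_right, con₂_comm hK ι o]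
  ring

theorem cov_oι (h : DyadDeriv δ g o ι P Q R) (K : Fin 2 → Fin 2 → A) :
    con₂ (cov₂ δ g K) o ι = δ (con₂ K o ι) - Q * con₂ K ι ι - R * con₂ K o o := by
  rw [con₂_cov₂, h.fun_o, h.fun_ι, con₂_add_left, con₂_add_right]
  ring

theorem cov_ιι (h : DyadDeriv δ g o ι P Q R) {K : Fin 2 → Fin 2 → A} (hK : ∀ B E, K B E = K E B) :
    con₂ (cov₂ δ g K) ι ι = δ (con₂ K ι ι) - 2 * R * con₂ K o ι + 2 * P * con₂ K ι ι := by
  rw [con₂_cov₂, h.fun_ι, con₂_add_left, con₂_add_right, con₂_comm hK ι o]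
  ring

theorem cov_oooι (h : DyadDeriv δ g o ι P Q R) {K : Fin 2 → Fin 2 → Fin 2 → Fin 2 → A}
    (h₁ : ∀ B E F G, K B E F G = K E B F G) (h₂ : ∀ B E F G, K B E F G = K B F E G)
    (h0 : con₄ K o o o o = 0) (h1 : con₄ K o o o ι = 0) :
    con₄ (cov₄ δ g K) o o o ι = -3 * Q * con₄ K o o ι ι := by
  have e1 : con₄ K ι o o ι = con₄ K o o ι ι := by
    simp only [con₄, Fin.sum_univ_two, h₁ 1 0, h₂ _ 1 0]; ring
  have e2 : con₄ K o ι o ι = con₄ K o o ι ι := by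
    simp only [con₄, Fin.sum_univ_two, h₁ 1 0, h₂ _ 1 0]; ring
  rw [con₄_cov₄, h.fun_o, h.fun_ι, con₄_add₁, con₄_add₂, con₄_add₃, con₄_add₄, h0, h1, e1, e2,
    map_zero]
  ring

theorem cov_ooιι (h : DyadDeriv δ g o ι P Q R) {K : Fin 2 → Fin 2 → Fin 2 → Fin 2 → A}
    (h₁ : ∀ B E F G, K B E F G = K E B F G) (h₂ : ∀ B E F G, K B E F G = K B F E G)
    (h₃ : ∀ B E F G, K B E F G = K B E G F) (h1 : con₄ K o o o ι = 0) :
    con₄ (cov₄ δ g K) o o ι ι = δ (con₄ K o o ι ι) - 2 * Q * con₄ K o ι ι ι := by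
  have e1 : con₄ K ι o ι ι = con₄ K o ι ι ι := by
    simp only [con₄, Fin.sum_univ_two, h₁ 1 0]; ring
  have e2 : con₄ K o o ι o = con₄ K o o o ι := by
    simp only [con₄, Fin.sum_univ_two, h₃ _ _ 1 0]; ring
  rw [con₄_cov₄, h.fun_o, h.fun_ι, con₄_add₁, con₄_add₂, con₄_add₃, con₄_add₄, e1, e2, h1]
  ring

theorem cov_oιιι (h : DyadDeriv δ g o ι P Q R) {K : Fin 2 → Fin 2 → Fin 2 → Fin 2 → A}
    (h₂ : ∀ B E F G, K B E F G = K B F E G) (h₃ : ∀ B E F G, K B E F G = K B E G F) :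
    con₄ (cov₄ δ g K) o ι ι ι = δ (con₄ K o ι ι ι) + 2 * P * con₄ K o ι ι ι
      - Q * con₄ K ι ι ι ι - 3 * R * con₄ K o o ι ι := by
  have e1 : con₄ K o ι o ι = con₄ K o o ι ι := by
    simp only [con₄, Fin.sum_univ_two, h₂ _ 1 0]; ring
  have e2 : con₄ K o ι ι o = con₄ K o o ι ι := by
    simp only [con₄, Fin.sum_univ_two, h₂ _ 1 0, h₃ _ _ 1 0]; ring
  rw [con₄_cov₄, h.fun_o, h.fun_ι, con₄_add₁, con₄_add₂, con₄_add₃, con₄_add₄, e1, e2]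
  ring

end DyadDeriv

/-- The lower components `κ_B = κ^A ε_{AB}`. -/
def lowFn (κ : Fin 2 → A) : Fin 2 → A := ![-κ 1, κ 0]

/-- `ν^B ∇π_B`. -/
def scal (δ : Derivation ℂ A A) (g : Fin 2 → Fin 2 → A) (ν π : Fin 2 → A) : A :=
  ∑ B, ν B * (δ (lowFn π B) - ∑ X, g B X * lowFn π X)

/-- The derivatives of a dyad in terms of its spin coefficients. -/
theorem dyadDeriv_scal {δ : Derivation ℂ A A} {g : Fin 2 → Fin 2 → A} {o ι : Fin 2 → A}
    (hg : g 1 1 = -g 0 0) (hd : o 0 * ι 1 - o 1 * ι 0 = 1) :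
    DyadDeriv δ g o ι (scal δ g ι o) (-scal δ g o o) (scal δ g ι ι) := by
  -- Differentiating `o_A ι^A = 1` gives `o_A ∇ι^A = ι_A ∇o^A`, which is why one coefficient `P`
  -- serves both derivatives.
  have hd' := congrArg δ hd
  have l0 : ∀ κ : Fin 2 → A, lowFn κ 0 = -κ 1 := fun κ => rfl
  have l1 : ∀ κ : Fin 2 → A, lowFn κ 1 = κ 0 := fun κ => rfl
  simp only [map_sub, Derivation.leibniz, Derivation.map_one_eq_zero, smul_eq_mul] at hd'
  constructor <;> intro B <;> fin_cases B <;>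
  simp only [Fin.zero_eta, Fin.mk_one, scal, Fin.sum_univ_two, l0, l1, map_neg, hg]
  · linear_combination -(δ (o 0) + g 1 0 * o 1 + g 0 0 * o 0) * hd
  · linear_combination -(δ (o 1) + g 0 1 * o 0 - g 0 0 * o 1) * hd
  · linear_combination -(δ (ι 0) + g 1 0 * ι 1 + g 0 0 * ι 0) * hd + ι 0 * hd'
  · linear_combination -(δ (ι 1) + g 0 1 * ι 0 - g 0 0 * ι 1) * hd + ι 1 * hd'

end DyadAlgebra

section DyadContraction

variable {A : Type*} [CommRing A] [Algebra ℂ A] {o ι : Fin 2 → A}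

/-- The dyad is a basis, so the three components determine a symmetric spinor; inverting the dyad on
both indices brings in the square of its determinant. -/
theorem con₂_eq_zero {v : Fin 2 → Fin 2 → A} (hd : o 0 * ι 1 - o 1 * ι 0 = 1)
    (hv : ∀ B E, v B E = v E B) (h0 : con₂ v o o = 0) (h1 : con₂ v o ι = 0)
    (h2 : con₂ v ι ι = 0) (B E : Fin 2) : v B E = 0 := by
  have hd2 : (o 0 * ι 1 - o 1 * ι 0) * (o 0 * ι 1 - o 1 * ι 0) = 1 := by rw [hd, one_mul]
  have h10 := hv 1 0
  simp only [con₂, Fin.sum_univ_two, h10] at h0 h1 h2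
  fin_cases B <;> fin_cases E <;> simp only [Fin.zero_eta, Fin.mk_one, h10]
  · linear_combination ι 1 * ι 1 * h0 - 2 * ι 1 * o 1 * h1 + o 1 * o 1 * h2 - v 0 0 * hd2
  · linear_combination -ι 1 * ι 0 * h0 + (ι 1 * o 0 + o 1 * ι 0) * h1 - o 0 * o 1 * h2
      - v 0 1 * hd2
  · linear_combination -ι 1 * ι 0 * h0 + (ι 1 * o 0 + o 1 * ι 0) * h1 - o 0 * o 1 * h2
      - v 0 1 * hd2
  · linear_combination ι 0 * ι 0 * h0 - 2 * ι 0 * o 0 * h1 + o 0 * o 0 * h2 - v 1 1 * hd2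

theorem vec_eq_zero {v : Fin 2 → A} (hd : o 0 * ι 1 - o 1 * ι 0 = 1)
    (h0 : v 0 * o 0 + v 1 * o 1 = 0) (h1 : v 0 * ι 0 + v 1 * ι 1 = 0) (B : Fin 2) : v B = 0 := by
  fin_cases B <;> simp only [Fin.zero_eta, Fin.mk_one]
  · linear_combination ι 1 * h0 - o 1 * h1 - v 0 * hd
  · linear_combination o 0 * h1 - ι 0 * h0 - v 1 * hd

/-- Since `ε^{AB} = o^A ι^B - ι^A o^B`, a trace over two unprimed indices is a difference of dyad
contractions. This brings Maxwell's equations into component form. -/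
theorem con₂_curl (N : Fin 2 → Fin 2 → Fin 2 → A) (hd : o 0 * ι 1 - o 1 * ι 0 = 1)
    (μ : Fin 2 → A) : con₂ (fun B E => ∑ P, o P * N P B E) ι μ
      - con₂ (fun B E => ∑ P, ι P * N P B E) o μ =
      (N 0 1 0 - N 1 0 0) * μ 0 + (N 0 1 1 - N 1 0 1) * μ 1 := by
  simp only [con₂, Fin.sum_univ_two]
  linear_combination ((N 0 1 0 - N 1 0 0) * μ 0 + (N 0 1 1 - N 1 0 1) * μ 1) * hd

theorem con₄_curl (N : Fin 2 → Fin 2 → Fin 2 → Fin 2 → Fin 2 → A)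
    (hN : ∀ B E F, N 0 1 B E F = N 1 0 B E F) (μ ν π : Fin 2 → A) :
    con₄ (fun B E F G => ∑ P, o P * N P B E F G) ι μ ν π
      = con₄ (fun B E F G => ∑ P, ι P * N P B E F G) o μ ν π := by
  simp only [con₄, Fin.sum_univ_two, hN]
  ring

/-- The components of `o^A (N_{ABE} + N_{BEA} + N_{EAB})`. -/
theorem con₂_cyclic (N : Fin 2 → Fin 2 → Fin 2 → A) (hN : ∀ P B E, N P B E = N P E B) :
    con₂ (fun B E => ∑ P, o P * (N P B E + N B E P + N E P B)) o o =
      3 * con₂ (fun B E => ∑ P, o P * N P B E) o o ∧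
    con₂ (fun B E => ∑ P, o P * (N P B E + N B E P + N E P B)) o ι =
      2 * con₂ (fun B E => ∑ P, o P * N P B E) o ι + con₂ (fun B E => ∑ P, ι P * N P B E) o o ∧
    con₂ (fun B E => ∑ P, o P * (N P B E + N B E P + N E P B)) ι ι =
      con₂ (fun B E => ∑ P, o P * N P B E) ι ι
        + 2 * con₂ (fun B E => ∑ P, ι P * N P B E) o ι := by
  have h := fun P => hN P 1 0
  simp only [con₂, Fin.sum_univ_two, h]
  refine ⟨?_, ?_, ?_⟩ <;> ring

theorem cov₂_symm {K : Fin 2 → Fin 2 → A} (hK : ∀ B E, K B E = K E B) (δ : Derivation ℂ A A)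
    (g : Fin 2 → Fin 2 → A) (B E : Fin 2) : cov₂ δ g K B E = cov₂ δ g K E B := by
  simp only [cov₂, hK E B, Fin.sum_univ_two, hK 0 B, hK 1 B, hK E 0, hK E 1]
  ring

theorem con₄_swap₁ {K : Fin 2 → Fin 2 → Fin 2 → Fin 2 → A}
    (h : ∀ B E F G, K B E F G = K E B F G) (κ μ ν π : Fin 2 → A) :
    con₄ K κ μ ν π = con₄ K μ κ ν π := by
  simp only [con₄, Fin.sum_univ_two, h 1 0]
  ring

theorem con₄_swap₂ {K : Fin 2 → Fin 2 → Fin 2 → Fin 2 → A}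
    (h : ∀ B E F G, K B E F G = K B F E G) (κ μ ν π : Fin 2 → A) :
    con₄ K κ μ ν π = con₄ K κ ν μ π := by
  simp only [con₄, Fin.sum_univ_two, h _ 1 0]
  ring

theorem cov₄_symm₁ {K : Fin 2 → Fin 2 → Fin 2 → Fin 2 → A}
    (h : ∀ B E F G, K B E F G = K E B F G) (δ : Derivation ℂ A A) (g : Fin 2 → Fin 2 → A)
    (B E F G : Fin 2) : cov₄ δ g K B E F G = cov₄ δ g K E B F G := by
  simp only [cov₄, h E B, Fin.sum_univ_two, h B 0, h B 1, h E 0, h E 1]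
  ring

theorem cov₄_symm₂ {K : Fin 2 → Fin 2 → Fin 2 → Fin 2 → A}
    (h : ∀ B E F G, K B E F G = K B F E G) (δ : Derivation ℂ A A) (g : Fin 2 → Fin 2 → A)
    (B E F G : Fin 2) : cov₄ δ g K B E F G = cov₄ δ g K B F E G := by
  simp only [cov₄, h _ F E, Fin.sum_univ_two, h _ E 0, h _ E 1, h _ F 0, h _ F 1]
  ring

end DyadContraction

theorem ev_lowFn {M : Type*} [TopologicalSpace M] [ChartedSpace (EuclideanSpace ℝ (Fin 4)) M]
    (π : Fin 2 → smoothFn M) (B : Fin 2) (x : M) :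
    ev x (lowFn π B) = low (fun E => ev x (π E)) B := by
  fin_cases B <;> simp [lowFn, low, Fin.sum_univ_two, eps_zero_zero, eps_zero_one, eps_one_zero,
    eps_one_one]

/-! ### Derivations along the dyad and spin coefficients -/

namespace SpinSpacetime

variable {M : Type*} [TopologicalSpace M] [ChartedSpace (EuclideanSpace ℝ (Fin 4)) M]
  [IsManifold (𝓡 4) ∞ M] (S : SpinSpacetime M)

/-- The derivation `κ^A ∇_{AA'}` of scalars. -/
def der (κ : Fin 2 → smoothFn M) (A' : Fin 2) : Derivation ℂ (smoothFn M) (smoothFn M) :=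
  ∑ A, ∑ a, (κ A * ivdwFn M a A A') • S.D a

/-- The connection coefficients of `κ^A ∇_{AA'}`. -/
def cg (κ : Fin 2 → smoothFn M) (A' B E : Fin 2) : smoothFn M :=
  ∑ A, ∑ a, κ A * ivdwFn M a A A' * S.γ a B E

theorem der_apply (κ : Fin 2 → smoothFn M) (A' : Fin 2) (f : smoothFn M) :
    S.der κ A' f = ∑ A, ∑ a, κ A * ivdwFn M a A A' * S.D a f := by
  simp only [der, Fin.sum_univ_two, Fin.sum_univ_four, Derivation.add_apply, Derivation.smul_apply,
    smul_eq_mul]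

theorem ev_der (κ : Fin 2 → smoothFn M) (A' : Fin 2) (f : smoothFn M) (x : M) :
    ev x (S.der κ A' f) = ∑ A, ev x (κ A) * S.nabla₀ f.1 A A' x := by
  simp only [der_apply, nabla₀_eq, map_sum, map_mul, ev_ivdwFn, Finset.mul_sum, mul_assoc]

theorem cov₂_der (κ : Fin 2 → smoothFn M) (A' : Fin 2) (K : Fin 2 → Fin 2 → smoothFn M) :
    cov₂ (S.der κ A') (S.cg κ A') K = fun B E => ∑ P, κ P * S.nab K P A' B E := by
  funext B E
  simp only [cov₂, der_apply, cg, nab, spinD, covD₂, Fin.sum_univ_two, Fin.sum_univ_four]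
  ring

theorem cov₄_der (κ : Fin 2 → smoothFn M) (A' : Fin 2)
    (K : Fin 2 → Fin 2 → Fin 2 → Fin 2 → smoothFn M) :
    cov₄ (S.der κ A') (S.cg κ A') K = fun B E F G => ∑ P, κ P *
      ∑ a, ivdwFn M a P A' * covD₄ S.D S.γ K a B E F G := by
  funext B E F G
  simp only [cov₄, der_apply, cg, covD₄, Fin.sum_univ_two, Fin.sum_univ_four]
  ring

theorem cg_trace (κ : Fin 2 → smoothFn M) (A' : Fin 2) : S.cg κ A' 1 1 = -S.cg κ A' 0 0 := by
  simp only [cg, γ_trace, Fin.sum_univ_two, Fin.sum_univ_four]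
  ring

/-- `κ^A ν^B ∇_{AA'} π_B`. -/
def sc (κ ν π : Fin 2 → smoothFn M) (A' : Fin 2) : smoothFn M :=
  scal (S.der κ A') (S.cg κ A') ν π

theorem nabla₁_low (π : Fin 2 → smoothFn M) (A A' B : Fin 2) (x : M) :
    S.nabla₁ (fun y => low fun E => ev y (π E)) A A' B x = ∑ a, ivdwInv a A A' *
      (ev x (S.D a (lowFn π B)) - ∑ X, ev x (S.γ a B X) * ev x (lowFn π X)) := by
  simp only [ev_γ]
  rw [← nabla₁_eq]
  simp only [ev_lowFn]

theorem ev_sc (κ ν π : Fin 2 → smoothFn M) (A' : Fin 2) (x : M) : ev x (S.sc κ ν π A') =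
    ∑ A, ∑ B, ev x (κ A) * ev x (ν B) *
      S.nabla₁ (fun y => low fun E => ev y (π E)) A A' B x := by
  simp only [nabla₁_low, sc, scal, der_apply, cg, map_sum, map_mul, map_sub, ev_ivdwFn]
  simp only [Fin.sum_univ_two, Fin.sum_univ_four]
  ring

theorem spinCoeff_eq (κ ν π : Fin 2 → smoothFn M) (μ : M → Fin 2 → ℂ) (x : M) :
    S.spinCoeff (fun y A => ev y (κ A)) μ (fun y A => ev y (ν A)) (fun y A => ev y (π A)) x =
      ∑ A', conj (μ x A') * ev x (S.sc κ ν π A') := by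
  simp only [spinCoeff, ev_sc, Fin.sum_univ_two]
  ring

theorem dyadDeriv {o ι : Fin 2 → smoothFn M} (hd : o 0 * ι 1 - o 1 * ι 0 = 1)
    (κ : Fin 2 → smoothFn M) (A' : Fin 2) :
    DyadDeriv (S.der κ A') (S.cg κ A') o ι (S.sc κ ι o A') (-S.sc κ o o A') (S.sc κ ι ι A') :=
  dyadDeriv_scal (S.cg_trace κ A') hd

theorem isShearFreeRay_iff (o : Fin 2 → smoothFn M) :
    S.IsShearFreeRay (fun y A => ev y (o A)) ↔ ∀ A', S.sc o o o A' = 0 := by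
  simp only [IsShearFreeRay, ← ev_sc]
  exact ⟨fun h A' => eq_of_ev fun x => by rw [h, map_zero], fun h A' x => by rw [h, map_zero]⟩

end SpinSpacetime

/-! ### Killing, Maxwell and Bianchi equations in dyad components -/

namespace SpinSpacetime

variable {M : Type*} [TopologicalSpace M] [ChartedSpace (EuclideanSpace ℝ (Fin 4)) M]
  [IsManifold (𝓡 4) ∞ M] (S : SpinSpacetime M) {o ι : Fin 2 → smoothFn M}

/-- The projected Killing equation in components, for `K₀ = 0`. -/
theorem killing_components (hd : o 0 * ι 1 - o 1 * ι 0 = 1) (ho : ∀ A', S.sc o o o A' = 0)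
    {K : Fin 2 → Fin 2 → smoothFn M} (hK : ∀ B E, K B E = K E B) (h0 : con₂ K o o = 0) :
    S.IsProjectedKilling (fun y A => ev y (o A)) (fun y A B => ev y (K A B)) ↔
    ∀ A', S.der o A' (con₂ K o ι) = -S.sc ι o o A' * con₂ K o ι ∧
      S.der o A' (con₂ K ι ι) - 2 * S.sc o ι ι A' * con₂ K o ι + 2 * S.sc o ι o A' * con₂ K ι ι
        + 2 * (S.der ι A' (con₂ K o ι) + S.sc ι o o A' * con₂ K ι ι) = 0 := by
  rw [S.isProjectedKilling_iff hK]
  have hN := S.nab_symm hK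
  have c := fun A' => con₂_cyclic (o := o) (ι := ι) (fun P B E => S.nab K P A' B E)
    fun P B E => hN P A' B E
  have hv : ∀ A' B E, ∑ P, o P * (S.nab K P A' B E + S.nab K B A' E P + S.nab K E A' P B) =
      ∑ P, o P * (S.nab K P A' E B + S.nab K E A' B P + S.nab K B A' P E) := fun A' B E =>
    Finset.sum_congr rfl fun P _ => by
      rw [hN P A' B E, hN B A' E P, hN E A' P B]; ring
  have l : ∀ (κ : Fin 2 → smoothFn M) A', (fun B E => ∑ P, κ P * S.nab K P A' B E) =
    cov₂ (S.der κ A') (S.cg κ A') K := fun κ A' => (S.cov₂_der κ A' K).symm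
  simp only [l, (S.dyadDeriv hd _ _).cov_oo hK, (S.dyadDeriv hd _ _).cov_oι,
    (S.dyadDeriv hd _ _).cov_ιι hK, h0, ho, map_zero] at c
  constructor
  · intro h A'
    obtain ⟨-, c1, c2⟩ := c A'
    have hz : ∀ κ μ, con₂ (fun B E => ∑ P, o P *
        (S.nab K P A' B E + S.nab K B A' E P + S.nab K E A' P B)) κ μ = 0 := fun κ μ => by
      simp [con₂, h]
    rw [hz] at c1 c2
    refine ⟨eq_of_ev fun x => ?_, ?_⟩
    -- The common factor `2` is cancelled pointwise in `ℂ`.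
    · have c1' := congrArg (ev x) c1
      simp only [map_add, map_sub, map_mul, map_neg, map_zero, map_ofNat] at c1' ⊢
      linear_combination -c1' / 2
    · linear_combination -c2
  · intro h A' B E
    obtain ⟨c0, c1, c2⟩ := c A'
    obtain ⟨e1, e2⟩ := h A'
    refine con₂_eq_zero hd (v := fun B E => ∑ P, o P *
      (S.nab K P A' B E + S.nab K B A' E P + S.nab K E A' P B)) (hv A') ?_ ?_ ?_ B E
    · rw [c0]; ring
    · rw [c1, e1]; ring
    · rw [c2]; linear_combination e2

/-- Maxwell's equations in components, for `φ₀ = 0`. -/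
theorem maxwell_components (hd : o 0 * ι 1 - o 1 * ι 0 = 1) (ho : ∀ A', S.sc o o o A' = 0)
    {φ : Fin 2 → Fin 2 → smoothFn M} (hφ : ∀ B E, φ B E = φ E B) (h0 : con₂ φ o o = 0) :
    S.IsMaxwell (fun y A B => ev y (φ A B)) ↔
    ∀ A', S.der o A' (con₂ φ o ι) = 2 * S.sc ι o o A' * con₂ φ o ι ∧
      S.der o A' (con₂ φ ι ι) - 2 * S.sc o ι ι A' * con₂ φ o ι + 2 * S.sc o ι o A' * con₂ φ ι ι =
        S.der ι A' (con₂ φ o ι) + S.sc ι o o A' * con₂ φ ι ι := by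
  rw [S.isMaxwell_iff hφ]
  have hm : ∀ x A' B, maxwellOp (fun a A B => ev x (covD₂ S.D S.γ φ a A B)) A' B =
      ev x (S.nab φ 0 A' 1 B - S.nab φ 1 A' 0 B) := by
    intro x A' B
    simp only [maxwellOp, nab, spinD, map_sub, map_sum, map_mul, ev_ivdwFn, Finset.sum_sub_distrib]
  have c := fun A' => con₂_curl (fun P B E => S.nab φ P A' B E) hd
  have l : ∀ (κ : Fin 2 → smoothFn M) A', (fun B E => ∑ P, κ P * S.nab φ P A' B E) =
    cov₂ (S.der κ A') (S.cg κ A') φ := fun κ A' => (S.cov₂_der κ A' φ).symm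
  have co := fun A' => c A' o
  have cι := fun A' => c A' ι
  simp only [l, con₂_comm (cov₂_symm hφ _ _) ι o, (S.dyadDeriv hd _ _).cov_oo hφ,
    (S.dyadDeriv hd _ _).cov_oι, (S.dyadDeriv hd _ _).cov_ιι hφ, h0, ho, map_zero] at co cι
  constructor
  · intro h A'
    have hz : ∀ B, S.nab φ 0 A' 1 B - S.nab φ 1 A' 0 B = 0 := fun B => eq_of_ev fun x => by
      rw [← hm, h, map_zero]
    have co' := co A'
    have cι' := cι A'
    rw [hz, hz] at co' cι'
    exact ⟨by linear_combination co', by linear_combination cι'⟩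
  · intro h x A' B
    obtain ⟨e1, e2⟩ := h A'
    rw [hm, vec_eq_zero (v := fun B => S.nab φ 0 A' 1 B - S.nab φ 1 A' 0 B) hd, map_zero]
    · rw [← co A']; linear_combination e1
    · rw [← cι A']; linear_combination e2

theorem Ψ_swap₁ (A B C D : Fin 2) : S.Ψ A B C D = S.Ψ B A C D :=
  eq_of_ev fun x => by rw [ev_Ψ, ev_Ψ, weyl_swap₁₂]

theorem Ψ_swap₂ (A B C D : Fin 2) : S.Ψ A B C D = S.Ψ A C B D :=
  eq_of_ev fun x => by rw [ev_Ψ, ev_Ψ, weyl_swap₂₃]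

theorem Ψ_swap₃ (A B C D : Fin 2) : S.Ψ A B C D = S.Ψ A B D C :=
  eq_of_ev fun x => by rw [ev_Ψ, ev_Ψ, weyl_swap₃₄]

theorem isRepeatedPrincipal_iff : S.IsRepeatedPrincipal (fun y A => ev y (o A)) ↔
    ∀ B, ∑ E, ∑ F, ∑ G, S.Ψ B E F G * o E * o F * o G = 0 := by
  have h : ∀ B x, ∑ E, ∑ F, ∑ G, S.weyl B E F G x * ev x (o E) * ev x (o F) * ev x (o G) =
      ev x (∑ E, ∑ F, ∑ G, S.Ψ B E F G * o E * o F * o G) := fun B x => by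
    simp only [map_sum, map_mul, ev_Ψ]
  simp only [IsRepeatedPrincipal, h]
  exact ⟨fun h B => eq_of_ev fun x => by rw [h, map_zero], fun h B x => by rw [h, map_zero]⟩

theorem con₄_Ψ_eq_zero (h : S.IsRepeatedPrincipal (fun y A => ev y (o A)))
    (κ : Fin 2 → smoothFn M) : con₄ S.Ψ o o o κ = 0 := by
  have h' := S.isRepeatedPrincipal_iff.1 h
  have e : con₄ S.Ψ o o o κ = con₄ S.Ψ κ o o o := by
    simp only [con₄, Fin.sum_univ_two, S.Ψ_swap₁ 1 0, S.Ψ_swap₂ _ 1 0, S.Ψ_swap₃ _ _ 1 0]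
    ring
  rw [e]
  have e2 : con₄ S.Ψ κ o o o = ∑ B, κ B * ∑ E, ∑ F, ∑ G, S.Ψ B E F G * o E * o F * o G := by
    simp only [con₄, Finset.mul_sum]
    refine Finset.sum_congr rfl fun B _ => Finset.sum_congr rfl fun E _ =>
      Finset.sum_congr rfl fun F _ => Finset.sum_congr rfl fun G _ => by ring
  rw [e2]
  exact Finset.sum_eq_zero fun B _ => by rw [h', mul_zero]

/-- The Bianchi identities in components. -/
theorem IsEinstein.bianchi_components {S : SpinSpacetime M} (hE : S.IsEinstein)
    (hd : o 0 * ι 1 - o 1 * ι 0 = 1) (ho : ∀ A', S.sc o o o A' = 0)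
    (hrep : S.IsRepeatedPrincipal (fun y A => ev y (o A))) (A' : Fin 2) :
    S.der o A' (con₄ S.Ψ o o ι ι) = 3 * S.sc ι o o A' * con₄ S.Ψ o o ι ι ∧
    S.der ι A' (con₄ S.Ψ o o ι ι) = S.der o A' (con₄ S.Ψ o ι ι ι)
      + (2 * S.sc o ι o A' - 2 * S.sc ι o o A') * con₄ S.Ψ o ι ι ι
      - 3 * S.sc o ι ι A' * con₄ S.Ψ o o ι ι := by
  have hN : ∀ B E F, (∑ a, ivdwFn M a 0 A' * covD₄ S.D S.γ S.Ψ a 1 B E F) =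
      ∑ a, ivdwFn M a 1 A' * covD₄ S.D S.γ S.Ψ a 0 B E F := fun B E F => eq_of_ev fun x => by
    have hm : maxwellOp (fun a P B => ev x (covD₄ S.D S.γ S.Ψ a P B E F)) A' B =
        ev x (∑ a, ivdwFn M a 0 A' * covD₄ S.D S.γ S.Ψ a 1 B E F)
          - ev x (∑ a, ivdwFn M a 1 A' * covD₄ S.D S.γ S.Ψ a 0 B E F) := by
      simp only [maxwellOp, map_sum, map_mul, ev_ivdwFn, Finset.sum_sub_distrib]
    rw [hE.maxwellOp_Ψ] at hm
    exact sub_eq_zero.1 hm.symm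
  have c := con₄_curl (o := o) (ι := ι)
    (fun P B E F G => ∑ a, ivdwFn M a P A' * covD₄ S.D S.γ S.Ψ a B E F G) hN
  rw [← cov₄_der, ← cov₄_der] at c
  have s1 := fun κ : Fin 2 → smoothFn M =>
    con₄_swap₁ (cov₄_symm₁ S.Ψ_swap₁ (S.der κ A') (S.cg κ A'))
  have s2 := fun κ : Fin 2 → smoothFn M =>
    con₄_swap₂ (cov₄_symm₂ S.Ψ_swap₂ (S.der κ A') (S.cg κ A'))
  have z := S.con₄_Ψ_eq_zero hrep
  have c1 := c o o ι
  have c2 := c o ι ι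
  rw [s1 o ι o, s2 o o ι, (S.dyadDeriv hd _ _).cov_ooιι S.Ψ_swap₁ S.Ψ_swap₂ S.Ψ_swap₃ (z ι),
    (S.dyadDeriv hd _ _).cov_oooι S.Ψ_swap₁ S.Ψ_swap₂ (z o) (z ι), ho] at c1
  rw [s1 o ι o, (S.dyadDeriv hd _ _).cov_oιιι S.Ψ_swap₂ S.Ψ_swap₃,
    (S.dyadDeriv hd _ _).cov_ooιι S.Ψ_swap₁ S.Ψ_swap₂ S.Ψ_swap₃ (z ι), ho] at c2
  exact ⟨by linear_combination c1, by linear_combination -c2⟩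

end SpinSpacetime

/-! ### The forms `f`, `ω`, `B` and potential pairs -/

theorem low_zero (κ : Fin 2 → ℂ) : low κ 0 = -κ 1 := by
  simp [low, Fin.sum_univ_two, eps_zero_zero, eps_one_zero]

theorem low_one (κ : Fin 2 → ℂ) : low κ 1 = κ 0 := by
  simp [low, Fin.sum_univ_two, eps_zero_one, eps_one_one]

/-- Completeness of the conjugate dyad: two spin coefficients that are the primed components of one
spinor, such as `ρ` and `τ`, are reassembled into that spinor. -/
theorem conj_dyad {o ι : Fin 2 → ℂ} (hd : o 0 * ι 1 - o 1 * ι 0 = 1) (s : Fin 2 → ℂ) (A' : Fin 2) :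
    (∑ X, conj (ι X) * s X) * conj (low o A') - (∑ X, conj (o X) * s X) * conj (low ι A') =
      s A' := by
  have h := congrArg conj hd
  simp only [map_sub, map_mul, map_one] at h
  fin_cases A' <;> simp only [Fin.zero_eta, Fin.mk_one, Fin.sum_univ_two, low_zero, low_one,
    map_neg]
  · linear_combination s 0 * h
  · linear_combination s 1 * h

namespace SpinSpacetime

variable {M : Type*} [TopologicalSpace M] [ChartedSpace (EuclideanSpace ℝ (Fin 4)) M]
  [IsManifold (𝓡 4) ∞ M] (S : SpinSpacetime M) {o ι : Fin 2 → smoothFn M}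

theorem ev_det (hd : o 0 * ι 1 - o 1 * ι 0 = 1) (x : M) :
    ev x (o 0) * ev x (ι 1) - ev x (o 1) * ev x (ι 0) = 1 := by
  simpa using congrArg (ev x) hd

/-- The pairs `ρ, τ` and `ρ', τ'` are, up to sign, the primed components of `sc ι o o` and `sc o ι
ι`. -/
theorem formf_eq (hd : o 0 * ι 1 - o 1 * ι 0 = 1) (A A' : Fin 2) (x : M) :
    S.formf (fun y A => ev y (o A)) (fun y A => ev y (ι A)) A A' x =
      -low (fun A => ev x (ι A)) A * ev x (S.sc ι o o A')
        - low (fun A => ev x (o A)) A * ev x (S.sc o ι ι A') := by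
  have h := conj_dyad (o := fun A => ev x (o A)) (ι := fun A => ev x (ι A)) (ev_det hd x)
  have h1 := h (fun X => ev x (S.sc ι o o X)) A'
  have h2 := h (fun X => ev x (S.sc o ι ι X)) A'
  simp only [formf, spinCoeff_eq]
  rw [← h1, ← h2]
  ring

theorem formω_eq (hd : o 0 * ι 1 - o 1 * ι 0 = 1) (A A' : Fin 2) (x : M) :
    S.formω (fun y A => ev y (o A)) (fun y A => ev y (ι A)) A A' x =
      low (fun A => ev x (ι A)) A * ev x (S.sc o ι o A')
        - low (fun A => ev x (o A)) A * ev x (S.sc ι ι o A') := by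
  have h := conj_dyad (o := fun A => ev x (o A)) (ι := fun A => ev x (ι A)) (ev_det hd x)
  have h1 := h (fun X => ev x (S.sc o ι o X)) A'
  have h2 := h (fun X => ev x (S.sc ι ι o X)) A'
  simp only [formω, spinCoeff_eq]
  rw [← h1, ← h2]
  ring

theorem formB_eq (hd : o 0 * ι 1 - o 1 * ι 0 = 1) (A A' : Fin 2) (x : M) :
    S.formB (fun y A => ev y (o A)) (fun y A => ev y (ι A)) A A' x =
      low (fun A => ev x (ι A)) A * ev x (S.sc ι o o A') := by
  have h1 := conj_dyad (o := fun A => ev x (o A)) (ι := fun A => ev x (ι A)) (ev_det hd x)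
    (fun X => ev x (S.sc ι o o X)) A'
  simp only [formB, spinCoeff_eq]
  rw [← h1]
  ring

/-- Contraction uses `o^A o_A = 0` and `o^A ι_A = -1`. The term `-f` contributes `-s` and `-2 (ω +
B)` contributes `2 sc o ι o + 2 s`, where `s = sc ι o o`. -/
theorem confGHPTilde_eq (hd : o 0 * ι 1 - o 1 * ι 0 = 1) (η : smoothFn M) (A' : Fin 2) (x : M) :
    S.confGHPTilde (fun y A => ev y (o A)) (fun y A => ev y (ι A)) (-2) (-1) η.1 A' x =
      ev x (S.der o A' η + (2 * S.sc o ι o A' + S.sc ι o o A') * η) := by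
  have h := ev_det hd x
  simp only [confGHPTilde, confGHP, S.formf_eq hd, S.formω_eq hd, S.formB_eq hd, map_add, ev_der,
    map_mul, map_ofNat, Fin.sum_univ_two, low_zero, low_one, ev_apply x η]
  push_cast
  linear_combination (2 * ev x (S.sc o ι o A') + ev x (S.sc ι o o A')) * η.1 x * h

/-- The equation of a potential pair in components. -/
theorem isPotentialPair_iff (hd : o 0 * ι 1 - o 1 * ι 0 = 1) {φ : smoothFn M} (η : smoothFn M)
    (hφ : ∀ x, ev x φ ≠ 0) :
    S.IsPotentialPair (fun y A => ev y (o A)) (fun y A => ev y (ι A)) φ.1 η.1 ↔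
    ∀ A', S.der o A' φ = S.sc ι o o A' * φ ∧
      S.der ι A' φ = φ * (S.der o A' η + (2 * S.sc o ι o A' + S.sc ι o o A') * η
        - S.sc o ι ι A') := by
  have key : ∀ A A' x, S.formf (fun y A => ev y (o A)) (fun y A => ev y (ι A)) A A' x =
      (φ.1 x)⁻¹ * S.nabla₀ φ.1 A A' x - low (fun A => ev x (o A)) A *
        S.confGHPTilde (fun y A => ev y (o A)) (fun y A => ev y (ι A)) (-2) (-1) η.1 A' x ↔
      S.nabla₀ φ.1 A A' x = ev x φ * (-low (fun A => ev x (ι A)) A * ev x (S.sc ι o o A')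
        + low (fun A => ev x (o A)) A * (ev x (S.der o A' η
          + (2 * S.sc o ι o A' + S.sc ι o o A') * η) - ev x (S.sc o ι ι A'))) := by
    intro A A' x
    have hx : φ.1 x ≠ 0 := hφ x
    rw [S.formf_eq hd, S.confGHPTilde_eq hd, ev_apply x φ]
    have hu := mul_inv_cancel₀ hx
    generalize (φ.1 x)⁻¹ = u at hu ⊢
    generalize ev x (S.der o A' η + (2 * S.sc o ι o A' + S.sc ι o o A') * η) = t
    constructor <;> intro h
    · linear_combination -φ.1 x * h - S.nabla₀ φ.1 A A' x * hu
    · linear_combination -u * h - (-low (fun A => ev x (ι A)) A * ev x (S.sc ι o o A')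
        - low (fun A => ev x (o A)) A * ev x (S.sc o ι ι A') + low (fun A => ev x (o A)) A * t) * hu
  constructor
  · rintro ⟨-, h⟩ A'
    have h0 := fun x => (key 0 A' x).1 (h 0 A' x)
    have h1 := fun x => (key 1 A' x).1 (h 1 A' x)
    constructor <;> refine eq_of_ev fun x => ?_
    · simp only [ev_der, Fin.sum_univ_two, h0, h1, low_zero, low_one, map_mul]
      linear_combination ev x (S.sc ι o o A') * ev x φ * ev_det hd x
    · simp only [ev_der, Fin.sum_univ_two, h0, h1, low_zero, low_one, map_mul, map_sub]
      linear_combination ev x φ * (ev x (S.der o A' η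
          + (2 * S.sc o ι o A' + S.sc ι o o A') * η) - ev x (S.sc o ι ι A')) * ev_det hd x
  · refine fun h => ⟨hφ, fun A A' x => (key A A' x).2 ?_⟩
    obtain ⟨e1, e2⟩ := h A'
    have h1 := congrArg (ev x) e1
    have h2 := congrArg (ev x) e2
    rw [ev_der, Fin.sum_univ_two, map_mul] at h1 h2
    rw [map_sub] at h2
    have hx := ev_det hd x
    fin_cases A <;> simp only [Fin.zero_eta, Fin.mk_one, low_zero, low_one]
    · linear_combination ev x (ι 1) * h1 - ev x (o 1) * h2 - S.nabla₀ φ.1 0 A' x * hx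
    · linear_combination ev x (o 0) * h2 - ev x (ι 0) * h1 - S.nabla₀ φ.1 1 A' x * hx

end SpinSpacetime

/-! ### Components of the spin-lowering field -/

section SpinLowering

variable {A : Type*} [CommRing A] [Algebra ℂ A] {o ι : Fin 2 → A}

/-- `Ψ_{ABCD} K^{CD}`. -/
def spinLower (X : Fin 2 → Fin 2 → Fin 2 → Fin 2 → A) (K : Fin 2 → Fin 2 → A) (B E : Fin 2) : A :=
  X B E 0 0 * K 1 1 - X B E 0 1 * K 1 0 - X B E 1 0 * K 0 1 + X B E 1 1 * K 0 0

/-- Each `ε` that raises an index of `K` is expanded as `o^A ι^B - ι^A o^B`, at the cost of one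
determinant per index. -/
theorem con₂_spinLower (hd : o 0 * ι 1 - o 1 * ι 0 = 1)
    {X : Fin 2 → Fin 2 → Fin 2 → Fin 2 → A} (hX : ∀ B E F G, X B E F G = X B E G F)
    {K : Fin 2 → Fin 2 → A} (hK : ∀ B E, K B E = K E B) (κ μ : Fin 2 → A) :
    con₂ (spinLower X K) κ μ = con₄ X κ μ ι ι * con₂ K o o - 2 * con₄ X κ μ o ι * con₂ K o ι
      + con₄ X κ μ o o * con₂ K ι ι := by
  have hd2 : (o 0 * ι 1 - o 1 * ι 0) * (o 0 * ι 1 - o 1 * ι 0) = 1 := by rw [hd, one_mul]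
  have e := mul_one (con₂ (spinLower X K) κ μ)
  rw [← hd2] at e
  rw [← e]
  simp only [con₂, con₄, spinLower, Fin.sum_univ_two, hX _ _ 1 0, hK 1 0]
  ring

/-- The components of `Ψ_{ABCD} K^{CD}` for a repeated principal spinor `o` and `K₀ = 0`. -/
theorem spinLower_components (hd : o 0 * ι 1 - o 1 * ι 0 = 1)
    {X : Fin 2 → Fin 2 → Fin 2 → Fin 2 → A} (h₁ : ∀ B E F G, X B E F G = X E B F G)
    (h₂ : ∀ B E F G, X B E F G = X B F E G) (h₃ : ∀ B E F G, X B E F G = X B E G F)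
    (hX : ∀ κ, con₄ X o o o κ = 0)
    {K : Fin 2 → Fin 2 → A} (hK : ∀ B E, K B E = K E B) (h0 : con₂ K o o = 0) :
    con₂ (spinLower X K) o o = 0 ∧
    con₂ (spinLower X K) o ι = -2 * con₄ X o o ι ι * con₂ K o ι ∧
    con₂ (spinLower X K) ι ι = con₄ X o o ι ι * con₂ K ι ι - 2 * con₄ X o ι ι ι * con₂ K o ι := by
  have e1 : con₄ X o ι o o = 0 := by
    rw [con₄_swap₂ h₂, ← hX ι]
    simp only [con₄, Fin.sum_univ_two, h₃ _ _ 1 0]; ring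
  have e2 : con₄ X ι ι o o = con₄ X o o ι ι := by
    simp only [con₄, Fin.sum_univ_two, h₁ 1 0, h₂ _ 1 0, h₃ _ _ 1 0]; ring
  have e3 : con₄ X ι ι o ι = con₄ X o ι ι ι := by
    rw [con₄_swap₂ h₂, con₄_swap₁ h₁]
  simp only [con₂_spinLower hd h₃ hK, h0, hX, con₄_swap₂ h₂ o ι o ι, e1, e2, e3]
  refine ⟨?_, ?_, ?_⟩ <;> ring

theorem spinLower_symm {X : Fin 2 → Fin 2 → Fin 2 → Fin 2 → A}
    (h₁ : ∀ B E F G, X B E F G = X E B F G) (K : Fin 2 → Fin 2 → A) (B E : Fin 2) :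
    spinLower X K B E = spinLower X K E B := by
  simp only [spinLower, h₁ B E]

theorem eq_of_con₂ (hd : o 0 * ι 1 - o 1 * ι 0 = 1) {K L : Fin 2 → Fin 2 → A}
    (hK : ∀ B E, K B E = K E B) (hL : ∀ B E, L B E = L E B) (h0 : con₂ K o o = con₂ L o o)
    (h1 : con₂ K o ι = con₂ L o ι) (h2 : con₂ K ι ι = con₂ L ι ι) (B E : Fin 2) :
    K B E = L B E := by
  have hs : ∀ κ μ, con₂ (fun B E => K B E - L B E) κ μ = con₂ K κ μ - con₂ L κ μ := fun κ μ => by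
    simp only [con₂, Fin.sum_univ_two]; ring
  refine sub_eq_zero.1 (con₂_eq_zero (v := fun B E => K B E - L B E) hd
    (fun B E => by rw [hK, hL]) ?_ ?_ ?_ B E)
  · rw [hs, h0, sub_self]
  · rw [hs, h1, sub_self]
  · rw [hs, h2, sub_self]

theorem con₂_mul (f : A) (K : Fin 2 → Fin 2 → A) (κ μ : Fin 2 → A) :
    con₂ (fun B E => f * K B E) κ μ = f * con₂ K κ μ := by
  simp only [con₂, Fin.sum_univ_two]; ring

end SpinLowering

theorem ev_con₂ {M : Type*} [TopologicalSpace M] [ChartedSpace (EuclideanSpace ℝ (Fin 4)) M]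
    (K : Fin 2 → Fin 2 → smoothFn M) (κ μ : Fin 2 → smoothFn M) (x : M) :
    ev x (con₂ K κ μ) =
      comp₂ (fun B E => ev x (K B E)) (fun B => ev x (κ B)) (fun B => ev x (μ B)) := by
  simp only [con₂, comp₂, map_sum, map_mul]

theorem eq_zero_of_mul {M : Type*} [TopologicalSpace M] [ChartedSpace (EuclideanSpace ℝ (Fin 4)) M]
    {f g : smoothFn M} (hf : ∀ x, ev x f ≠ 0) (h : f * g = 0) : g = 0 :=
  eq_of_ev fun x => by
    have hx := congrArg (ev x) h
    rw [map_mul, map_zero] at hx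
    rw [map_zero]
    exact (mul_eq_zero.1 hx).resolve_left (hf x)

/-! ### Maxwell fields from projected Killing spinors -/

namespace SpinSpacetime

variable {M : Type*} [TopologicalSpace M] [ChartedSpace (EuclideanSpace ℝ (Fin 4)) M]
  [IsManifold (𝓡 4) ∞ M] (S : SpinSpacetime M) {o ι : Fin 2 → smoothFn M}

theorem ev_con₄ (κ μ ν π : Fin 2 → smoothFn M) (x : M) : ev x (con₄ S.Ψ κ μ ν π) =
    S.weylComp (fun y A => ev y (κ A)) (fun y A => ev y (μ A)) (fun y A => ev y (ν A))
      (fun y A => ev y (π A)) x := by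
  simp only [con₄, weylComp, map_sum, map_mul, ev_Ψ]

theorem weylContract_eq (K : M → Fin 2 → Fin 2 → ℂ) (x : M) :
    S.weylContract K x = spinLower (fun A B C D => S.weyl A B C D x) (K x) := by
  funext A B
  simp only [weylContract, raise₂, spinLower, Fin.sum_univ_two, eps_zero_zero, eps_zero_one,
    eps_one_zero, eps_one_one]
  ring

theorem ev_spinLower (K : Fin 2 → Fin 2 → smoothFn M) :
    S.weylContract (fun y A B => ev y (K A B)) = fun y A B => ev y (spinLower S.Ψ K A B) := by
  funext y A B
  rw [weylContract_eq]
  simp only [spinLower, map_add, map_sub, map_mul, ev_Ψ]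

/-- The Maxwell field `-2 φ³ K` of a projected Killing spinor with `K₁ = c φ⁻¹`. -/
theorem isMaxwell_mul (hd : o 0 * ι 1 - o 1 * ι 0 = 1) (ho : ∀ A', S.sc o o o A' = 0)
    {φ : smoothFn M} (hφ : ∀ A', S.der o A' φ = S.sc ι o o A' * φ)
    {K : Fin 2 → Fin 2 → smoothFn M} (hK : ∀ B E, K B E = K E B) (h0 : con₂ K o o = 0)
    (hkill : S.IsProjectedKilling (fun y A => ev y (o A)) (fun y A B => ev y (K A B)))
    {c : ℂ} (hc : con₂ K o ι * φ = algebraMap ℂ _ c) :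
    S.IsMaxwell (fun y A B => ev y (-2 * φ ^ 3 * K A B)) := by
  have hk := (S.killing_components hd ho hK h0).1 hkill
  refine (S.maxwell_components hd ho (φ := fun A B => -2 * φ ^ 3 * K A B)
    (fun B E => by rw [hK]) (by rw [con₂_mul, h0, mul_zero])).2 fun A' => ?_
  obtain ⟨e1, e2⟩ := hk A'
  -- Constancy of `K₁ φ` gives `2 φ³ ι·∇K₁ = -ι·∇(φ³ K₁)`, which turns the coefficient of the
  -- Killing equation into that of Maxwell's equation.
  have f1 := congrArg (S.der ι A') hc
  have hp := hφ A'
  have h2 : ∀ δ : Derivation ℂ (smoothFn M) (smoothFn M), δ 2 = 0 := fun δ => δ.map_natCast 2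
  simp only [con₂_mul, Derivation.leibniz, smul_eq_mul, Derivation.leibniz_pow, map_neg, h2,
    Derivation.map_algebraMap, nsmul_eq_mul, Nat.add_one_sub_one, Nat.cast_ofNat] at f1 ⊢
  constructor
  · linear_combination -2 * φ ^ 3 * e1 - 6 * φ ^ 2 * con₂ K o ι * hp
  · linear_combination -2 * φ ^ 3 * e2 - 6 * φ ^ 2 * con₂ K ι ι * hp + 6 * φ ^ 2 * f1

/-- Spin lowering in an Einstein space. -/
theorem IsEinstein.isMaxwell_spinLower {S : SpinSpacetime M} (hE : S.IsEinstein)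
    (hd : o 0 * ι 1 - o 1 * ι 0 = 1) (ho : ∀ A', S.sc o o o A' = 0)
    (hrep : S.IsRepeatedPrincipal (fun y A => ev y (o A)))
    {K : Fin 2 → Fin 2 → smoothFn M} (hK : ∀ B E, K B E = K E B) (h0 : con₂ K o o = 0)
    (hkill : S.IsProjectedKilling (fun y A => ev y (o A)) (fun y A B => ev y (K A B))) :
    S.IsMaxwell (fun y A B => ev y (spinLower S.Ψ K A B)) := by
  have hk := (S.killing_components hd ho hK h0).1 hkill
  obtain ⟨l0, l1, l2⟩ := spinLower_components hd S.Ψ_swap₁ S.Ψ_swap₂ S.Ψ_swap₃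
    (S.con₄_Ψ_eq_zero hrep) hK h0
  refine (S.maxwell_components hd ho (spinLower_symm S.Ψ_swap₁ K) l0).2 fun A' => ?_
  obtain ⟨e1, e2⟩ := hk A'
  obtain ⟨b1, b2⟩ := hE.bianchi_components hd ho hrep A'
  have h2 : ∀ δ : Derivation ℂ (smoothFn M) (smoothFn M), δ 2 = 0 := fun δ => δ.map_natCast 2
  simp only [l1, l2, Derivation.leibniz, smul_eq_mul, map_neg, map_sub, h2]
  constructor
  · linear_combination -2 * con₄ S.Ψ o o ι ι * e1 - 2 * con₂ K o ι * b1
  · linear_combination con₄ S.Ψ o o ι ι * e2 + con₂ K ι ι * b1 - 2 * con₄ S.Ψ o ι ι ι * e1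
      + 2 * con₂ K o ι * b2

/-- The potential pair of an Einstein space. -/
theorem IsEinstein.potential {S : SpinSpacetime M} (hE : S.IsEinstein)
    (hd : o 0 * ι 1 - o 1 * ι 0 = 1) (ho : ∀ A', S.sc o o o A' = 0)
    (hrep : S.IsRepeatedPrincipal (fun y A => ev y (o A))) {φ η : smoothFn M}
    (hφ : ∀ x, ev x φ ≠ 0) (h2 : φ ^ 3 = con₄ S.Ψ o o ι ι)
    (h3 : 3 * φ ^ 3 * η = con₄ S.Ψ o ι ι ι) (A' : Fin 2) :
    S.der o A' φ = S.sc ι o o A' * φ ∧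
      S.der ι A' φ = φ * (S.der o A' η + (2 * S.sc o ι o A' + S.sc ι o o A') * η
        - S.sc o ι ι A') := by
  obtain ⟨b1, b2⟩ := hE.bianchi_components hd ho hrep A'
  have hD3 : ∀ δ : Derivation ℂ (smoothFn M) (smoothFn M), δ 3 = 0 := fun δ => δ.map_natCast 3
  rw [← h2] at b1 b2
  rw [← h3] at b2
  simp only [Derivation.leibniz, smul_eq_mul, Derivation.leibniz_pow, hD3, nsmul_eq_mul,
    Nat.add_one_sub_one, Nat.cast_ofNat] at b1 b2
  -- The Bianchi identities for `φ ^ 3` carry the factor `3 φ²`, which vanishes nowhere and can be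
  -- cancelled.
  have hne : ∀ x, ev x (3 * φ ^ 2) ≠ 0 := fun x => by
    rw [map_mul, map_ofNat, map_pow]
    exact mul_ne_zero (by norm_num) (pow_ne_zero 2 (hφ x))
  have e1 : S.der o A' φ - S.sc ι o o A' * φ = 0 := eq_zero_of_mul hne (by linear_combination b1)
  refine ⟨sub_eq_zero.1 e1, sub_eq_zero.1 (eq_zero_of_mul hne ?_)⟩
  linear_combination b2 + 9 * φ ^ 2 * η * e1

/-- The projected Killing spinor of a potential pair. -/
theorem killing_of_potential (hd : o 0 * ι 1 - o 1 * ι 0 = 1) (ho : ∀ A', S.sc o o o A' = 0)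
    {φ η : smoothFn M} (hφ : ∀ x, ev x φ ≠ 0)
    (hp : ∀ A', S.der o A' φ = S.sc ι o o A' * φ ∧
      S.der ι A' φ = φ * (S.der o A' η + (2 * S.sc o ι o A' + S.sc ι o o A') * η
        - S.sc o ι ι A'))
    {K : Fin 2 → Fin 2 → smoothFn M} (hK : ∀ B E, K B E = K E B) (h0 : con₂ K o o = 0)
    {c : ℂ} (h1 : con₂ K o ι * φ = algebraMap ℂ _ c) (h2 : con₂ K ι ι = 2 * η * con₂ K o ι) :
    S.IsProjectedKilling (fun y A => ev y (o A)) (fun y A B => ev y (K A B)) := by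
  refine (S.killing_components hd ho hK h0).2 fun A' => ?_
  obtain ⟨p1, p2⟩ := hp A'
  have f0 := congrArg (S.der o A') h1
  have f1 := congrArg (S.der ι A') h1
  have hD2 : ∀ δ : Derivation ℂ (smoothFn M) (smoothFn M), δ 2 = 0 := fun δ => δ.map_natCast 2
  simp only [Derivation.leibniz, smul_eq_mul, Derivation.map_algebraMap] at f0 f1
  have e1 : S.der o A' (con₂ K o ι) + S.sc ι o o A' * con₂ K o ι = 0 :=
    eq_zero_of_mul hφ (by linear_combination f0 - con₂ K o ι * p1)
  have e2 : S.der ι A' (con₂ K o ι) + con₂ K o ι * (S.der o A' η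
      + (2 * S.sc o ι o A' + S.sc ι o o A') * η - S.sc o ι ι A') = 0 :=
    eq_zero_of_mul hφ (by linear_combination f1 - con₂ K o ι * p2)
  rw [h2]
  simp only [Derivation.leibniz, smul_eq_mul, hD2]
  exact ⟨by linear_combination e1, by linear_combination 2 * e2 + 2 * η * e1⟩

end SpinSpacetime

/-! ### Pointwise algebra of the potential Killing spinor -/

theorem _root_.ContMDiff.inv_complex {M : Type*} [TopologicalSpace M]
    [ChartedSpace (EuclideanSpace ℝ (Fin 4)) M] {f : M → ℂ}
    (hf : ContMDiff (𝓡 4) 𝓘(ℝ, ℂ) ∞ f) (h : ∀ x, f x ≠ 0) :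
    ContMDiff (𝓡 4) 𝓘(ℝ, ℂ) ∞ (fun x => (f x)⁻¹) := fun x =>
  (contDiffAt_inv ℝ (h x)).contMDiffAt.comp x (hf x)

section Pointwise

variable {o ι : Fin 2 → ℂ}

theorem symProd_comm (κ μ : Fin 2 → ℂ) (A B : Fin 2) : symProd κ μ A B = symProd κ μ B A := by
  rw [symProd, symProd]; ring

theorem symProd_sub (o ι : Fin 2 → ℂ) (η : ℂ) (A B : Fin 2) :
    symProd o (fun D => ι D - η * o D) A B = symProd o ι A B - η * (low o A * low o B) := by
  fin_cases A <;> fin_cases B <;>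
  simp only [Fin.zero_eta, Fin.mk_one, symProd, low_zero, low_one] <;> ring

theorem det_of_low (h : ∑ A, low o A * ι A = 1) : o 0 * ι 1 - o 1 * ι 0 = 1 := by
  rw [Fin.sum_univ_two, low_zero, low_one] at h
  linear_combination h

end Pointwise

section SpinLoweringPotential

variable {o ι : Fin 2 → ℂ}

/-- `-2 Ψ₂ K` is the spin-lowering field if `K₀ = 0` and `K₂ = 2 η K₁`. -/
theorem mul_eq_spinLower (hd : o 0 * ι 1 - o 1 * ι 0 = 1)
    {X : Fin 2 → Fin 2 → Fin 2 → Fin 2 → ℂ} (h₁ : ∀ B E F G, X B E F G = X E B F G)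
    (h₂ : ∀ B E F G, X B E F G = X B F E G) (h₃ : ∀ B E F G, X B E F G = X B E G F)
    (hX : ∀ κ, con₄ X o o o κ = 0) {η : ℂ} (hη : 3 * con₄ X o o ι ι * η = con₄ X o ι ι ι)
    {K : Fin 2 → Fin 2 → ℂ} (hK : ∀ B E, K B E = K E B) (h0 : con₂ K o o = 0)
    (h2 : con₂ K ι ι = 2 * η * con₂ K o ι) (A B : Fin 2) :
    -2 * con₄ X o o ι ι * K A B = spinLower X K A B := by
  obtain ⟨w0, w1, w2⟩ := spinLower_components hd h₁ h₂ h₃ hX hK h0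
  refine eq_of_con₂ hd (K := fun A B => -2 * con₄ X o o ι ι * K A B) (fun A B => by rw [hK])
    (spinLower_symm h₁ K) ?_ ?_ ?_ A B
  · rw [con₂_mul, w0, h0, mul_zero]
  · rw [con₂_mul, w1]
  · rw [con₂_mul, w2, h2, ← hη]
    ring

/-- If `-2 Ψ₂ K` is the spin-lowering field, then `K₂ = 2 η K₁`. -/
theorem con₂_eq_of_spinLower (hd : o 0 * ι 1 - o 1 * ι 0 = 1)
    {X : Fin 2 → Fin 2 → Fin 2 → Fin 2 → ℂ} (h₁ : ∀ B E F G, X B E F G = X E B F G)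
    (h₂ : ∀ B E F G, X B E F G = X B F E G) (h₃ : ∀ B E F G, X B E F G = X B E G F)
    (hX : ∀ κ, con₄ X o o o κ = 0) {η : ℂ} (hη : 3 * con₄ X o o ι ι * η = con₄ X o ι ι ι)
    (hne : con₄ X o o ι ι ≠ 0) {K : Fin 2 → Fin 2 → ℂ} (hK : ∀ B E, K B E = K E B)
    (h0 : con₂ K o o = 0) (h : ∀ A B, -2 * con₄ X o o ι ι * K A B = spinLower X K A B) :
    con₂ K ι ι = 2 * η * con₂ K o ι := by
  obtain ⟨-, -, w2⟩ := spinLower_components hd h₁ h₂ h₃ hX hK h0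
  rw [← funext fun A => funext fun B => h A B, con₂_mul, ← hη] at w2
  refine mul_left_cancel₀ (mul_ne_zero three_ne_zero hne) ?_
  linear_combination -w2

/-- The components of `-2 c φ⁻¹ (o_{(A} ι_{B)} - η o_A o_B)`. -/
theorem con₂_potential (hd : o 0 * ι 1 - o 1 * ι 0 = 1) (c φ η : ℂ) {K : Fin 2 → Fin 2 → ℂ}
    (hK : ∀ A B, K A B = -2 * c * φ⁻¹ * (symProd o ι A B - η * (low o A * low o B))) :
    (∀ A B, K A B = K B A) ∧ con₂ K o o = 0 ∧ con₂ K o ι = c * φ⁻¹ ∧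
      con₂ K ι ι = 2 * η * (c * φ⁻¹) := by
  have hd2 : (o 0 * ι 1 - o 1 * ι 0) * (o 0 * ι 1 - o 1 * ι 0) = 1 := by rw [hd, one_mul]
  refine ⟨fun A B => by rw [hK, hK, symProd_comm]; ring, ?_⟩
  simp only [con₂, hK, symProd, low_zero, low_one, Fin.sum_univ_two]
  refine ⟨by ring, ?_, ?_⟩
  · linear_combination c * φ⁻¹ * hd2
  · linear_combination 2 * η * c * φ⁻¹ * hd2

theorem eq_potential (hd : o 0 * ι 1 - o 1 * ι 0 = 1) (c φ η : ℂ) {K : Fin 2 → Fin 2 → ℂ}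
    (hK : ∀ A B, K A B = K B A) (h0 : con₂ K o o = 0) (h1 : con₂ K o ι = c * φ⁻¹)
    (h2 : con₂ K ι ι = 2 * η * con₂ K o ι) (A B : Fin 2) :
    K A B = -2 * c * φ⁻¹ * (symProd o ι A B - η * (low o A * low o B)) := by
  obtain ⟨k, k0, k1, k2⟩ := con₂_potential hd c φ η
    (K := fun A B => -2 * c * φ⁻¹ * (symProd o ι A B - η * (low o A * low o B))) fun _ _ => rfl
  exact eq_of_con₂ hd hK k (h0.trans k0.symm) (h1.trans k1.symm)
    ((h2.trans (by rw [h1])).trans k2.symm) A B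

end SpinLoweringPotential

/-! ### The potential as a smooth field, and Sachs' law -/

namespace SpinSpacetime

variable {M : Type*} [TopologicalSpace M] [ChartedSpace (EuclideanSpace ℝ (Fin 4)) M]
  [IsManifold (𝓡 4) ∞ M] (S : SpinSpacetime M) {o ι : Fin 2 → smoothFn M}

theorem weylComp_hat (κ μ : M → Fin 2 → ℂ) (η : M → ℂ) (x : M) :
    S.weylComp κ (fun y D => μ y D - η y * κ y D) (fun y D => μ y D - η y * κ y D)
      (fun y D => μ y D - η y * κ y D) x =
    S.weylComp κ μ μ μ x - 3 * η x * S.weylComp κ κ μ μ x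
      + 3 * η x ^ 2 * S.weylComp κ κ κ μ x - η x ^ 3 * S.weylComp κ κ κ κ x := by
  simp only [weylComp, Fin.sum_univ_two, S.weyl_swap₁₂ 1 0, S.weyl_swap₂₃ _ 1 0,
    S.weyl_swap₃₄ _ _ 1 0]
  ring

theorem con₄_weyl_eq_zero (hrep : S.IsRepeatedPrincipal (fun y A => ev y (o A))) (x : M)
    (κ : Fin 2 → ℂ) : con₄ (fun A B C D => S.weyl A B C D x) (fun A => ev x (o A))
      (fun A => ev x (o A)) (fun A => ev x (o A)) κ = 0 := by
  have h := congrArg (ev x) (S.con₄_Ψ_eq_zero hrep fun A => algebraMap ℂ _ (κ A))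
  rw [S.ev_con₄, map_zero] at h
  simp only [AlgHom.commutes] at h
  exact h

/-- Where `Ψ₂` does not vanish, the integrability condition `Ψ₂ K₀ = 0` applies; elsewhere `K₀ = 0`
is assumed. -/
theorem con₂_eq_zero_of_weylComp (hrep : S.IsRepeatedPrincipal (fun y A => ev y (o A)))
    {K : Fin 2 → Fin 2 → smoothFn M}
    (hkill : S.IsProjectedKilling (fun y A => ev y (o A)) (fun y A B => ev y (K A B)))
    (h : ∀ x, S.weylComp (fun y A => ev y (o A)) (fun y A => ev y (o A)) (fun y A => ev y (ι A))
          (fun y A => ev y (ι A)) x ≠ 0 ∨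
        comp₂ (fun A B => ev x (K A B)) (fun A => ev x (o A)) (fun A => ev x (o A)) = 0) :
    con₂ K o o = 0 := eq_of_ev fun x => by
  rw [ev_con₂, map_zero]
  have hK : ∀ B E, K B E = K E B := fun B E => eq_of_ev fun x => hkill.1 x B E
  exact (h x).elim (fun hx => (mul_eq_zero.1 (S.weylComp_mul_comp₂ _ hK hkill hrep x)
      ).resolve_left hx) id

/-- `-2 c φ⁻¹ (o_{(A} ι_{B)} - η o_A o_B)` as smooth functions. -/
theorem exists_smooth_potential (o ι : Fin 2 → smoothFn M) {φ : smoothFn M} (η : smoothFn M)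
    (hφ : ∀ x, ev x φ ≠ 0) (c : ℂ) :
    ∃ K : Fin 2 → Fin 2 → smoothFn M, ∀ x A B, ev x (K A B) = -2 * c * (φ.1 x)⁻¹ *
        (symProd (fun A => ev x (o A)) (fun A => ev x (ι A)) A B
          - η.1 x * (low (fun A => ev x (o A)) A * low (fun A => ev x (o A)) B)) := by
  obtain ⟨φi, hi⟩ : ∃ φi : smoothFn M, ∀ x, ev x φi = (φ.1 x)⁻¹ :=
    ⟨⟨_, ContMDiff.inv_complex φ.2 hφ⟩, fun _ => rfl⟩
  obtain ⟨k, hk⟩ : ∃ k : smoothFn M, ∀ x, ev x k = -2 * c :=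
    ⟨algebraMap ℂ _ (-2 * c), fun x => (ev x).commutes _⟩
  obtain ⟨h, hh⟩ : ∃ h : smoothFn M, ∀ x, ev x h = 1 / 2 :=
    ⟨algebraMap ℂ _ (1 / 2), fun x => (ev x).commutes _⟩
  refine ⟨fun A B => k * φi * (h * (lowFn o A * lowFn ι B + lowFn o B * lowFn ι A)
    - η * (lowFn o A * lowFn o B)), fun x A B => ?_⟩
  simp only [map_mul, map_sub, map_add, hk, hi, hh, ev_lowFn, symProd]
  rw [ev_apply x η]
  ring

theorem isProjectedKilling_potential (hd : o 0 * ι 1 - o 1 * ι 0 = 1)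
    (ho : ∀ A', S.sc o o o A' = 0) {φ η : smoothFn M} (hφ : ∀ x, ev x φ ≠ 0)
    (hp : ∀ A', S.der o A' φ = S.sc ι o o A' * φ ∧
      S.der ι A' φ = φ * (S.der o A' η + (2 * S.sc o ι o A' + S.sc ι o o A') * η
        - S.sc o ι ι A')) (c : ℂ) {K : Fin 2 → Fin 2 → smoothFn M}
    (hK : ∀ x A B, ev x (K A B) = -2 * c * (φ.1 x)⁻¹ *
        (symProd (fun A => ev x (o A)) (fun A => ev x (ι A)) A B
          - η.1 x * (low (fun A => ev x (o A)) A * low (fun A => ev x (o A)) B))) :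
    S.IsProjectedKilling (fun y A => ev y (o A)) (fun y A B => ev y (K A B)) := by
  have hc := fun x => con₂_potential (o := fun A => ev x (o A)) (ι := fun A => ev x (ι A))
    (ev_det hd x) c (φ.1 x) (η.1 x) (hK x)
  have e0 : con₂ K o o = 0 := eq_of_ev fun x => by
    rw [ev_con₂, map_zero]; exact (hc x).2.1
  have e1 : ∀ x, ev x (con₂ K o ι) = c * (φ.1 x)⁻¹ := fun x => by
    rw [ev_con₂]; exact (hc x).2.2.1
  have e2 : ∀ x, ev x (con₂ K ι ι) = 2 * η.1 x * (c * (φ.1 x)⁻¹) := fun x => by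
    rw [ev_con₂]; exact (hc x).2.2.2
  refine S.killing_of_potential hd ho hφ hp (fun B E => eq_of_ev fun x => (hc x).1 B E) e0
    (c := c) (eq_of_ev fun x => ?_) (eq_of_ev fun x => ?_)
  · rw [map_mul, e1, AlgHom.commutes]
    exact inv_mul_cancel_right₀ (hφ x) c
  · rw [map_mul, map_mul, map_ofNat, e1, e2, ev_apply x η]

end SpinSpacetime

namespace SpinSpacetime

variable {M : Type*} [TopologicalSpace M] [ChartedSpace (EuclideanSpace ℝ (Fin 4)) M]
  [IsManifold (𝓡 4) ∞ M] (S : SpinSpacetime M)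

section Pointwise

variable {o ι : M → Fin 2 → ℂ} {x : M}

theorem weylContract_components (hd : o x 0 * ι x 1 - o x 1 * ι x 0 = 1)
    (hX : ∀ κ, con₄ (fun A B C D => S.weyl A B C D x) (o x) (o x) (o x) κ = 0)
    {K : M → Fin 2 → Fin 2 → ℂ} (hK : ∀ A B, K x A B = K x B A)
    (h0 : comp₂ (K x) (o x) (o x) = 0) :
    comp₂ (S.weylContract K x) (o x) (o x) = 0 ∧
    comp₂ (S.weylContract K x) (o x) (ι x) =
      -2 * S.weylComp o o ι ι x * comp₂ (K x) (o x) (ι x) ∧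
    comp₂ (S.weylContract K x) (ι x) (ι x) = S.weylComp o o ι ι x * comp₂ (K x) (ι x) (ι x)
      - 2 * S.weylComp o ι ι ι x * comp₂ (K x) (o x) (ι x) := by
  rw [S.weylContract_eq]
  exact spinLower_components hd (fun A B C D => S.weyl_swap₁₂ A B C D x)
    (fun A B C D => S.weyl_swap₂₃ A B C D x) (fun A B C D => S.weyl_swap₃₄ A B C D x) hX hK h0

theorem mul_eq_weylContract (hd : o x 0 * ι x 1 - o x 1 * ι x 0 = 1)
    (hX : ∀ κ, con₄ (fun A B C D => S.weyl A B C D x) (o x) (o x) (o x) κ = 0)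
    {η : ℂ} (hη : 3 * S.weylComp o o ι ι x * η = S.weylComp o ι ι ι x)
    {K : M → Fin 2 → Fin 2 → ℂ} (hK : ∀ A B, K x A B = K x B A)
    (h0 : comp₂ (K x) (o x) (o x) = 0)
    (h2 : comp₂ (K x) (ι x) (ι x) = 2 * η * comp₂ (K x) (o x) (ι x)) (A B : Fin 2) :
    -2 * S.weylComp o o ι ι x * K x A B = S.weylContract K x A B := by
  rw [S.weylContract_eq]
  exact mul_eq_spinLower hd (fun A B C D => S.weyl_swap₁₂ A B C D x)
    (fun A B C D => S.weyl_swap₂₃ A B C D x) (fun A B C D => S.weyl_swap₃₄ A B C D x) hX hη hK h0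
    h2 A B

/-- `-2 Ψ₂ K` is the spin-lowering field if and only if `K` is a multiple of the potential. -/
theorem mul_eq_weylContract_iff (hd : o x 0 * ι x 1 - o x 1 * ι x 0 = 1)
    (hX : ∀ κ, con₄ (fun A B C D => S.weyl A B C D x) (o x) (o x) (o x) κ = 0)
    {η : ℂ} (hη : 3 * S.weylComp o o ι ι x * η = S.weylComp o ι ι ι x)
    (hne : S.weylComp o o ι ι x ≠ 0)
    {K : M → Fin 2 → Fin 2 → ℂ} (hK : ∀ A B, K x A B = K x B A)
    (h0 : comp₂ (K x) (o x) (o x) = 0) {c φ : ℂ} (h1 : comp₂ (K x) (o x) (ι x) = c * φ⁻¹) :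
    (∀ A B, -2 * S.weylComp o o ι ι x * K x A B = S.weylContract K x A B) ↔
      ∀ A B, K x A B = -2 * c * φ⁻¹ *
        (symProd (o x) (ι x) A B - η * (low (o x) A * low (o x) B)) := by
  constructor
  · intro h
    rw [S.weylContract_eq] at h
    exact eq_potential hd c φ η hK h0 h1 (con₂_eq_of_spinLower hd
      (fun A B C D => S.weyl_swap₁₂ A B C D x) (fun A B C D => S.weyl_swap₂₃ A B C D x)
      (fun A B C D => S.weyl_swap₃₄ A B C D x) hX hη hne hK h0 h)
  · intro h
    obtain ⟨k, k0, k1, k2⟩ := con₂_potential hd c φ η h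
    exact S.mul_eq_weylContract hd hX hη k k0 (k2.trans (congrArg (2 * η * ·) k1).symm)

/-- The spin-lowering field of the potential `-2 c φ⁻¹ (o_{(A} ι_{B)} - η o_A o_B)`. -/
theorem weylContract_potential (hd : o x 0 * ι x 1 - o x 1 * ι x 0 = 1)
    (hX : ∀ κ, con₄ (fun A B C D => S.weyl A B C D x) (o x) (o x) (o x) κ = 0)
    {c φ η : ℂ} (hη : 3 * S.weylComp o o ι ι x * η = S.weylComp o ι ι ι x)
    (hφ : φ ≠ 0) (hφ3 : φ ^ 3 = S.weylComp o o ι ι x) {K : M → Fin 2 → Fin 2 → ℂ}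
    (hK : ∀ A B, K x A B = -2 * c * φ⁻¹ *
        (symProd (o x) (ι x) A B - η * (low (o x) A * low (o x) B))) :
    comp₂ (K x) (o x) (ι x) = c * φ⁻¹ ∧
    (∀ A B, -2 * S.weylComp o o ι ι x * K x A B = S.weylContract K x A B) ∧
    comp₂ (S.weylContract K x) (o x) (o x) = 0 ∧
    comp₂ (S.weylContract K x) (o x) (ι x) = -2 * c * φ ^ 2 ∧
    comp₂ (S.weylContract K x) (ι x) (ι x) = -2 * c * (2 * S.weylComp o ι ι ι x / (3 * φ)) ∧
    ∀ A B, S.weylContract K x A B =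
      4 * c * φ ^ 2 * symProd (o x) (fun D => ι x D - η * o x D) A B := by
  obtain ⟨k, k0, k1, k2⟩ : (∀ A B, K x A B = K x B A) ∧ comp₂ (K x) (o x) (o x) = 0 ∧
      comp₂ (K x) (o x) (ι x) = c * φ⁻¹ ∧ comp₂ (K x) (ι x) (ι x) = 2 * η * (c * φ⁻¹) :=
    con₂_potential hd c φ η hK
  obtain ⟨w0, w1, w2⟩ := S.weylContract_components hd hX k k0
  have hm := S.mul_eq_weylContract hd hX hη k k0 (by rw [k1, k2])
  refine ⟨k1, hm, w0, ?_, ?_, fun A B => ?_⟩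
  · rw [w1, k1, ← hφ3]
    field_simp
  · rw [w2, k1, k2, ← hη, ← hφ3]
    field_simp
    ring
  · rw [← hm, hK, ← hφ3, symProd_sub]
    field_simp
    ring

end Pointwise

variable {o ι : Fin 2 → smoothFn M}

/-- Sachs' conservation law. -/
theorem IsEinstein.isClosed_symProd {S : SpinSpacetime M} (hE : S.IsEinstein)
    (hd : o 0 * ι 1 - o 1 * ι 0 = 1) (ho : ∀ A', S.sc o o o A' = 0)
    (hrep : S.IsRepeatedPrincipal (fun y A => ev y (o A))) {φ η : smoothFn M}
    (hφ : ∀ x, ev x φ ≠ 0) (h2 : φ ^ 3 = con₄ S.Ψ o o ι ι)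
    (h3 : 3 * φ ^ 3 * η = con₄ S.Ψ o ι ι ι) :
    IsClosedTwoForm (S.maxwellForm (fun x A B => φ.1 x ^ 2 *
      symProd (fun A => ev x (o A)) (fun D => ev x (ι D) - η.1 x * ev x (o D)) A B)) := by
  -- The constant `c = 1/4` normalises the factor `4 c` of the spin-lowering field to `1`.
  obtain ⟨K, hK⟩ := exists_smooth_potential o ι η hφ (1 / 4)
  have hkill := S.isProjectedKilling_potential hd ho hφ (hE.potential hd ho hrep hφ h2 h3) _ hK
  have hx := fun x => con₂_potential (o := fun A => ev x (o A)) (ι := fun A => ev x (ι A))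
    (ev_det hd x) (1 / 4) (φ.1 x) (η.1 x) (hK x)
  have h0 : con₂ K o o = 0 := eq_of_ev fun x => by
    rw [ev_con₂, map_zero]; exact (hx x).2.1
  have hm := hE.isMaxwell_spinLower hd ho hrep (fun B E => eq_of_ev fun x => (hx x).1 B E) h0 hkill
  have hcl := S.isClosed_of_isMaxwell (spinLower_symm S.Ψ_swap₁ K) hm
  rw [← S.ev_spinLower] at hcl
  have e : S.weylContract (fun y A B => ev y (K A B)) = fun x A B => φ.1 x ^ 2 *
      symProd (fun A => ev x (o A)) (fun D => ev x (ι D) - η.1 x * ev x (o D)) A B := by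
    funext x A B
    have hη : 3 * S.weylComp (fun y A => ev y (o A)) (fun y A => ev y (o A))
        (fun y A => ev y (ι A)) (fun y A => ev y (ι A)) x * η.1 x =
        S.weylComp (fun y A => ev y (o A)) (fun y A => ev y (ι A))
        (fun y A => ev y (ι A)) (fun y A => ev y (ι A)) x := by
      have h := congrArg (ev x) h3
      rw [h2, map_mul, map_mul, map_ofNat, S.ev_con₄, S.ev_con₄] at h
      exact h
    have hφ3 : φ.1 x ^ 3 = S.weylComp (fun y A => ev y (o A)) (fun y A => ev y (o A))
        (fun y A => ev y (ι A)) (fun y A => ev y (ι A)) x := by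
      rw [← S.ev_con₄, ← h2, map_pow, ev_apply]
    have h := (S.weylContract_potential (φ := φ.1 x) (o := fun y A => ev y (o A))
      (ι := fun y A => ev y (ι A)) (K := fun y A B => ev y (K A B)) (ev_det hd x)
      (S.con₄_weyl_eq_zero hrep x) hη (hφ x) hφ3 (hK x)).2.2.2.2.2 A B
    rw [h, mul_one_div_cancel (by norm_num : (4 : ℂ) ≠ 0), one_mul]
  rwa [e] at hcl

/-- The scalar `Ψ₃` of the dyad `(o, ι - η o)` vanishes for `3 Ψ₂ η = Ψ₃`. -/
theorem weylComp_hat_eq_zero (hrep : S.IsRepeatedPrincipal (fun y A => ev y (o A))) {η : M → ℂ}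
    {x : M} (hη : 3 * S.weylComp (fun y A => ev y (o A)) (fun y A => ev y (o A))
        (fun y A => ev y (ι A)) (fun y A => ev y (ι A)) x * η x =
      S.weylComp (fun y A => ev y (o A)) (fun y A => ev y (ι A))
        (fun y A => ev y (ι A)) (fun y A => ev y (ι A)) x) :
    S.weylComp (fun y A => ev y (o A)) (fun y D => ev y (ι D) - η y * ev y (o D))
      (fun y D => ev y (ι D) - η y * ev y (o D)) (fun y D => ev y (ι D) - η y * ev y (o D)) x
      = 0 := by
  have z : ∀ κ : Fin 2 → smoothFn M, S.weylComp (fun y A => ev y (o A)) (fun y A => ev y (o A))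
      (fun y A => ev y (o A)) (fun y A => ev y (κ A)) x = 0 := fun κ => by
    rw [← S.ev_con₄, S.con₄_Ψ_eq_zero hrep, map_zero]
  rw [S.weylComp_hat (fun y A => ev y (o A)) (fun y A => ev y (ι A)), z, z, ← hη]
  ring

/-- The Maxwell field `-2 φ³ K` is closed as a two-form. -/
theorem isMaxwell_and_isClosed_mul (hd : o 0 * ι 1 - o 1 * ι 0 = 1)
    (ho : ∀ A', S.sc o o o A' = 0) {φ : smoothFn M} (hne : ∀ x, ev x φ ≠ 0)
    (hφ : ∀ A', S.der o A' φ = S.sc ι o o A' * φ) {K : Fin 2 → Fin 2 → smoothFn M}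
    (h0 : con₂ K o o = 0)
    (hkill : S.IsProjectedKilling (fun y A => ev y (o A)) (fun y A B => ev y (K A B))) {c : ℂ}
    (hc : ∀ x, comp₂ (fun A B => ev x (K A B)) (fun A => ev x (o A)) (fun A => ev x (ι A)) =
      c * (φ.1 x)⁻¹) :
    S.IsMaxwell (fun x A B => -2 * φ.1 x ^ 3 * ev x (K A B)) ∧
      IsClosedTwoForm (S.maxwellForm (fun x A B => -2 * φ.1 x ^ 3 * ev x (K A B))) := by
  have hK : ∀ B E, K B E = K E B := fun B E => eq_of_ev fun x => hkill.1 x B E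
  have hm := S.isMaxwell_mul hd ho hφ hK h0 hkill (c := c) (eq_of_ev fun x => by
    rw [map_mul, ev_con₂, hc, AlgHom.commutes]
    exact inv_mul_cancel_right₀ (hne x) c)
  have hF : (fun (x : M) A B => -2 * φ.1 x ^ 3 * ev x (K A B)) =
      fun y A B => ev y (-2 * φ ^ 3 * K A B) := by
    funext y A B
    simp only [map_mul, map_neg, map_pow, map_ofNat, ev_apply y φ]
  rw [hF]
  exact ⟨hm, S.isClosed_of_isMaxwell (fun A B => by rw [hK]) hm⟩

end SpinSpacetime

end

end TwoSpinor

/-! ### The main theorem -/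

theorem mainTheorem6 {M : Type*} [TopologicalSpace M]
    [ChartedSpace (EuclideanSpace ℝ (Fin 4)) M] [IsManifold (𝓡 4) ∞ M]
    (S : SpinSpacetime M) (o ι : M → Fin 2 → ℂ)
    (ho : ∀ A, ContMDiff (𝓡 4) 𝓘(ℝ, ℂ) ∞ (fun x => o x A))
    (hι : ∀ A, ContMDiff (𝓡 4) 𝓘(ℝ, ℂ) ∞ (fun x => ι x A))
    (hdyad : ∀ x, ∑ A, low (o x) A * ι x A = 1)
    (hsfr : S.IsShearFreeRay o)
    (hrep : S.IsRepeatedPrincipal o) :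
    -- the general case
    (∀ φ η : M → ℂ,
      ContMDiff (𝓡 4) 𝓘(ℝ, ℂ) ∞ φ → ContMDiff (𝓡 4) 𝓘(ℝ, ℂ) ∞ η →
      S.IsPotentialPair o ι φ η →
      ∀ K : M → Fin 2 → Fin 2 → ℂ,
        (∀ A B, ContMDiff (𝓡 4) 𝓘(ℝ, ℂ) ∞ (fun x => K x A B)) →
        S.IsProjectedKilling o K →
        (∀ x, S.weylComp o o ι ι x ≠ 0 ∨ comp₂ (K x) (o x) (o x) = 0) →
        ∀ c : ℂ, (∀ x, comp₂ (K x) (o x) (ι x) = c * (φ x)⁻¹) →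
          S.IsMaxwell (fun x A B => -2 * φ x ^ 3 * K x A B) ∧
          IsClosedTwoForm (S.maxwellForm (fun x A B => -2 * φ x ^ 3 * K x A B))) ∧
    -- the Einstein case
    (S.IsEinstein → (∀ x, S.weylComp o o ι ι x ≠ 0) →
      -- spin lowering
      (∀ K : M → Fin 2 → Fin 2 → ℂ,
        (∀ A B, ContMDiff (𝓡 4) 𝓘(ℝ, ℂ) ∞ (fun x => K x A B)) →
        S.IsProjectedKilling o K →
          S.IsMaxwell (S.weylContract K) ∧
          IsClosedTwoForm (S.maxwellForm (S.weylContract K))) ∧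
      ∀ φ η : M → ℂ, ContMDiff (𝓡 4) 𝓘(ℝ, ℂ) ∞ φ →
        (∀ x, φ x ^ 3 = S.weylComp o o ι ι x) →
        (∀ x, η x = S.weylComp o ι ι ι x / (3 * S.weylComp o o ι ι x)) →
        S.IsPotentialPair o ι φ η ∧
        -- the Maxwell field `-2 Ψ₂ K`, and when it is the spin-lowering field
        (∀ K : M → Fin 2 → Fin 2 → ℂ,
          (∀ A B, ContMDiff (𝓡 4) 𝓘(ℝ, ℂ) ∞ (fun x => K x A B)) →
          S.IsProjectedKilling o K →
          ∀ c : ℂ, (∀ x, comp₂ (K x) (o x) (ι x) = c * (φ x)⁻¹) →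
            S.IsMaxwell (fun x A B => -2 * S.weylComp o o ι ι x * K x A B) ∧
            IsClosedTwoForm
              (S.maxwellForm (fun x A B => -2 * S.weylComp o o ι ι x * K x A B)) ∧
            ((∀ x A B, -2 * S.weylComp o o ι ι x * K x A B = S.weylContract K x A B) ↔
              ∀ x A B, K x A B = -2 * c * (φ x)⁻¹ *
                (symProd (o x) (ι x) A B - η x * (low (o x) A * low (o x) B)))) ∧
        (∀ (c : ℂ) (K : M → Fin 2 → Fin 2 → ℂ),
          (∀ x A B, K x A B = -2 * c * (φ x)⁻¹ *
            (symProd (o x) (ι x) A B - η x * (low (o x) A * low (o x) B))) →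
          S.IsProjectedKilling o K ∧
          (∀ x, comp₂ (K x) (o x) (ι x) = c * (φ x)⁻¹) ∧
          (∀ x A B, -2 * S.weylComp o o ι ι x * K x A B = S.weylContract K x A B) ∧
          -- the components of the Maxwell field
          (∀ x, comp₂ (S.weylContract K x) (o x) (o x) = 0) ∧
          (∀ x, comp₂ (S.weylContract K x) (o x) (ι x) = -2 * c * φ x ^ 2) ∧
          (∀ x, comp₂ (S.weylContract K x) (ι x) (ι x) =
            -2 * c * (2 * S.weylComp o ι ι ι x / (3 * φ x))) ∧
          -- in terms of the dyad `(o, ι - η o)`, whose scalar `Ψ₃` vanishes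
          (∀ x A B, S.weylContract K x A B =
            4 * c * φ x ^ 2 * symProd (o x) (fun D => ι x D - η x * o x D) A B)) ∧
        -- Sachs' conservation law
        (∀ x, S.weylComp o (fun y D => ι y D - η y * o y D) (fun y D => ι y D - η y * o y D)
          (fun y D => ι y D - η y * o y D) x = 0) ∧
        IsClosedTwoForm (S.maxwellForm (fun x A B =>
          φ x ^ 2 * symProd (o x) (fun D => ι x D - η x * o x D) A B)) ∧
        ((∀ x, S.weylComp o ι ι ι x = 0) →
          IsClosedTwoForm (S.maxwellForm (fun x A B =>
            φ x ^ 2 * symProd (o x) (ι x) A B)))) := by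
  -- Fields with smooth components are replaced by tuples in `smoothFn M`, where the algebraic
  -- lemmas apply.
  obtain ⟨o, rfl⟩ : ∃ o' : Fin 2 → smoothFn M, o = fun y A => ev y (o' A) :=
    ⟨fun A => ⟨_, ho A⟩, rfl⟩
  obtain ⟨ι, rfl⟩ : ∃ ι' : Fin 2 → smoothFn M, ι = fun y A => ev y (ι' A) :=
    ⟨fun A => ⟨_, hι A⟩, rfl⟩
  have hdx : ∀ x, ev x (o 0) * ev x (ι 1) - ev x (o 1) * ev x (ι 0) = 1 :=
    fun x => det_of_low (o := fun A => ev x (o A)) (ι := fun A => ev x (ι A)) (hdyad x)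
  have hd : o 0 * ι 1 - o 1 * ι 0 = 1 := eq_of_ev fun x => by
    simpa only [map_sub, map_mul, map_one] using hdx x
  have hs := (S.isShearFreeRay_iff o).1 hsfr
  have hX := S.con₄_weyl_eq_zero hrep
  have lift : ∀ {K : M → Fin 2 → Fin 2 → ℂ},
      (∀ A B, ContMDiff (𝓡 4) 𝓘(ℝ, ℂ) ∞ (fun x => K x A B)) →
      ∃ K' : Fin 2 → Fin 2 → smoothFn M, K = fun y A B => ev y (K' A B) :=
    fun hK => ⟨fun A B => ⟨_, hK A B⟩, rfl⟩
  refine ⟨?_, fun hE hΨ => ⟨?_, ?_⟩⟩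
  · intro φ η hφ hη hpot K hKs hkill hK0 c hc
    obtain ⟨φ, rfl⟩ : ∃ φ' : smoothFn M, φ = φ'.1 := ⟨⟨_, hφ⟩, rfl⟩
    obtain ⟨η, rfl⟩ : ∃ η' : smoothFn M, η = η'.1 := ⟨⟨_, hη⟩, rfl⟩
    obtain ⟨K, rfl⟩ := lift hKs
    have hne : ∀ x, ev x φ ≠ 0 := hpot.1
    exact S.isMaxwell_and_isClosed_mul hd hs hne
      (fun A' => ((S.isPotentialPair_iff hd η hne).1 hpot A').1)
      (S.con₂_eq_zero_of_weylComp hrep hkill hK0) hkill hc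
  · intro K hKs hkill
    obtain ⟨K, rfl⟩ := lift hKs
    have hm := hE.isMaxwell_spinLower hd hs hrep (fun B E => eq_of_ev fun x => hkill.1 x B E)
      (S.con₂_eq_zero_of_weylComp hrep hkill fun x => Or.inl (hΨ x)) hkill
    rw [S.ev_spinLower]
    exact ⟨hm, S.isClosed_of_isMaxwell (spinLower_symm S.Ψ_swap₁ K) hm⟩
  intro φ η hφ hφ3 hη
  obtain ⟨φ, rfl⟩ : ∃ φ' : smoothFn M, φ = φ'.1 := ⟨⟨_, hφ⟩, rfl⟩
  have hne : ∀ x, ev x φ ≠ 0 := fun x h0 => hΨ x (by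
    rw [← hφ3, ← ev_apply, h0, zero_pow three_ne_zero])
  have hΨ3 : ∀ x, ev x (3 * con₄ S.Ψ o o ι ι) ≠ 0 := fun x => by
    rw [map_mul, map_ofNat, S.ev_con₄]
    exact mul_ne_zero three_ne_zero (hΨ x)
  -- Smoothness of `η` is not assumed: it is a quotient of Weyl scalars whose denominator vanishes
  -- nowhere.
  obtain ⟨η, rfl⟩ : ∃ η' : smoothFn M, η = η'.1 :=
    ⟨con₄ S.Ψ o ι ι ι * ⟨_, ContMDiff.inv_complex (3 * con₄ S.Ψ o o ι ι).2 hΨ3⟩, funext fun x => by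
      rw [hη, div_eq_mul_inv, ← S.ev_con₄, ← S.ev_con₄]
      rfl⟩
  have hη' := fun x => (congrArg _ (hη x)).trans
    (mul_div_cancel₀ _ (mul_ne_zero three_ne_zero (hΨ x)))
  have P2 : φ ^ 3 = con₄ S.Ψ o o ι ι := eq_of_ev fun x => by
    rw [map_pow, S.ev_con₄, ← hφ3, ev_apply]
  have P3 : 3 * φ ^ 3 * η = con₄ S.Ψ o ι ι ι := eq_of_ev fun x => by
    rw [P2, map_mul, map_mul, map_ofNat, S.ev_con₄, S.ev_con₄, ← hη', ev_apply]
  have hp := hE.potential hd hs hrep hne P2 P3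
  have hcl := hE.isClosed_symProd hd hs hrep hne P2 P3
  refine ⟨(S.isPotentialPair_iff hd η hne).2 hp, ?_, ?_,
    fun x => S.weylComp_hat_eq_zero hrep (hη' x), hcl, fun h3 => ?_⟩
  · intro K hKs hk c hc
    obtain ⟨K, rfl⟩ := lift hKs
    have h0 := S.con₂_eq_zero_of_weylComp hrep hk fun x => Or.inl (hΨ x)
    have hm := S.isMaxwell_and_isClosed_mul hd hs hne (fun A' => (hp A').1) h0 hk hc
    simp only [hφ3] at hm
    refine ⟨hm.1, hm.2, forall_congr' fun x => ?_⟩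
    exact S.mul_eq_weylContract_iff (o := fun y A => ev y (o A)) (ι := fun y A => ev y (ι A))
      (K := fun y A B => ev y (K A B)) (hdx x) (hX x) (hη' x) (hΨ x) (hk.1 x)
      (by rw [← ev_con₂, h0, map_zero]) (hc x)
  · intro c K hK
    -- The formula determines `K`, so `K` coincides with the smooth potential and its smoothness is
    -- automatic.
    obtain ⟨K', hK'⟩ := SpinSpacetime.exists_smooth_potential o ι η hne c
    obtain rfl : K = fun y A B => ev y (K' A B) :=
      funext fun x => funext fun A => funext fun B => (hK x A B).trans (hK' x A B).symm
    have hw := fun x => S.weylContract_potential (o := fun y A => ev y (o A))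
      (ι := fun y A => ev y (ι A)) (K := fun y A B => ev y (K' A B)) (φ := φ.1 x) (hdx x) (hX x)
      (hη' x) (hne x) (hφ3 x) (hK x)
    exact ⟨S.isProjectedKilling_potential hd hs hne hp c hK', fun x => (hw x).1,
      fun x => (hw x).2.1, fun x => (hw x).2.2.1, fun x => (hw x).2.2.2.1,
      fun x => (hw x).2.2.2.2.1, fun x => (hw x).2.2.2.2.2⟩
  -- For `Ψ₃ = 0` the correction `η` vanishes and the adapted dyad is the given one.
  · have hz : ∀ x, η.1 x = 0 := fun x => by rw [hη, h3, zero_div]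
    simpa only [hz, zero_mul, sub_zero] using hcl
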